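/- Let $d\ge 2$ and let $D$ be a probability distribution on $\mathbb Z^d$ that is invariant under the symmetries of $\mathbb Z^d$ (signed permutations of the coordinates), with $D(\pm e_i)=p_1>0$ for $i=1,\dots,d$. **Walks and weights.** A plaquette is a set $\{x,x+u,x+v,x+u+v\}$ with $u,v\in\{\pm e_1,\dots,\pm e_d\}$, $u\notin\{\pm v\}$; two nearest-neighbour edges of $\mathbb Z^d$ are adjacent if their endpoints form a plaquette. An $n$-step walk is a sequence $\omega=(\omega_0,\dots,\omega_n)$ in $\mathbb Z^d$ with $\omega_{i+1}\ne\omega_i$; $\mathcal W_n(x)$ is the set of $n$-step walks from $o$ to $x$, $\Gamma_n(x)\subset\mathcal W_n(x)$ is the set of self-avoiding ones, and $\mathbb P_n(\omega)=\prod_{i<n}D(\omega_{i+1}-\omega_i)$. For $\kappa\ge 0$ put $W_\kappa(\omega)=(1+\kappa)^{|\mathrm{adj}(\omega)|}\,\mathbb P_n(\omega)$, where $\mathrm{adj}(\omega)$ is the set of plaquettes spanned by pairs of adjacent edges of $\omega$. Let $$G_{z,\kappa}(x)=\sum_{n\ge0}\sum_{\omega\in\Gamma_n(x)}z^nW_\kappa(\omega),\qquad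 H_{z,\kappa}(x)=G_{z,\kappa}(x)-\delta_{x,o},\qquad r_\kappa(x)=\mathbf 1\{x=o\}+\kappa\,\mathbf 1\{\|x\|_\infty=1\},$$ let $c_n(\kappa)$ be the total weight $\sum_\omega W_\kappa(\omega)$ of the $n$-step self-avoiding walks from $o$, and let $z_c=\sup\{z\ge0:\sum_n c_n(\kappa)z^n<\infty\}$, $z_0=(1+\kappa)^{-2(d-1)}$, $k_0=2d(d-1)$. **Lace expansion coefficients.** Let $U_{ij}(\omega)=\mathbf 1\{\omega_i=\omega_j\}-\kappa\,\mathbf 1\{\{\omega_i,\omega_{i+1}\}\text{ and }\{\omega_{j-1},\omega_j\}\text{ are adjacent edges}\}$. A graph on $\{0,\dots,n\}$ is a set of pairs $ij$ with $0\le i$, $i+1<j\le n$; it is connected if for every $0<j<n$ it has an edge $ik$ with $i<j<k$; a lace is a connected graph that becomes disconnected when any one of its edges is removed. For a connected graph $\mathcal G$, let $\mathsf L(\mathcal G)$ be the lace with edges $s_it_i$ given by $s_1=0$, $t_1=\max\{t: 0t\in \mathcal G\}$, $t_{i+1}=\max\{t:\exists s<t_i,\ st\in \mathcal G\}$, $s_{i+1}=\min\{s: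 st_{i+1}\in \mathcal G\}$. For a lace $L$, let $\mathcal C(L)$ be the set of pairs $ij\notin L$ with $\mathsf L(L\cup\{ij\})=L$. Let $J^{(m)}_{[0,n]}(\omega)$ be the sum over laces $L$ on $\{0,\dots,n\}$ with $m$ edges of $\prod_{ij\in L}(-U_{ij}(\omega))\prod_{ij\in\mathcal C(L)}(1-U_{ij}(\omega))$, and let $$\pi^{(m)}_{z,\kappa}(x)=\sum_{n\ge2}\sum_{\omega\in\mathcal W_n(x)}z^n\,\mathbb P_n(\omega)\,J^{(m)}_{[0,n]}(\omega).$$ **Proposition.** There is a $\kappa_0>0$, depending only on $d$ and $p_1$, such that for all $D$ as above, all $0\le\kappa\le\kappa_0$, all $z$ with $z_0\le z<z_c$ and all $x\in\mathbb Z^d$, the series defining $\pi^{(m)}_{z,\kappa}(x)$ is absolutely convergent for every $m\ge1$, the right-hand sides below are finite, and the following bounds hold. For $m=1$, $$|\pi^{(1)}_{z,\kappa}(x)|\le(1+\kappa)^{2k_0}\,z\,r_\kappa(x)\,(D*H_{z,\kappa})(x),$$ where $(f*g)(x)=\sum_{y}f(y)g(x-y)$ and $(D*H_{z,\kappa})(x)$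 is finite. For every $m\ge2$, $$|\pi^{(m)}_{z,\kappa}(x)|\le(1+\kappa)^{(4m-2)k_0}\sum_{(y_2,\dots,y_{2m-1})\in(\mathbb Z^d)^{2m-2}}H(y_2)\,r(y_3)\Big[\prod_{j=1}^{m-2}H(y_{2j+1}-y_{2j})\,G(y_{2j+2}-y_{2j+1})\,r(y_{2j+3}-y_{2j})\Big]H(y_{2m-1}-y_{2m-2})\,H(x-y_{2m-1})\,r(x-y_{2m-2}),$$ where $H=H_{z,\kappa}$, $G=G_{z,\kappa}$, $r=r_\kappa$, and the empty product (for $m=2$) is $1$. -/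

import Mathlib

open scoped NNReal ENNReal

noncomputable section

namespace ASAW

/-! ### The lattice, plaquettes and adjacent edges -/

/-- Vertices of the lattice `ℤ^d`. -/
abbrev Vtx (d : ℕ) : Type := Fin d → ℤ

/-- `u` is one of the `2d` generators `±e_i` of `ℤ^d`. -/
def IsGenerator {d : ℕ} (u : Vtx d) : Prop :=
  ∃ i : Fin d, u = Pi.single i 1 ∨ u = -Pi.single i 1

/-- A plaquette is a set of vertices `{x, x+u, x+v, x+u+v}` with generators `u ∉ {v, -v}`. -/
def IsPlaquette {d : ℕ} (P : Set (Vtx d)) : Prop :=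
  ∃ x u v : Vtx d, IsGenerator u ∧ IsGenerator v ∧ u ≠ v ∧ u ≠ -v ∧
    P = {x, x + u, x + v, x + u + v}

/-- `e` is a nearest-neighbour edge of `ℤ^d`. -/
def IsLatticeEdge {d : ℕ} (e : Sym2 (Vtx d)) : Prop :=
  ∃ x y : Vtx d, e = s(x, y) ∧ ∑ i, |x i - y i| = 1

/-- The set of endpoints of two edges. -/
def span {d : ℕ} (e f : Sym2 (Vtx d)) : Set (Vtx d) := {v | v ∈ e ∨ v ∈ f}

/-- Two edges of `ℤ^d` are adjacent if their endpoints form a plaquette. -/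
def AdjacentEdges {d : ℕ} (e f : Sym2 (Vtx d)) : Prop :=
  IsLatticeEdge e ∧ IsLatticeEdge f ∧ IsPlaquette (span e f)

/-- The set of plaquettes spanned by pairs of adjacent edges `e ∈ A`, `f ∈ B`. -/
def adj {d : ℕ} (A B : Set (Sym2 (Vtx d))) : Set (Set (Vtx d)) :=
  {P | ∃ e ∈ A, ∃ f ∈ B, AdjacentEdges e f ∧ P = span e f}

/-! ### Step distributions and walks -/

/-- `D` is a probability distribution on `ℤ^d`, invariant under the symmetries of `ℤ^d`
(signed permutations of the coordinates), with `D (± e_i) = p₁`. -/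
structure IsStepDistribution {d : ℕ} (D : Vtx d → ℝ≥0) (p₁ : ℝ≥0) : Prop where
  hasSum : HasSum D 1
  symm : ∀ (σ : Equiv.Perm (Fin d)) (ε : Fin d → ℤˣ) (x : Vtx d),
    D (fun i => (ε i : ℤ) * x (σ i)) = D x
  single : ∀ i : Fin d, D (Pi.single i 1) = p₁

/-- An `n`-step walk `(ω_0, …, ω_n)` with `ω_{i+1} ≠ ω_i`. It is stored as a sequence indexed by
`ℕ` that is constant from index `n` on, so that the data are exactly `ω_0, …, ω_n`. -/
structure Walk (d n : ℕ) where
  vert : ℕ → Vtx d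
  step_ne : ∀ i < n, vert (i + 1) ≠ vert i
  const : ∀ i, n ≤ i → vert i = vert n

namespace Walk

variable {d n : ℕ}

/-- `ω` visits no vertex more than once. -/
def IsSelfAvoiding (ω : Walk d n) : Prop :=
  ∀ i j, i ≤ n → j ≤ n → ω.vert i = ω.vert j → i = j

/-- The set of edges traversed by `ω`. -/
def edges (ω : Walk d n) : Set (Sym2 (Vtx d)) :=
  {e | ∃ i < n, e = s(ω.vert i, ω.vert (i + 1))}

/-- The probability of `ω` (given its initial vertex) for the random walk with step
distribution `D`. -/
def prob (D : Vtx d → ℝ≥0) (ω : Walk d n) : ℝ≥0 :=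
  ∏ i ∈ Finset.range n, D (ω.vert (i + 1) - ω.vert i)

/-- The weight `W_κ(ω) = (1+κ)^{|adj(ω)|} P_n(ω)`. -/
def weight (D : Vtx d → ℝ≥0) (κ : ℝ≥0) (ω : Walk d n) : ℝ≥0 :=
  (1 + κ) ^ (adj ω.edges ω.edges).ncard * ω.prob D

end Walk

/-- `n`-step walks from the origin to `x`. -/
abbrev WalksTo (d n : ℕ) (x : Vtx d) : Type :=
  {ω : Walk d n // ω.vert 0 = 0 ∧ ω.vert n = x}

/-- `n`-step self-avoiding walks from the origin to `x`. -/
abbrev SAWsTo (d n : ℕ) (x : Vtx d) : Type :=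
  {ω : Walk d n // ω.vert 0 = 0 ∧ ω.vert n = x ∧ ω.IsSelfAvoiding}

/-- `n`-step self-avoiding walks from the origin. -/
abbrev SAWs (d n : ℕ) : Type :=
  {ω : Walk d n // ω.vert 0 = 0 ∧ ω.IsSelfAvoiding}

/-! ### Two-point function, susceptibility and critical point

Sums of non-negative terms are taken in `ℝ≥0∞`. -/

section TwoPoint

variable {d : ℕ} (D : Vtx d → ℝ≥0) (κ z : ℝ≥0)

/-- `c_n(κ)`, the total weight of `n`-step self-avoiding walks from the origin. -/
def c (n : ℕ) : ℝ≥0∞ := ∑' ω : SAWs d n, (ω.1.weight D κ : ℝ≥0∞)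

/-- The susceptibility `χ_κ(z) = ∑ c_n(κ) z^n`. -/
def χ : ℝ≥0∞ := ∑' n : ℕ, c D κ n * (z : ℝ≥0∞) ^ n

/-- The critical point `z_c = sup {z ≥ 0 | χ_κ(z) < ∞}`. -/
def zc : ℝ≥0∞ := sSup {w | ∃ z : ℝ≥0, χ D κ z < ∞ ∧ w = z}

/-- The two-point function `G_{z,κ}(x)`. -/
def G (x : Vtx d) : ℝ≥0∞ :=
  ∑' n : ℕ, ∑' ω : SAWsTo d n x, (z : ℝ≥0∞) ^ n * (ω.1.weight D κ : ℝ≥0∞)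

open Classical in
/-- `H_{z,κ}(x) = G_{z,κ}(x) - δ_{x,o}`. -/
def H (x : Vtx d) : ℝ≥0∞ := G D κ z x - if x = 0 then 1 else 0

end TwoPoint

/-- `z_0(κ) = (1+κ)^{-2(d-1)}`. -/
def z0 (d : ℕ) (κ : ℝ≥0) : ℝ≥0 := ((1 + κ) ^ (2 * (d - 1)))⁻¹

/-- `k_0 = 2d(d-1)`. -/
def k0 (d : ℕ) : ℕ := 2 * d * (d - 1)

open Classical in
/-- `r_κ(x) = 1{x = o} + κ 1{‖x‖_∞ = 1}`. -/
def r {d : ℕ} (κ : ℝ≥0) (x : Vtx d) : ℝ≥0∞ :=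
  (if x = 0 then 1 else 0) + (κ : ℝ≥0∞) * (if ‖x‖ = 1 then 1 else 0)

/-- Convolution of non-negative functions on `ℤ^d`. -/
def conv {d : ℕ} (f g : Vtx d → ℝ≥0∞) (x : Vtx d) : ℝ≥0∞ := ∑' y : Vtx d, f y * g (x - y)

/-! ### Graphs on integer intervals and laces -/

/-- The possible edges on `{a, …, b}`: pairs `(i, j)` with `a ≤ i`, `i + 1 < j`, `j ≤ b`. -/
def pairs (a b : ℕ) : Finset (ℕ × ℕ) :=
  (Finset.Icc a b ×ˢ Finset.Icc a b).filter fun e => e.1 + 1 < e.2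

/-- A graph on `{a, …, b}` is connected if every interior point lies strictly under an edge. -/
def IsConn (a b : ℕ) (Γ : Finset (ℕ × ℕ)) : Prop :=
  ∀ j, a < j → j < b → ∃ e ∈ Γ, e.1 < j ∧ j < e.2

/-- A lace is a connected graph that becomes disconnected when any edge is removed. -/
def IsLace (a b : ℕ) (L : Finset (ℕ × ℕ)) : Prop :=
  L ⊆ pairs a b ∧ IsConn a b L ∧ ∀ e ∈ L, ¬ IsConn a b (L.erase e)

open Classical in
/-- The set of laces on `{a, …, b}` with `m` edges. -/
def laces (a b m : ℕ) : Finset (Finset (ℕ × ℕ)) :=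
  (pairs a b).powerset.filter fun L => IsLace a b L ∧ L.card = m

/-- The right endpoints selected by the lace algorithm: first the largest `t` with `(a, t) ∈ Γ`,
then repeatedly the largest `t` joined to some `s` smaller than the previous right endpoint. -/
def laceT (a : ℕ) (Γ : Finset (ℕ × ℕ)) : ℕ → ℕ
  | 0 => (Γ.filter fun e => e.1 = a).sup Prod.snd
  | k + 1 => (Γ.filter fun e => e.1 < laceT a Γ k).sup Prod.snd

/-- The left endpoints selected by the lace algorithm: first `a`, then the smallest `s` joined to
the current right endpoint. -/
def laceS (a : ℕ) (Γ : Finset (ℕ × ℕ)) : ℕ → ℕ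
  | 0 => a
  | k + 1 => sInf {s | (s, laceT a Γ (k + 1)) ∈ Γ}

/-- The lace associated with a connected graph on `{a, …, b}`. Once the right endpoint has reached
`b`, further iterations reproduce the same edge, so all of them may be taken together. -/
def laceMap (a : ℕ) (Γ : Finset (ℕ × ℕ)) : Set (ℕ × ℕ) :=
  Set.range fun k => (laceS a Γ k, laceT a Γ k)

open Classical in
/-- The edges compatible with the lace `L`: those `ij ∉ L` with `laceMap (L ∪ {ij}) = L`. -/
def compatible (a b : ℕ) (L : Finset (ℕ × ℕ)) : Finset (ℕ × ℕ) :=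
  (pairs a b).filter fun e => e ∉ L ∧ laceMap a (insert e L) = (L : Set (ℕ × ℕ))

/-! ### The lace expansion coefficients -/

section LaceExpansion

variable {d n : ℕ}

open Classical in
/-- `U_{ij}(ω)`: the indicator of `ω_i = ω_j`, minus `κ` times the indicator that the steps
`{ω_i, ω_{i+1}}` and `{ω_{j-1}, ω_j}` are adjacent edges. -/
def U (κ : ℝ≥0) (ω : Walk d n) (e : ℕ × ℕ) : ℝ :=
  (if ω.vert e.1 = ω.vert e.2 then 1 else 0) -
    (κ : ℝ) * (if AdjacentEdges s(ω.vert e.1, ω.vert (e.1 + 1))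
      s(ω.vert (e.2 - 1), ω.vert e.2) then 1 else 0)

/-- `J^{(m)}_{[a,b]}(ω)`, the contribution of laces with `m` edges. -/
def J (κ : ℝ≥0) (m a b : ℕ) (ω : Walk d n) : ℝ :=
  ∑ L ∈ laces a b m, (∏ e ∈ L, -U κ ω e) * ∏ e ∈ compatible a b L, (1 - U κ ω e)

/-- The summand `z^n P_n(ω) J^{(m)}_{[0,n]}(ω)`. -/
def piTerm (D : Vtx d → ℝ≥0) (κ z : ℝ≥0) (m : ℕ) (ω : Walk d n) : ℝ :=
  (z : ℝ) ^ n * (ω.prob D : ℝ) * J κ m 0 n ω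

/-- `π^{(m)}_{z,κ}(x) = ∑_{n ≥ 2} ∑_ω z^n P_n(ω) J^{(m)}_{[0,n]}(ω)`, the inner sum being over
`n`-step walks from the origin to `x` (here `n` is written as `k + 2`). -/
def lacePi (D : Vtx d → ℝ≥0) (κ z : ℝ≥0) (m : ℕ) (x : Vtx d) : ℝ :=
  ∑' k : ℕ, ∑' ω : WalksTo d (k + 2) x, piTerm D κ z m ω.1

/-- The double series defining `π^{(m)}_{z,κ}(x)` is absolutely convergent. -/
def LacePiConverges (D : Vtx d → ℝ≥0) (κ z : ℝ≥0) (m : ℕ) (x : Vtx d) : Prop :=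
  Summable fun p : Σ k : ℕ, WalksTo d (k + 2) x => |piTerm D κ z m p.2.1|

end LaceExpansion

/-! ### The diagrams -/

section Diagrams

variable {d : ℕ}

/-- A tuple `(y_2, y_3, …, y_{2m-1})` is stored as a function on `Fin (2m-2)`; `ycoord y i` is the
entry `y_i` for `2 ≤ i ≤ 2m-1`. -/
def ycoord {m : ℕ} (y : Fin (2 * m - 2) → Vtx d) (i : ℕ) : Vtx d :=
  if h : i - 2 < 2 * m - 2 then y ⟨i - 2, h⟩ else 0

/-- The diagram with `m ≥ 2` lace edges: the sum over `(y_2, …, y_{2m-1})` of the product of the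
factors `H`, `G` and `r_κ`. -/
def diagram (D : Vtx d → ℝ≥0) (κ z : ℝ≥0) (m : ℕ) (x : Vtx d) : ℝ≥0∞ :=
  ∑' y : Fin (2 * m - 2) → Vtx d,
    H D κ z (ycoord y 2) * r κ (ycoord y 3) *
    (∏ j ∈ Finset.Icc 1 (m - 2),
      (H D κ z (ycoord y (2 * j + 1) - ycoord y (2 * j)) *
        G D κ z (ycoord y (2 * j + 2) - ycoord y (2 * j + 1)) *
        r κ (ycoord y (2 * j + 3) - ycoord y (2 * j)))) *
    (H D κ z (ycoord y (2 * m - 1) - ycoord y (2 * m - 2)) *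
      H D κ z (x - ycoord y (2 * m - 1)) *
      r κ (x - ycoord y (2 * m - 2)))

end Diagrams

end ASAW

end

noncomputable section

namespace ASAW

/-! ### Generators and adjacent edges -/

section Geometry

variable {d : ℕ}

/-! After taking absolute values, a lace edge contributes at most `r` of the displacement between
its end points. The compatible edges contribute zero if one of them joins two visits to the same
vertex, and otherwise a factor 1+κ for each compatible pair of adjacent steps. The end points of the
lace cut the walk into 2m-1 self-avoiding pieces. Without attraction these pieces could be summed
independently to `H` or `G`, giving the diagram. With attraction, a piece also gains 1+κ for each of
its adjacencies with earlier steps, and the number of these is unbounded.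

This gain is paid for by entropy (`tsum_obstacle_le`). Let V be the set of past vertices. If a step
(a, a+u) of a path avoiding V runs alongside an edge {a+w, a+u+w} within V, the step can be rerouted
through that edge. The result is again self-avoiding if the rerouted steps share u, w and the
parities of their starting points; by pigeonhole a fixed fraction, depending on d only, of all such
steps does. One rerouting costs at worst a factor θ, which is bounded below because z ≥ z₀ and
D(±e_i) = p₁ > 0. Summing over the subsets S of rerouted steps gives (1+θ) per available step, which
exceeds the attraction when κ is small. The original path and S can be read off from the rerouted
path, by deleting the vertices in V, so no path is produced twice. Hence the sum over a piece,
including its attraction to an arbitrary past, is at most the plain two-point function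
(`tsum_kern_le`).

For this to apply, the past with which a piece interacts must itself be self-avoiding and disjoint
from the piece. The combinatorics of laces provides exactly this (`laceSeq_of_mem_laces`): a
compatible edge ending in a piece starts no earlier than the second last right end point of the
lace, and within that window nearly all pairs are compatible, so coincidences there kill the term. A
bounded number of exceptional steps near the end points of the window and of the piece is absorbed
into (1+κ)^(2k₀) per piece (`card_pairs_le`, `piece_le_kern`).

The pieces are then summed from last to first (`tsum_prod_le`), since the obstacle of a piece
depends on earlier pieces only and the bound is uniform in the obstacle. Finiteness of the diagrams
(`diagram_lt_top`) follows from finiteness of χ below z_c, and gives absolute convergence. -/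

lemma IsGenerator.neg {u : Vtx d} (h : IsGenerator u) : IsGenerator (-u) := by
  obtain ⟨i, h | h⟩ := h
  · exact ⟨i, Or.inr (by rw [h])⟩
  · exact ⟨i, Or.inl (by rw [h, neg_neg])⟩

lemma IsGenerator.exists_single {u : Vtx d} (h : IsGenerator u) :
    ∃ i : Fin d, ∃ s : ℤ, (s = 1 ∨ s = -1) ∧ u = Pi.single i s := by
  obtain ⟨i, h | h⟩ := h
  · exact ⟨i, 1, Or.inl rfl, h⟩
  · exact ⟨i, -1, Or.inr rfl, by rw [h, Pi.single_neg]⟩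

lemma isGenerator_single (i : Fin d) {s : ℤ} (hs : s = 1 ∨ s = -1) :
    IsGenerator (Pi.single i s : Vtx d) := by
  rcases hs with rfl | rfl
  · exact ⟨i, Or.inl rfl⟩
  · exact ⟨i, Or.inr (by rw [Pi.single_neg])⟩

/-- The generators orthogonal to `u`. -/
def transverse (u : Vtx d) : Finset (Vtx d) :=
  ((Finset.univ.filter fun i : Fin d => u i = 0) ×ˢ ({1, -1} : Finset ℤ)).image
    fun p => Pi.single p.1 p.2

lemma mem_transverse {u w : Vtx d} :
    w ∈ transverse u ↔ ∃ j : Fin d, ∃ s : ℤ, u j = 0 ∧ (s = 1 ∨ s = -1) ∧ w = Pi.single j s := by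
  simp only [transverse, Finset.mem_image, Finset.mem_product, Finset.mem_filter,
    Finset.mem_univ, true_and, Finset.mem_insert, Finset.mem_singleton, Prod.exists]
  constructor
  · rintro ⟨j, s, ⟨h1, h2⟩, h3⟩; exact ⟨j, s, h1, h2, h3.symm⟩
  · rintro ⟨j, s, h1, h2, h3⟩; exact ⟨j, s, ⟨h1, h2⟩, h3.symm⟩

lemma isGenerator_of_mem_transverse {u w : Vtx d} (h : w ∈ transverse u) : IsGenerator w := by
  obtain ⟨j, s, -, hs, rfl⟩ := mem_transverse.1 h
  exact isGenerator_single j hs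

lemma mem_transverse_of_ne {u w : Vtx d} (hu : IsGenerator u) (hw : IsGenerator w)
    (h1 : u ≠ w) (h2 : u ≠ -w) : w ∈ transverse u := by
  obtain ⟨i, s, hs, rfl⟩ := hu.exists_single
  obtain ⟨j, t, ht, rfl⟩ := hw.exists_single
  refine mem_transverse.2 ⟨j, t, ?_, ht, rfl⟩
  have hij : j ≠ i := by
    rintro rfl
    rw [← Pi.single_neg] at h2
    rcases hs with rfl | rfl <;> rcases ht with rfl | rfl <;> simp at h1 h2
  simp [hij]

/-- Only the axis of `u` is excluded, and each of the other d-1 axes has two signs. Every factor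
2(d-1) below counts the edges parallel to a given one in a common plaquette. -/
lemma card_transverse_le {u : Vtx d} (hu : IsGenerator u) :
    (transverse u).card ≤ 2 * (d - 1) := by
  obtain ⟨i, s, hs, rfl⟩ := hu.exists_single
  refine Finset.card_image_le.trans ?_
  rw [Finset.card_product, mul_comm]
  refine Nat.mul_le_mul (by simp) ?_
  have : (Finset.univ.filter fun j : Fin d => (Pi.single i s : Vtx d) j = 0) ⊆
      Finset.univ.erase i := by
    intro j hj
    simp only [Finset.mem_filter, Finset.mem_univ, true_and] at hj
    refine Finset.mem_erase.2 ⟨?_, Finset.mem_univ _⟩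
    rintro rfl
    rw [Pi.single_eq_same] at hj
    omega
  refine (Finset.card_le_card this).trans ?_
  rw [Finset.card_erase_of_mem (Finset.mem_univ _), Finset.card_univ, Fintype.card_fin]

lemma norm_single_add_single {i j : Fin d} (hij : i ≠ j) {s t : ℤ} (hs : |s| ≤ 1)
    (ht : t = 1 ∨ t = -1) : ‖(Pi.single i s + Pi.single j t : Vtx d)‖ = 1 := by
  have hle : ∀ k : Fin d, |(Pi.single i s + Pi.single j t : Vtx d) k| ≤ 1 := by
    intro k
    have ht' : |t| ≤ 1 := by rcases ht with rfl | rfl <;> simp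
    by_cases h1 : k = i
    · subst h1; simpa [hij] using hs
    · by_cases h2 : k = j
      · subst h2; simpa [h1] using ht'
      · simp [h1, h2]
  apply le_antisymm
  · refine (pi_norm_le_iff_of_nonneg zero_le_one).2 fun k => ?_
    rw [Int.norm_eq_abs]
    exact_mod_cast hle k
  · have := norm_le_pi_norm (Pi.single i s + Pi.single j t : Vtx d) j
    refine le_trans (le_of_eq ?_) this
    rw [Int.norm_eq_abs]
    rcases ht with rfl | rfl <;> simp [hij.symm]

lemma norm_of_mem_transverse {u w : Vtx d} (hu : IsGenerator u) (hw : w ∈ transverse u) :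
    ‖w‖ = 1 ∧ ‖u + w‖ = 1 := by
  obtain ⟨j, t, hj, ht, rfl⟩ := mem_transverse.1 hw
  obtain ⟨i, s, hs, rfl⟩ := hu.exists_single
  have hij : i ≠ j := by
    rintro rfl
    rw [Pi.single_eq_same] at hj
    omega
  refine ⟨?_, norm_single_add_single hij (by rcases hs with rfl | rfl <;> simp) ht⟩
  simpa using norm_single_add_single (s := 0) hij (by simp) ht

/-- Any corner can serve as base point, after changing the sign of one or both generators. -/
lemma isPlaquette_base {P : Set (Vtx d)} (hP : IsPlaquette P) {a : Vtx d} (ha : a ∈ P) :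
    ∃ u v : Vtx d, IsGenerator u ∧ IsGenerator v ∧ u ≠ v ∧ u ≠ -v ∧
      P = {a, a + u, a + v, a + u + v} := by
  obtain ⟨x, u, v, hu, hv, h1, h2, rfl⟩ := hP
  have h3 : -u ≠ v := fun h => h2 (by rw [← h, neg_neg])
  have h4 : -u ≠ -v := fun h => h1 (neg_injective h)
  simp only [Set.mem_insert_iff, Set.mem_singleton_iff] at ha
  rcases ha with rfl | rfl | rfl | rfl
  · exact ⟨u, v, hu, hv, h1, h2, rfl⟩
  · refine ⟨-u, v, hu.neg, hv, h3, h4, ?_⟩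
    ext y
    simp only [Set.mem_insert_iff, Set.mem_singleton_iff, add_neg_cancel_right]
    rw [show x + u + v = x + (u + v) by abel]
    tauto
  · refine ⟨u, -v, hu, hv.neg, h2, by rwa [neg_neg], ?_⟩
    ext y
    simp only [Set.mem_insert_iff, Set.mem_singleton_iff, add_neg_cancel_right]
    rw [show x + v + u + -v = x + u by abel, show x + v + u = x + u + v by abel]
    tauto
  · refine ⟨-u, -v, hu.neg, hv.neg, h4, by rwa [neg_neg], ?_⟩
    ext y
    simp only [Set.mem_insert_iff, Set.mem_singleton_iff]
    rw [show x + u + v + -u = x + v by abel, show x + u + v + -v = x + u by abel,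
      show x + v + -v = x by abel]
    tauto

/-- Parity: |t| and t agree modulo 2, and the coordinate sum of a generator is odd, so the left side
is even. This rules out a lattice edge along the diagonal of a plaquette. -/
lemma sum_abs_generator_add_generator_ne_one {u v : Vtx d} (hu : IsGenerator u)
    (hv : IsGenerator v) : ∑ i, |u i + v i| ≠ 1 := by
  have hpar : ∀ {w : Vtx d}, IsGenerator w → ¬ (2 : ℤ) ∣ ∑ i, w i := by
    intro w hw
    obtain ⟨i, s, hs, rfl⟩ := hw.exists_single
    rw [Finset.sum_pi_single']
    simp only [Finset.mem_univ, if_true]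
    omega
  have hu' := hpar hu
  have hv' := hpar hv
  intro h
  have hd : (2 : ℤ) ∣ ∑ i, (|u i + v i| - (u i + v i)) :=
    Finset.dvd_sum fun i _ => by
      rcases abs_cases (u i + v i) with ⟨h, -⟩ | ⟨h, -⟩ <;> rw [h] <;> omega
  rw [Finset.sum_sub_distrib, Finset.sum_add_distrib, h] at hd
  omega

/-- An edge adjacent to `{a, b}` is a translate of it by a generator orthogonal to `b - a`. -/
lemma AdjacentEdges.exists_shift {a b : Vtx d} {f : Sym2 (Vtx d)} (h : AdjacentEdges s(a, b) f) :
    IsGenerator (b - a) ∧ ∃ w ∈ transverse (b - a), f = s(a + w, b + w) := by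
  obtain ⟨⟨x, y, hxy, hsum⟩, -, hP⟩ := h
  have hab : ∑ i, |b i - a i| = 1 := by
    rcases Sym2.eq_iff.1 hxy with ⟨rfl, rfl⟩ | ⟨rfl, rfl⟩
    · rw [← hsum]; exact Finset.sum_congr rfl fun i _ => abs_sub_comm _ _
    · exact hsum
  have key : ∀ u v : Vtx d, IsGenerator u → IsGenerator v → u ≠ v → u ≠ -v → b = a + u →
      span s(a, b) f = {a, a + u, a + v, a + u + v} →
      IsGenerator (b - a) ∧ ∃ w ∈ transverse (b - a), f = s(a + w, b + w) := by
    intro u v hu hv h1 h2 hb hspan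
    have hba : b - a = u := by rw [hb]; abel
    rw [hba]
    refine ⟨hu, v, mem_transverse_of_ne hu hv h1 h2, ?_⟩
    have hu0 : u ≠ 0 := by
      rintro rfl
      rw [hb] at hab
      simp at hab
    have hv0 : v ≠ 0 := by
      obtain ⟨i, s, hs, rfl⟩ := hv.exists_single
      intro h
      have := congrFun h i
      rw [Pi.single_eq_same, Pi.zero_apply] at this
      omega
    have m1 : a + v ∈ f := by
      have : a + v ∈ span s(a, b) f := by rw [hspan]; simp
      rcases this with h | h
      · rw [Sym2.mem_iff, hb] at h
        rcases h with h | h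
        · exact absurd (by simpa using h) hv0
        · exact absurd (add_left_cancel h).symm h1
      · exact h
    have m2 : b + v ∈ f := by
      have : b + v ∈ span s(a, b) f := by rw [hspan, hb]; simp
      rcases this with h | h
      · rw [Sym2.mem_iff, hb] at h
        rcases h with h | h
        · refine absurd ?_ h2
          rw [add_assoc] at h
          exact eq_neg_of_add_eq_zero_left (by simpa using h)
        · exact absurd (by simpa using h) hv0
      · exact h
    have hne : a + v ≠ b + v := by
      rw [hb]; intro h; exact hu0 (by simpa using h)
    exact ((Sym2.mem_and_mem_iff hne).1 ⟨m1, m2⟩)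
  have haP : a ∈ span s(a, b) f := Or.inl (by simp)
  have hbP : b ∈ span s(a, b) f := Or.inl (by simp)
  obtain ⟨u, v, hu, hv, h1, h2, hspan⟩ := isPlaquette_base hP haP
  rw [hspan] at hbP
  simp only [Set.mem_insert_iff, Set.mem_singleton_iff] at hbP
  rcases hbP with h | h | h | h
  · rw [h] at hab; simp at hab
  · exact key u v hu hv h1 h2 h hspan
  · refine key v u hv hu h1.symm (fun h => h2 (by rw [h, neg_neg])) h ?_
    rw [hspan, show a + u + v = a + v + u by abel, Set.insert_comm (a + u)]
  -- Here `b` would be the corner opposite to `a`.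
  · refine absurd ?_ (sum_abs_generator_add_generator_ne_one hu hv)
    rw [← hab, h]
    exact Finset.sum_congr rfl fun i _ => by
      simp only [Pi.add_apply]; congr 1; abel

lemma AdjacentEdges.symm {e f : Sym2 (Vtx d)} (h : AdjacentEdges e f) : AdjacentEdges f e := by
  refine ⟨h.2.1, h.1, ?_⟩
  have : span f e = span e f := by
    ext v; exact or_comm
  rw [this]; exact h.2.2

/-- The edges obtained by translating `{a, b}` along generators orthogonal to `b - a`. -/
def parallels (a b : Vtx d) : Finset (Sym2 (Vtx d)) :=
  (transverse (b - a)).image fun w => s(a + w, b + w)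

lemma AdjacentEdges.mem_parallels {a b : Vtx d} {f : Sym2 (Vtx d)}
    (h : AdjacentEdges s(a, b) f) : f ∈ parallels a b := by
  obtain ⟨-, w, hw, rfl⟩ := h.exists_shift
  exact Finset.mem_image_of_mem _ hw

lemma card_parallels_le {a b : Vtx d} (h : IsGenerator (b - a)) :
    (parallels a b).card ≤ 2 * (d - 1) :=
  Finset.card_image_le.trans (card_transverse_le h)

/-- Depending on the orientation of the second edge, `y - a` is the side `w` or the diagonal `u + w`
of a plaquette. This is the origin of the term κ·1{‖x‖_∞ = 1} in `r`, and it shows that an adjacency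
and a coincidence cannot occur for the same pair of times. -/
lemma norm_sub_of_adjacentEdges {a b x y : Vtx d} (h : AdjacentEdges s(a, b) s(x, y)) :
    ‖y - a‖ = 1 := by
  obtain ⟨hg, w, hw, hf⟩ := h.exists_shift
  have hn := norm_of_mem_transverse hg hw
  rcases Sym2.eq_iff.1 hf with ⟨-, rfl⟩ | ⟨-, rfl⟩
  · rw [← hn.2]; congr 1; abel
  · rw [← hn.1]; congr 1; abel

end Geometry

/-! ### Self-avoiding paths as lists of vertices -/

lemma tsum_le_tsum_of_injective {α β : Type*} {f : α → ℝ≥0∞} {g : β → ℝ≥0∞} (i : α → β)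
    (hi : Function.Injective i) (h : ∀ a, f a ≤ g (i a)) : ∑' a, f a ≤ ∑' b, g b :=
  (ENNReal.tsum_le_tsum h).trans (ENNReal.tsum_comp_le_tsum_of_injective hi g)

section Lists

variable {d : ℕ}

/-- The steps `(l_i, l_{i+1})` of a list of vertices. -/
def steps (l : List (Vtx d)) : List (Vtx d × Vtx d) := l.zip l.tail

/-- The probability of a list of vertices as a walk. -/
def lprob (D : Vtx d → ℝ≥0) (l : List (Vtx d)) : ℝ≥0 :=
  ((steps l).map fun p => D (p.2 - p.1)).prod

/-- The edges of a list of vertices. -/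
def ledges (l : List (Vtx d)) : Set (Sym2 (Vtx d)) := {e | ∃ p ∈ steps l, e = s(p.1, p.2)}

/-- The weight of a list of vertices as a walk, including the factor of `z` per step. -/
def lweight (D : Vtx d → ℝ≥0) (κ z : ℝ≥0) (l : List (Vtx d)) : ℝ≥0 :=
  z ^ (l.length - 1) * ((1 + κ) ^ (adj (ledges l) (ledges l)).ncard * lprob D l)

/-- `l` lists the vertices of a self-avoiding path from `a` to `b`. -/
structure IsPath (a b : Vtx d) (l : List (Vtx d)) : Prop where
  nodup : l.Nodup
  head : l.head? = some a
  last : l.getLast? = some b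

@[simp] lemma steps_nil : steps ([] : List (Vtx d)) = [] := rfl
@[simp] lemma steps_singleton (a : Vtx d) : steps [a] = [] := rfl
@[simp] lemma steps_cons_cons (a b : Vtx d) (t : List (Vtx d)) :
    steps (a :: b :: t) = (a, b) :: steps (b :: t) := rfl

@[simp] lemma lprob_singleton (D : Vtx d → ℝ≥0) (a : Vtx d) : lprob D [a] = 1 := rfl
lemma lprob_cons_cons (D : Vtx d → ℝ≥0) (a b : Vtx d) (t : List (Vtx d)) :
    lprob D (a :: b :: t) = D (b - a) * lprob D (b :: t) := by
  simp [lprob]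

lemma mem_of_mem_steps {l : List (Vtx d)} {p : Vtx d × Vtx d} (h : p ∈ steps l) :
    p.1 ∈ l ∧ p.2 ∈ l :=
  ⟨(List.of_mem_zip h).1, List.mem_of_mem_tail (List.of_mem_zip h).2⟩

lemma finite_ledges (l : List (Vtx d)) : (ledges l).Finite := by
  refine ((steps l).finite_toSet.image fun p => s(p.1, p.2)).subset ?_
  rintro e ⟨p, hp, rfl⟩
  exact ⟨p, hp, rfl⟩

lemma finite_adj {A B : Set (Sym2 (Vtx d))} (hA : A.Finite) (hB : B.Finite) :
    (adj A B).Finite := by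
  refine (hA.image2 span hB).subset ?_
  rintro P ⟨e, he, f, hf, -, rfl⟩
  exact ⟨e, he, f, hf, rfl⟩

/-- The vertices `ω_p, …, ω_q`. -/
def piece (ω : ℕ → Vtx d) (p q : ℕ) : List (Vtx d) := (List.range' p (q + 1 - p)).map ω

lemma length_piece (ω : ℕ → Vtx d) (p q : ℕ) : (piece ω p q).length = q + 1 - p := by
  simp [piece]

lemma mem_piece {ω : ℕ → Vtx d} {p q : ℕ} {x : Vtx d} :
    x ∈ piece ω p q ↔ ∃ i, p ≤ i ∧ i ≤ q ∧ ω i = x := by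
  simp only [piece, List.mem_map, List.mem_range'_1]
  constructor
  · rintro ⟨i, h, rfl⟩; exact ⟨i, by omega, by omega, rfl⟩
  · rintro ⟨i, h1, h2, rfl⟩; exact ⟨i, by omega, rfl⟩

lemma piece_self (ω : ℕ → Vtx d) (p : ℕ) : piece ω p p = [ω p] := by
  simp [piece]

lemma piece_cons (ω : ℕ → Vtx d) {p q : ℕ} (h : p ≤ q) :
    piece ω p q = ω p :: piece ω (p + 1) q := by
  rw [piece, show q + 1 - p = (q + 1 - (p + 1)) + 1 by omega, List.range'_succ]
  rfl

lemma tail_piece (ω : ℕ → Vtx d) (p q : ℕ) : (piece ω p q).tail = piece ω (p + 1) q := by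
  rcases le_or_gt p q with h | h
  · rw [piece_cons ω h, List.tail_cons]
  · simp [piece, show q + 1 - p = 0 by omega, show q + 1 - (p + 1) = 0 by omega]

lemma nodup_piece {ω : ℕ → Vtx d} {p q : ℕ} (h : Set.InjOn ω (Set.Icc p q)) :
    (piece ω p q).Nodup := by
  refine List.Nodup.map_on ?_ List.nodup_range'
  intro x hx y hy hxy
  rw [List.mem_range'_1] at hx hy
  exact h ⟨by omega, by omega⟩ ⟨by omega, by omega⟩ hxy

lemma steps_piece (ω : ℕ → Vtx d) {p q : ℕ} (h : p ≤ q) :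
    steps (piece ω p q) = (List.range' p (q - p)).map fun i => (ω i, ω (i + 1)) := by
  obtain ⟨n, rfl⟩ := Nat.exists_eq_add_of_le h
  clear h
  induction n generalizing p with
  | zero => simp [piece_self]
  | succ n ih =>
    rw [piece_cons ω (by omega), piece_cons ω (by omega), steps_cons_cons,
      ← piece_cons ω (by omega), show p + (n + 1) = (p + 1) + n by omega, ih,
      show p + 1 + n - p = (p + 1 + n - (p + 1)) + 1 by omega, List.range'_succ]
    rfl

lemma mem_steps_piece {ω : ℕ → Vtx d} {p q : ℕ} (h : p ≤ q) {e : Vtx d × Vtx d} :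
    e ∈ steps (piece ω p q) ↔ ∃ i, p ≤ i ∧ i < q ∧ e = (ω i, ω (i + 1)) := by
  rw [steps_piece ω h]
  simp only [List.mem_map, List.mem_range'_1]
  constructor
  · rintro ⟨i, h, rfl⟩; exact ⟨i, by omega, by omega, rfl⟩
  · rintro ⟨i, h1, h2, rfl⟩; exact ⟨i, by omega, rfl⟩

lemma mem_ledges_piece {ω : ℕ → Vtx d} {p q : ℕ} (h : p ≤ q) {e : Sym2 (Vtx d)} :
    e ∈ ledges (piece ω p q) ↔ ∃ i, p ≤ i ∧ i < q ∧ e = s(ω i, ω (i + 1)) := by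
  constructor
  · rintro ⟨x, hx, rfl⟩
    obtain ⟨i, h1, h2, rfl⟩ := (mem_steps_piece h).1 hx
    exact ⟨i, h1, h2, rfl⟩
  · rintro ⟨i, h1, h2, rfl⟩
    exact ⟨_, (mem_steps_piece h).2 ⟨i, h1, h2, rfl⟩, rfl⟩

lemma lprob_piece (D : Vtx d → ℝ≥0) (ω : ℕ → Vtx d) {p q : ℕ} (h : p ≤ q) :
    lprob D (piece ω p q) = ∏ i ∈ Finset.Ico p q, D (ω (i + 1) - ω i) := by
  rw [lprob, steps_piece ω h, List.map_map]
  rfl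

lemma isPath_piece {ω : ℕ → Vtx d} {p q : ℕ} (h : p ≤ q) (hω : Set.InjOn ω (Set.Icc p q)) :
    IsPath (ω p) (ω q) (piece ω p q) := by
  refine ⟨nodup_piece hω, by rw [piece_cons ω h]; rfl, ?_⟩
  rw [piece, List.getLast?_map, List.getLast?_range']
  simp [show q + 1 - p ≠ 0 by omega]
  congr 1
  omega

lemma piece_getD (l : List (Vtx d)) (h : l ≠ []) :
    piece (fun i => l.getD i 0) 0 (l.length - 1) = l := by
  have hl := List.length_pos_iff.2 h
  refine List.ext_getElem (by rw [length_piece]; omega) fun i h1 h2 => ?_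
  simp [piece, h2]

lemma IsPath.ne_nil {a b : Vtx d} {l : List (Vtx d)} (h : IsPath a b l) : l ≠ [] := by
  rintro rfl
  simpa using h.head

lemma IsPath.getD_zero {a b : Vtx d} {l : List (Vtx d)} (h : IsPath a b l) : l.getD 0 0 = a := by
  have := h.head
  rw [List.head?_eq_getElem?] at this
  simp [List.getD_eq_getElem?_getD, this]

lemma IsPath.getD_last {a b : Vtx d} {l : List (Vtx d)} (h : IsPath a b l) :
    l.getD (l.length - 1) 0 = b := by
  have := h.last
  rw [List.getLast?_eq_getElem?] at this
  simp [List.getD_eq_getElem?_getD, this]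

lemma getD_injOn {l : List (Vtx d)} (h : l.Nodup) (hl : l ≠ []) :
    Set.InjOn (fun i => l.getD i 0) (Set.Icc 0 (l.length - 1)) := by
  have hl := List.length_pos_iff.2 hl
  intro i hi j hj hij
  have h1 : i < l.length := by have := hi.2; omega
  have h2 : j < l.length := by have := hj.2; omega
  simp only [List.getD_eq_getElem, h1, h2] at hij
  exact (h.getElem_inj_iff).1 hij

/-! ### Translation invariance -/

lemma AdjacentEdges.map_sub {e f : Sym2 (Vtx d)} (h : AdjacentEdges e f) (a : Vtx d) :
    AdjacentEdges (e.map (· - a)) (f.map (· - a)) ∧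
      span (e.map (· - a)) (f.map (· - a)) = (· - a) '' span e f := by
  have hL : ∀ {e : Sym2 (Vtx d)}, IsLatticeEdge e → IsLatticeEdge (e.map (· - a)) := by
    rintro e ⟨x, y, rfl, h⟩
    exact ⟨x - a, y - a, rfl, by simpa using h⟩
  have hs : span (e.map (· - a)) (f.map (· - a)) = (· - a) '' span e f := by
    ext v
    simp only [span, Set.mem_ofPred_eq, Sym2.mem_map, Set.mem_image]
    constructor
    · rintro (⟨x, hx, rfl⟩ | ⟨x, hx, rfl⟩)
      · exact ⟨x, Or.inl hx, rfl⟩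
      · exact ⟨x, Or.inr hx, rfl⟩
    · rintro ⟨x, hx | hx, rfl⟩
      · exact Or.inl ⟨x, hx, rfl⟩
      · exact Or.inr ⟨x, hx, rfl⟩
  refine ⟨⟨hL h.1, hL h.2.1, ?_⟩, hs⟩
  obtain ⟨x, u, v, hu, hv, h1, h2, hP⟩ := h.2.2
  refine ⟨x - a, u, v, hu, hv, h1, h2, ?_⟩
  rw [hs, hP]
  simp only [Set.image_insert_eq, Set.image_singleton]
  congr 2
  · abel
  · congr 1
    · abel
    · congr 1; abel

/-- Translation acts injectively on plaquettes and preserves adjacency. -/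
lemma ncard_adj_le_of_map_sub {A B : Set (Sym2 (Vtx d))} (hB : B.Finite) (a : Vtx d)
    (h : ∀ e ∈ A, e.map (· - a) ∈ B) : (adj A A).ncard ≤ (adj B B).ncard := by
  refine Set.ncard_le_ncard_of_injOn (fun P => (· - a) '' P) ?_ ?_ (finite_adj hB hB)
  · rintro P ⟨e, he, f, hf, hef, rfl⟩
    exact ⟨_, h e he, _, h f hf, (hef.map_sub a).1, (hef.map_sub a).2.symm⟩
  · exact (Set.image_injective.2 (sub_left_injective (b := a))).injOn

/-- The walk from the origin given by a self-avoiding path. -/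
def walkOfPath {a b : Vtx d} {l : List (Vtx d)} (h : IsPath a b l) :
    SAWsTo d (l.length - 1) (b - a) :=
  ⟨{ vert := fun i => l.getD (min i (l.length - 1)) 0 - a
     step_ne := fun i hi he => by
      have := getD_injOn h.nodup h.ne_nil (x₁ := min (i + 1) (l.length - 1))
        (x₂ := min i (l.length - 1)) ⟨by omega, by omega⟩ ⟨by omega, by omega⟩ (by simpa using he)
      omega
     const := fun i hi => by rw [min_eq_right hi, min_self] },
    by simp only [Nat.zero_min, h.getD_zero, sub_self],
    by simp only [min_self, h.getD_last],
    fun i j hi hj he => by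
      have := getD_injOn h.nodup h.ne_nil (x₁ := min i (l.length - 1))
        (x₂ := min j (l.length - 1)) ⟨by omega, by omega⟩ ⟨by omega, by omega⟩ (sub_left_injective he)
      omega⟩

lemma finite_walk_edges {n : ℕ} (ω : Walk d n) : ω.edges.Finite := by
  refine ((Set.finite_lt_nat n).image fun i => s(ω.vert i, ω.vert (i + 1))).subset ?_
  rintro e ⟨i, hi, rfl⟩
  exact ⟨i, hi, rfl⟩

lemma lweight_le_weight_walkOfPath (D : Vtx d → ℝ≥0) (κ z : ℝ≥0) {a b : Vtx d}
    {l : List (Vtx d)} (h : IsPath a b l) :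
    lweight D κ z l ≤ z ^ (l.length - 1) * (walkOfPath h).1.weight D κ := by
  rw [lweight, Walk.weight]
  have hp := piece_getD l h.ne_nil
  refine mul_le_mul_right (mul_le_mul' (pow_le_pow_right' le_self_add ?_) ?_) _
  · refine ncard_adj_le_of_map_sub (finite_walk_edges _) a fun e he => ?_
    rw [← hp, mem_ledges_piece (Nat.zero_le _)] at he
    obtain ⟨i, -, hi, rfl⟩ := he
    refine ⟨i, hi, ?_⟩
    simp only [walkOfPath, Sym2.map_mk, min_eq_left hi.le,
      min_eq_left (Nat.succ_le_of_lt hi)]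
  · apply le_of_eq
    conv_lhs => rw [← hp]
    rw [lprob_piece D _ (Nat.zero_le _), Walk.prob, Finset.range_eq_Ico]
    refine Finset.prod_congr rfl fun i hi => ?_
    have hi := (Finset.mem_Ico.1 hi).2
    simp only [walkOfPath, min_eq_left hi.le, min_eq_left (Nat.succ_le_of_lt hi), sub_sub_sub_cancel_right]

/-- The total weight of the self-avoiding paths from `a` to `b` is at most `G (b - a)`. -/
lemma tsum_lweight_le_G (D : Vtx d → ℝ≥0) (κ z : ℝ≥0) (a b : Vtx d) :
    ∑' l : {l : List (Vtx d) // IsPath a b l}, (lweight D κ z l.1 : ℝ≥0∞) ≤ G D κ z (b - a) := by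
  rw [G, ← ENNReal.tsum_sigma' (f := fun p : Σ n, SAWsTo d n (b - a) =>
    (z : ℝ≥0∞) ^ p.1 * (p.2.1.weight D κ : ℝ≥0∞))]
  refine tsum_le_tsum_of_injective
    (fun l : {l : List (Vtx d) // IsPath a b l} =>
      (⟨l.1.length - 1, walkOfPath l.2⟩ : Σ n, SAWsTo d n (b - a))) ?_ ?_
  · rintro ⟨l, hl⟩ ⟨l', hl'⟩ he
    have hlen : l.length - 1 = l'.length - 1 := congrArg Sigma.fst he
    have hv : (fun i => l.getD (min i (l.length - 1)) 0 - a) =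
        fun i => l'.getD (min i (l'.length - 1)) 0 - a :=
      congrArg (fun p : Σ n, SAWsTo d n (b - a) => p.2.1.vert) he
    refine Subtype.ext ?_
    have e1 := piece_getD l hl.ne_nil
    have e2 := piece_getD l' hl'.ne_nil
    change l = l'
    rw [← e1, ← e2, hlen]
    refine List.map_congr_left fun i hi => ?_
    have hi := (List.mem_range'_1.1 hi).2
    have := congrFun hv i
    simp only [sub_left_inj] at this
    rwa [hlen, min_eq_left (by omega)] at this
  · rintro ⟨l, hl⟩
    exact_mod_cast lweight_le_weight_walkOfPath D κ z hl

end Lists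

/-! ### Flipping steps of a path towards an obstacle -/

section Flip

variable {d : ℕ}

/-- Replace each step `(a, a + u)` with `a ∈ S` by the three steps through `a + w`, `a + u + w`. -/
def flip (u w : Vtx d) (S : Finset (Vtx d)) (l : List (Vtx d)) : List (Vtx d) :=
  l.flatMap fun a => if a ∈ S then [a, a + w, a + u + w] else [a]

variable {u w : Vtx d} {S : Finset (Vtx d)}

lemma flip_cons_of_mem {a : Vtx d} {l : List (Vtx d)} (h : a ∈ S) :
    flip u w S (a :: l) = a :: (a + w) :: (a + u + w) :: flip u w S l := by
  simp [flip, h]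

lemma flip_cons_of_notMem {a : Vtx d} {l : List (Vtx d)} (h : a ∉ S) :
    flip u w S (a :: l) = a :: flip u w S l := by
  simp [flip, h]

/-- Flipping inserts vertices only after existing ones, so the head survives; the inductions over
the path use this to expose the first step of the flipped tail. -/
lemma exists_flip_cons (u w : Vtx d) (S : Finset (Vtx d)) (a : Vtx d) (l : List (Vtx d)) :
    ∃ r, flip u w S (a :: l) = a :: r := by
  by_cases h : a ∈ S
  · exact ⟨_, flip_cons_of_mem h⟩
  · exact ⟨_, flip_cons_of_notMem h⟩

lemma mem_flip {l : List (Vtx d)} {x : Vtx d} :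
    x ∈ flip u w S l ↔ x ∈ l ∨ ∃ a ∈ l, a ∈ S ∧ (x = a + w ∨ x = a + u + w) := by
  simp only [flip, List.mem_flatMap]
  constructor
  · rintro ⟨a, ha, hx⟩
    split_ifs at hx with h
    · simp only [List.mem_cons, List.not_mem_nil, or_false] at hx
      rcases hx with rfl | hx
      · exact Or.inl ha
      · exact Or.inr ⟨a, ha, h, hx⟩
    · rw [List.mem_singleton] at hx
      exact Or.inl (hx ▸ ha)
  · rintro (hx | ⟨a, ha, h, hx⟩)
    · exact ⟨x, hx, by split_ifs <;> simp⟩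
    · exact ⟨a, ha, by rw [if_pos h]; simp [hx]⟩

lemma head?_flip (l : List (Vtx d)) : (flip u w S l).head? = l.head? := by
  cases l with
  | nil => rfl
  | cons a l => obtain ⟨r, hr⟩ := exists_flip_cons u w S a l; rw [hr]; rfl

/-- Every vertex of `S` on `l` is the start of a step of `l` in direction `u`. -/
def StepsAlong (u : Vtx d) (S : Finset (Vtx d)) (l : List (Vtx d)) : Prop :=
  ∀ a ∈ l, a ∈ S → (a, a + u) ∈ steps l

lemma StepsAlong.notMem {a : Vtx d} (h : StepsAlong u S [a]) : a ∉ S := fun ha => by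
  simpa using h a (by simp) ha

lemma StepsAlong.cons {a b : Vtx d} {t : List (Vtx d)} (h : StepsAlong u S (a :: b :: t))
    (hl : (a :: b :: t).Nodup) : StepsAlong u S (b :: t) ∧ (a ∈ S → b = a + u) := by
  have hn := (List.nodup_cons.1 hl).1
  constructor
  · intro x hx hxS
    have := h x (List.mem_cons_of_mem _ hx) hxS
    rw [steps_cons_cons, List.mem_cons] at this
    rcases this with h1 | h1
    · obtain ⟨rfl, -⟩ := Prod.mk.injEq _ _ _ _ ▸ h1
      exact absurd hx hn
    · exact h1
  · intro ha
    have := h a (by simp) ha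
    rw [steps_cons_cons, List.mem_cons] at this
    rcases this with h1 | h1
    · exact (Prod.mk.inj h1).2.symm
    · exact absurd (mem_of_mem_steps h1).1 hn

lemma getLast?_flip {l : List (Vtx d)} (hl : l.Nodup) (h : StepsAlong u S l) :
    (flip u w S l).getLast? = l.getLast? := by
  induction l with
  | nil => rfl
  | cons a l ih =>
    cases l with
    | nil => rw [flip_cons_of_notMem h.notMem]; rfl
    | cons b t =>
      have ih := ih (List.nodup_cons.1 hl).2 (h.cons hl).1
      obtain ⟨r, hr⟩ := exists_flip_cons u w S b t
      rw [List.getLast?_cons_cons, ← ih, hr]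
      by_cases ha : a ∈ S
      · rw [flip_cons_of_mem ha, hr]; simp only [List.getLast?_cons_cons]
      · rw [flip_cons_of_notMem ha, hr]; simp only [List.getLast?_cons_cons]

lemma length_flip (l : List (Vtx d)) :
    (flip u w S l).length = l.length + 2 * l.countP (· ∈ S) := by
  induction l with
  | nil => rfl
  | cons a l ih =>
    by_cases ha : a ∈ S
    · rw [flip_cons_of_mem ha, List.countP_cons_of_pos (by simpa using ha)]
      simp only [List.length_cons, ih]; ring
    · rw [flip_cons_of_notMem ha, List.countP_cons_of_neg (by simpa using ha)]
      simp only [List.length_cons, ih]; ring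

/-- A step `u` becomes the three steps `w`, `u`, `-w`, at the price of two more factors p₁. -/
lemma lprob_flip {D : Vtx d → ℝ≥0} {p₁ : ℝ≥0} (hD : ∀ v, IsGenerator v → D v = p₁)
    (hu : IsGenerator u) (hw : IsGenerator w) {l : List (Vtx d)} (hl : l.Nodup)
    (h : StepsAlong u S l) :
    lprob D (flip u w S l) = lprob D l * (p₁ ^ 2) ^ l.countP (· ∈ S) := by
  induction l with
  | nil => simp [flip, lprob]
  | cons a l ih =>
    cases l with
    | nil =>
      rw [flip_cons_of_notMem h.notMem, List.countP_cons_of_neg (by simpa using h.notMem)]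
      simp [flip]
    | cons b t =>
      have ih := ih (List.nodup_cons.1 hl).2 (h.cons hl).1
      obtain ⟨r, hr⟩ := exists_flip_cons u w S b t
      rw [hr] at ih
      by_cases ha : a ∈ S
      · obtain rfl := (h.cons hl).2 ha
        rw [flip_cons_of_mem ha, hr, List.countP_cons_of_pos (by simpa using ha)]
        simp only [lprob_cons_cons, ih]
        rw [show a + w - a = w by abel, show a + u + w - (a + w) = u by abel,
          show a + u - (a + u + w) = -w by abel, show a + u - a = u by abel,
          hD _ hu, hD _ hw, hD _ hw.neg]
        ring
      · rw [flip_cons_of_notMem ha, hr, List.countP_cons_of_neg (by simpa using ha)]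
        simp only [lprob_cons_cons, ih]
        ring

lemma mem_steps_flip {l : List (Vtx d)} {p : Vtx d × Vtx d} (hp : p ∈ steps l) (hS : p.1 ∉ S) :
    p ∈ steps (flip u w S l) := by
  induction l with
  | nil => simp at hp
  | cons a l ih =>
    cases l with
    | nil => simp at hp
    | cons b t =>
      obtain ⟨r, hr⟩ := exists_flip_cons u w S b t
      rw [hr] at ih
      rw [steps_cons_cons, List.mem_cons] at hp
      by_cases ha : a ∈ S
      · rw [flip_cons_of_mem ha, hr]
        rcases hp with rfl | hp
        · exact absurd ha hS
        · simp [ih hp]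
      · rw [flip_cons_of_notMem ha, hr]
        rcases hp with rfl | hp
        · simp
        · simp [ih hp]

/-- Inserted vertices lie in `V`, which the old path avoids. Two inserted vertices coming from
different `a`, `b` can coincide only if `b = a + u` or `a = b + u`, which is excluded by `hS`. -/
lemma nodup_flip {V : Set (Vtx d)} {l : List (Vtx d)} (hl : l.Nodup) (hV : ∀ a ∈ l, a ∉ V)
    (hu : u ≠ 0) (hSV : ∀ a ∈ S, a + w ∈ V ∧ a + u + w ∈ V)
    (hS : ∀ a ∈ S, ∀ b ∈ S, b ≠ a + u) : (flip u w S l).Nodup := by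
  rw [flip, List.nodup_flatMap]
  constructor
  · intro a ha
    split_ifs with h
    · have h1 : a ≠ a + w := fun e => hV a ha (e ▸ (hSV a h).1)
      have h2 : a ≠ a + u + w := fun e => hV a ha (e ▸ (hSV a h).2)
      have h3 : a + w ≠ a + u + w := fun e => hu (by
        have := add_right_cancel e
        simpa using this)
      simp [h1, h2, h3, -left_eq_add, -add_left_inj]
    · simp
  · refine (List.nodup_iff_pairwise_ne.1 hl).imp_of_mem ?_
    intro a b ha hb hab x hxa hxb
    have key : ∀ {a x : Vtx d}, (x ∈ if a ∈ S then [a, a + w, a + u + w] else [a]) →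
        x = a ∨ (a ∈ S ∧ (x = a + w ∨ x = a + u + w)) := by
      intro a x hx
      split_ifs at hx with h
      · simpa [h] using hx
      · exact Or.inl (by simpa using hx)
    rcases key hxa with rfl | ⟨haS, h1⟩ <;> rcases key hxb with rfl | ⟨hbS, h2⟩
    · exact hab rfl
    · rcases h2 with h2 | h2
      · exact hV x ha (h2 ▸ (hSV b hbS).1)
      · exact hV x ha (h2 ▸ (hSV b hbS).2)
    · rcases h1 with h1 | h1
      · exact hV x hb (h1 ▸ (hSV a haS).1)
      · exact hV x hb (h1 ▸ (hSV a haS).2)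
    · rcases h1 with rfl | rfl <;> rcases h2 with h2 | h2
      · exact hab (add_right_cancel h2)
      · exact hS b hbS a haS (add_right_cancel h2)
      · exact hS a haS b hbS (add_right_cancel h2).symm
      · exact hab (add_right_cancel (add_right_cancel h2))

open Classical in
-- This is the injectivity of flipping in the path: knowledge of the obstacle alone suffices to undo
-- it, whatever `S` was.
lemma filter_flip {V : Set (Vtx d)} {l : List (Vtx d)} (hV : ∀ a ∈ l, a ∉ V)
    (hSV : ∀ a ∈ S, a + w ∈ V ∧ a + u + w ∈ V) :
    (flip u w S l).filter (fun a => a ∉ V) = l := by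
  induction l with
  | nil => rfl
  | cons a l ih =>
    have ih := ih fun x hx => hV x (List.mem_cons_of_mem _ hx)
    have ha := hV a (by simp)
    by_cases h : a ∈ S
    · rw [flip_cons_of_mem h]
      simp only [List.filter_cons, ha, hSV a h, ih]
      simp
    · rw [flip_cons_of_notMem h]
      simp only [List.filter_cons, ha, ih]
      simp

/-- Steps not starting in `S` survive the flip, so a plaquette can be lost only if one of its two
spanning edges is a flipped step. Each flipped step lies in at most 2(d-1) such plaquettes. -/
lemma ncard_adj_le_flip {l : List (Vtx d)} (hl : l.Nodup) (hu : IsGenerator u)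
    (h : StepsAlong u S l) :
    (adj (ledges l) (ledges l)).ncard ≤
      (adj (ledges (flip u w S l)) (ledges (flip u w S l))).ncard + 2 * (d - 1) * S.card := by
  classical
  set T : Finset (Set (Vtx d)) :=
    S.biUnion fun a => (parallels a (a + u)).image fun f => span s(a, a + u) f with hT
  have hTc : T.card ≤ 2 * (d - 1) * S.card := by
    rw [mul_comm]
    refine Finset.card_biUnion_le_card_mul _ _ _ fun a _ => ?_
    exact Finset.card_image_le.trans (card_parallels_le (by simpa using hu))
  have hstep : ∀ p ∈ steps l, p.1 ∈ S → p.2 = p.1 + u := by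
    intro p hp hpS
    clear hTc hT T
    induction l with
    | nil => simp at hp
    | cons a l ih =>
      cases l with
      | nil => simp at hp
      | cons b t =>
        rw [steps_cons_cons, List.mem_cons] at hp
        rcases hp with rfl | hp
        · exact (h.cons hl).2 hpS
        · exact ih (List.nodup_cons.1 hl).2 (h.cons hl).1 hp
  have hspan : ∀ e f : Sym2 (Vtx d), span e f = span f e := fun e f => by
    ext v; exact or_comm
  have hsub : adj (ledges l) (ledges l) ⊆
      adj (ledges (flip u w S l)) (ledges (flip u w S l)) ∪ (T : Set (Set (Vtx d))) := by
    rintro P ⟨e, ⟨p, hp, rfl⟩, f, ⟨q, hq, rfl⟩, hef, rfl⟩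
    have main : ∀ p ∈ steps l, ∀ q : Vtx d × Vtx d, AdjacentEdges s(p.1, p.2) s(q.1, q.2) →
        p.1 ∈ S → span s(p.1, p.2) s(q.1, q.2) ∈ T := by
      intro p hp q hpq hpS
      have h1 := hstep p hp hpS
      refine Finset.mem_biUnion.2 ⟨p.1, hpS, Finset.mem_image.2 ⟨s(q.1, q.2), ?_, by rw [h1]⟩⟩
      rw [← h1]
      exact hpq.mem_parallels
    by_cases h1 : p.1 ∈ S
    · exact Or.inr (main p hp q hef h1)
    by_cases h2 : q.1 ∈ S
    · rw [hspan]
      exact Or.inr (main q hq p hef.symm h2)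
    exact Or.inl ⟨_, ⟨p, mem_steps_flip hp h1, rfl⟩, _, ⟨q, mem_steps_flip hq h2, rfl⟩, hef, rfl⟩
  calc (adj (ledges l) (ledges l)).ncard
      ≤ _ := Set.ncard_le_ncard hsub
        ((finite_adj (finite_ledges _) (finite_ledges _)).union T.finite_toSet)
    _ ≤ _ := Set.ncard_union_le _ _
    _ ≤ _ := by rw [Set.ncard_coe_finset]; gcongr

/-- Per flipped step, two additional steps contribute z²p₁², and at most 2(d-1) factors 1+κ are
lost; `hθ` says that the net effect is at least θ. -/
lemma lweight_flip {D : Vtx d → ℝ≥0} {p₁ κ z θ : ℝ≥0} (hD : ∀ v, IsGenerator v → D v = p₁)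
    (hθ : θ * (1 + κ) ^ (2 * (d - 1)) ≤ z ^ 2 * p₁ ^ 2) (hu : IsGenerator u) (hw : IsGenerator w)
    {l : List (Vtx d)} (hl : l.Nodup) (h : StepsAlong u S l) (hSl : S ⊆ l.toFinset) :
    lweight D κ z l * θ ^ S.card ≤ lweight D κ z (flip u w S l) := by
  have hcount : l.countP (· ∈ S) = S.card := by
    rw [List.countP_eq_length_filter, ← List.toFinset_card_of_nodup (hl.filter _)]
    congr 1
    ext a
    simp only [List.mem_toFinset, List.mem_filter, decide_eq_true_eq]
    exact ⟨fun h => h.2, fun h => ⟨List.mem_toFinset.1 (hSl h), h⟩⟩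
  rcases eq_or_ne l [] with rfl | hne
  · have : S = ∅ := by simpa using hSl
    subst this
    simp [flip]
  have hlen := List.length_pos_iff.2 hne
  rw [lweight, lweight, lprob_flip hD hu hw hl h, length_flip, hcount,
    show l.length + 2 * S.card - 1 = (l.length - 1) + 2 * S.card by omega, pow_add, pow_mul z 2]
  calc z ^ (l.length - 1) * ((1 + κ) ^ (adj (ledges l) (ledges l)).ncard * lprob D l) * θ ^ S.card
      ≤ z ^ (l.length - 1) * ((1 + κ) ^ ((adj (ledges (flip u w S l))
          (ledges (flip u w S l))).ncard + 2 * (d - 1) * S.card) * lprob D l) * θ ^ S.card := by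
        gcongr
        · exact le_self_add
        · exact ncard_adj_le_flip hl hu h
    _ = z ^ (l.length - 1) * ((1 + κ) ^ (adj (ledges (flip u w S l))
          (ledges (flip u w S l))).ncard * lprob D l) *
          (θ * (1 + κ) ^ (2 * (d - 1))) ^ S.card := by
        rw [pow_add, mul_pow, ← pow_mul]; ring
    _ ≤ z ^ (l.length - 1) * ((1 + κ) ^ (adj (ledges (flip u w S l))
          (ledges (flip u w S l))).ncard * lprob D l) * (z ^ 2 * p₁ ^ 2) ^ S.card := by
        gcongr
    _ = _ := by rw [mul_pow]; ring

end Flip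

/-! ### Entropy from flips beats the attraction of an obstacle -/

section Obstacle

variable {d : ℕ}

open Classical in
/-- The starting points of the steps of `l` that have a parallel edge within `V`. -/
def flippable (V : Set (Vtx d)) (l : List (Vtx d)) : Finset (Vtx d) :=
  l.toFinset.filter fun a => ∃ u w, IsGenerator u ∧ w ∈ transverse u ∧ (a, a + u) ∈ steps l ∧
    a + w ∈ V ∧ a + u + w ∈ V

open Classical in
/-- Colours `(u, w, c)`: a direction, an orthogonal direction and parities of the coordinates. -/
def colours (d : ℕ) : Finset (Vtx d × Vtx d × (Fin d → ZMod 2)) :=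
  (transverse 0 ×ˢ transverse 0 ×ˢ Finset.univ).filter fun q =>
    IsGenerator q.1 ∧ q.2.1 ∈ transverse q.1

open Classical in
/-- The starting points of flippable steps of one colour. -/
def flipClass (V : Set (Vtx d)) (q : Vtx d × Vtx d × (Fin d → ZMod 2)) (l : List (Vtx d)) :
    Finset (Vtx d) :=
  l.toFinset.filter fun a => (a, a + q.1) ∈ steps l ∧ a + q.2.1 ∈ V ∧ a + q.1 + q.2.1 ∈ V ∧
    (fun i => (a i : ZMod 2)) = q.2.2

lemma IsGenerator.mem_transverse_zero {u : Vtx d} (h : IsGenerator u) : u ∈ transverse 0 := by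
  obtain ⟨i, s, hs, rfl⟩ := h.exists_single
  exact mem_transverse.2 ⟨i, s, rfl, hs, rfl⟩

lemma mem_colours {q : Vtx d × Vtx d × (Fin d → ZMod 2)} :
    q ∈ colours d ↔ IsGenerator q.1 ∧ q.2.1 ∈ transverse q.1 := by
  simp only [colours, Finset.mem_filter, Finset.mem_product, Finset.mem_univ, and_true,
    and_iff_right_iff_imp]
  exact fun h => ⟨h.1.mem_transverse_zero, (isGenerator_of_mem_transverse h.2).mem_transverse_zero⟩

/-- Pigeonhole over the colours, whose number depends on `d` only; this is why κ₀ does too, apart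
from p₁. The dimension enters through the existence of two orthogonal directions. -/
lemma exists_colour (hd : 2 ≤ d) (V : Set (Vtx d)) (l : List (Vtx d)) :
    ∃ q ∈ colours d, (flippable V l).card ≤ (colours d).card * (flipClass V q l).card := by
  classical
  have hne : (colours d).Nonempty := by
    refine ⟨(Pi.single ⟨0, by omega⟩ 1, Pi.single ⟨1, by omega⟩ 1, 0),
      mem_colours.2 ⟨⟨_, Or.inl rfl⟩, mem_transverse.2 ⟨⟨1, by omega⟩, 1, ?_, Or.inl rfl, rfl⟩⟩⟩
    simp
  obtain ⟨q, hq, hmax⟩ := Finset.exists_max_image (colours d) (fun q => (flipClass V q l).card) hne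
  refine ⟨q, hq, ?_⟩
  have hsub : flippable V l ⊆ (colours d).biUnion fun q => flipClass V q l := by
    intro a ha
    obtain ⟨h1, u, w, hu, hw, h2, h3, h4⟩ := Finset.mem_filter.1 ha
    refine Finset.mem_biUnion.2 ⟨(u, w, fun i => (a i : ZMod 2)), mem_colours.2 ⟨hu, hw⟩, ?_⟩
    exact Finset.mem_filter.2 ⟨h1, h2, h3, h4, rfl⟩
  refine (Finset.card_le_card hsub).trans (Finset.card_biUnion_le_card_mul _ _ _ hmax)

/-- Moving by the generator `q.1` changes the parity of one coordinate, hence the colour.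
Consecutive steps are thus never flipped together. -/
lemma flipClass_ne_add {V : Set (Vtx d)} {q : Vtx d × Vtx d × (Fin d → ZMod 2)}
    {l : List (Vtx d)} (hq : q ∈ colours d) {a b : Vtx d} (ha : a ∈ flipClass V q l)
    (hb : b ∈ flipClass V q l) : b ≠ a + q.1 := by
  classical
  rintro rfl
  obtain ⟨i, s, hs, hu⟩ := (mem_colours.1 hq).1.exists_single
  have h1 := congrFun (Finset.mem_filter.1 ha).2.2.2.2 i
  have h2 := congrFun (Finset.mem_filter.1 hb).2.2.2.2 i
  rw [← h1, hu] at h2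
  simp only [Pi.add_apply, Pi.single_eq_same, Int.cast_add, add_eq_left] at h2
  rcases hs with rfl | rfl <;> simp at h2

/-- Paths avoiding `V`, weighted by the number of their steps running parallel to edges within
`V`, are dominated by all paths with the same end points. -/
lemma tsum_obstacle_le (hd : 2 ≤ d) {D : Vtx d → ℝ≥0} {p₁ κ z θ : ℝ≥0}
    (hD : ∀ v, IsGenerator v → D v = p₁)
    (hθ : θ * (1 + κ) ^ (2 * (d - 1)) ≤ z ^ 2 * p₁ ^ 2)
    (hκ : (1 + κ) ^ (2 * (d - 1) * (colours d).card) ≤ 1 + θ) (V : Set (Vtx d)) (a b : Vtx d) :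
    ∑' l : {l : List (Vtx d) // IsPath a b l ∧ ∀ v ∈ l, v ∉ V},
      ((lweight D κ z l.1 * (1 + κ) ^ (2 * (d - 1) * (flippable V l.1).card) : ℝ≥0) : ℝ≥0∞) ≤
      ∑' l : {l : List (Vtx d) // IsPath a b l}, (lweight D κ z l.1 : ℝ≥0∞) := by
  classical
  -- The colour depends on the path but not on the subset to be flipped, so it is known again once
  -- the path has been recovered.
  choose col hcol hcard using fun l => exists_colour hd V l
  set F : List (Vtx d) → Finset (Vtx d) := fun l => flipClass V (col l) l with hF
  have hFV : ∀ l, ∀ S ⊆ F l, ∀ x ∈ S, x + (col l).2.1 ∈ V ∧ x + (col l).1 + (col l).2.1 ∈ V :=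
    fun l S hS x hx => ⟨(Finset.mem_filter.1 (hS hx)).2.2.1, (Finset.mem_filter.1 (hS hx)).2.2.2.1⟩
  have hFS : ∀ l, ∀ S ⊆ F l, StepsAlong (col l).1 S l :=
    fun l S hS x _ hx => (Finset.mem_filter.1 (hS hx)).2.1
  have hFl : ∀ l, F l ⊆ l.toFinset := fun l => Finset.filter_subset _ _
  have hgen : ∀ l, IsGenerator (col l).1 ∧ IsGenerator (col l).2.1 := fun l =>
    ⟨(mem_colours.1 (hcol l)).1, isGenerator_of_mem_transverse (mem_colours.1 (hcol l)).2⟩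
  have h0 : ∀ {u : Vtx d}, IsGenerator u → u ≠ 0 := by
    intro u hu h
    obtain ⟨i, s, hs, rfl⟩ := hu.exists_single
    have := congrFun h i
    rw [Pi.single_eq_same, Pi.zero_apply] at this
    omega
  have step1 : ∀ l : {l : List (Vtx d) // IsPath a b l ∧ ∀ v ∈ l, v ∉ V},
      ((lweight D κ z l.1 * (1 + κ) ^ (2 * (d - 1) * (flippable V l.1).card) : ℝ≥0) : ℝ≥0∞) ≤
      ∑' S : {S // S ∈ (F l.1).powerset},
        (lweight D κ z (flip (col l.1).1 (col l.1).2.1 S.1 l.1) : ℝ≥0∞) := by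
    rintro ⟨l, hl, hlV⟩
    rw [Finset.tsum_subtype (F l).powerset
      (fun S => (lweight D κ z (flip (col l).1 (col l).2.1 S l) : ℝ≥0∞))]
    rw [← ENNReal.ofNNReal_finsetSum, ENNReal.coe_le_coe]
    calc lweight D κ z l * (1 + κ) ^ (2 * (d - 1) * (flippable V l).card)
        ≤ lweight D κ z l * (1 + κ) ^ (2 * (d - 1) * (colours d).card * (F l).card) := by
          refine mul_le_mul_right (pow_le_pow_right' le_self_add ?_) _
          rw [mul_assoc (2 * (d - 1))]
          exact Nat.mul_le_mul_left _ (hcard l)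
      _ ≤ lweight D κ z l * (1 + θ) ^ (F l).card := by
          rw [pow_mul]; gcongr
      -- Binomial expansion: each subset of flippable steps of the chosen colour will be realised by
      -- an actual path.
      _ = ∑ S ∈ (F l).powerset, lweight D κ z l * θ ^ S.card := by
          rw [← Finset.mul_sum, add_comm 1 θ, ← Finset.sum_pow_mul_eq_add_pow]
          simp
      _ ≤ _ := by
          refine Finset.sum_le_sum fun S hS => ?_
          have hS := Finset.mem_powerset.1 hS
          exact lweight_flip hD hθ (hgen l).1 (hgen l).2 hl.nodup (hFS l S hS) (hS.trans (hFl l))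
  refine (ENNReal.tsum_le_tsum step1).trans ?_
  rw [← ENNReal.tsum_sigma' (f := fun p : Σ l : {l : List (Vtx d) // IsPath a b l ∧ ∀ v ∈ l, v ∉ V},
    {S // S ∈ (F l.1).powerset} =>
      (lweight D κ z (flip (col p.1.1).1 (col p.1.1).2.1 p.2.1 p.1.1) : ℝ≥0∞))]
  refine tsum_le_tsum_of_injective
    (fun p : Σ l : {l : List (Vtx d) // IsPath a b l ∧ ∀ v ∈ l, v ∉ V},
      {S // S ∈ (F l.1).powerset} =>
      (⟨flip (col p.1.1).1 (col p.1.1).2.1 p.2.1 p.1.1, ?_⟩ : {l : List (Vtx d) // IsPath a b l}))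
    ?_ (fun _ => le_rfl)
  · obtain ⟨⟨l, hl, hlV⟩, S, hS⟩ := p
    have hS := Finset.mem_powerset.1 hS
    exact ⟨nodup_flip hl.nodup hlV (h0 (hgen l).1) (hFV l S hS) (fun x hx y hy =>
      flipClass_ne_add (hcol l) (hS hx) (hS hy)), by rw [head?_flip]; exact hl.head,
      by rw [getLast?_flip hl.nodup (hFS l S hS)]; exact hl.last⟩
  · rintro ⟨⟨l, hl, hlV⟩, S, hS⟩ ⟨⟨l', hl', hlV'⟩, S', hS'⟩ he
    have hS1 := Finset.mem_powerset.1 hS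
    have hS1' := Finset.mem_powerset.1 hS'
    have he : flip (col l).1 (col l).2.1 S l = flip (col l').1 (col l').2.1 S' l' :=
      congrArg Subtype.val he
    have hll : l = l' := by
      rw [← filter_flip hlV (hFV l S hS1), ← filter_flip hlV' (hFV l' S' hS1'), he]
    subst hll
    -- A step of the class was flipped exactly if its first detour vertex is visited. That vertex
    -- lies in `V`, so it is not on `l`; it is not the second detour vertex of another step because
    -- of the parity classes.
    have key : ∀ S ⊆ F l, S = (F l).filter fun x =>
        x + (col l).2.1 ∈ flip (col l).1 (col l).2.1 S l := by
      intro S hS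
      ext x
      simp only [Finset.mem_filter, mem_flip]
      constructor
      · intro hx
        exact ⟨hS hx, Or.inr ⟨x, List.mem_toFinset.1 (hFl l (hS hx)), hx, Or.inl rfl⟩⟩
      · rintro ⟨hxF, h | ⟨y, hy, hyS, h | h⟩⟩
        · exact absurd (hFV l _ subset_rfl x hxF).1 (hlV _ h)
        · rwa [add_right_cancel h]
        · exact absurd (add_right_cancel h) (flipClass_ne_add (hcol l) (hS hyS) hxF)
    have hSS : S = S' := by rw [key S hS1, key S' hS1', he]
    subst hSS
    rfl

lemma tsum_obstacle_le_G (hd : 2 ≤ d) {D : Vtx d → ℝ≥0} {p₁ κ z θ : ℝ≥0}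
    (hD : ∀ v, IsGenerator v → D v = p₁)
    (hθ : θ * (1 + κ) ^ (2 * (d - 1)) ≤ z ^ 2 * p₁ ^ 2)
    (hκ : (1 + κ) ^ (2 * (d - 1) * (colours d).card) ≤ 1 + θ) (V : Set (Vtx d)) (a b : Vtx d) :
    ∑' l : {l : List (Vtx d) // IsPath a b l ∧ ∀ v ∈ l, v ∉ V},
      ((lweight D κ z l.1 * (1 + κ) ^ (2 * (d - 1) * (flippable V l.1).card) : ℝ≥0) : ℝ≥0∞) ≤
      G D κ z (b - a) :=
  (tsum_obstacle_le hd hD hθ hκ V a b).trans (tsum_lweight_le_G D κ z a b)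

lemma IsPath.ne_of_two_le_length {a b : Vtx d} {l : List (Vtx d)} (h : IsPath a b l)
    (h2 : 2 ≤ l.length) : a ≠ b := by
  intro hab
  have := getD_injOn h.nodup h.ne_nil (x₁ := 0) (x₂ := l.length - 1) ⟨le_rfl, Nat.zero_le _⟩
    ⟨Nat.zero_le _, le_rfl⟩ (by simp only [h.getD_zero, h.getD_last, hab])
  omega

lemma H_eq_G_of_ne (D : Vtx d → ℝ≥0) (κ z : ℝ≥0) {x : Vtx d} (hx : x ≠ 0) :
    H D κ z x = G D κ z x := by
  simp [H, hx]

end Obstacle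

/-! ### Kernels of the pieces of a walk -/

section Kernel

variable {d : ℕ} (D : Vtx d → ℝ≥0) (κ z : ℝ≥0)

open Classical in
/-- The weight of a path from `a` to `b` avoiding `V`, including its interaction with `V`; if `hi`
holds, then the path is required to have at least one step. -/
def kern (hi : Prop) (V : Set (Vtx d)) (a b : Vtx d) (l : List (Vtx d)) : ℝ≥0∞ :=
  if IsPath a b l ∧ (∀ v ∈ l, v ∉ V) ∧ (hi → 2 ≤ l.length) then
    ((lweight D κ z l * (1 + κ) ^ (2 * (d - 1) * (flippable V l).card) : ℝ≥0) : ℝ≥0∞) else 0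

open Classical in
/-- `H` if `hi` holds, and `G` otherwise. -/
def HG (hi : Prop) (x : Vtx d) : ℝ≥0∞ := if hi then H D κ z x else G D κ z x

variable {D κ z}

/-- The bound is uniform in `V`, which allows pieces with random obstacles to be summed one at a
time. `H` and `G` differ only at the origin, where a self-avoiding path with at least one step does
not exist. -/
lemma tsum_kern_le (hd : 2 ≤ d) {p₁ θ : ℝ≥0} (hD : ∀ v, IsGenerator v → D v = p₁)
    (hθ : θ * (1 + κ) ^ (2 * (d - 1)) ≤ z ^ 2 * p₁ ^ 2)
    (hκ : (1 + κ) ^ (2 * (d - 1) * (colours d).card) ≤ 1 + θ) (hi : Prop) (V : Set (Vtx d))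
    (a b : Vtx d) : ∑' l, kern D κ z hi V a b l ≤ HG D κ z hi (b - a) := by
  classical
  by_cases h0 : hi ∧ a = b
  · obtain ⟨hi, rfl⟩ := h0
    refine le_trans (le_of_eq ?_) zero_le
    refine ENNReal.tsum_eq_zero.2 fun l => ?_
    rw [kern, if_neg]
    rintro ⟨h1, -, h2⟩
    exact h1.ne_of_two_le_length (h2 hi) rfl
  · have hHG : HG D κ z hi (b - a) = G D κ z (b - a) := by
      by_cases h : hi
      · rw [HG, if_pos h, H_eq_G_of_ne]
        exact fun e => h0 ⟨h, (sub_eq_zero.1 e).symm⟩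
      · rw [HG, if_neg h]
    rw [hHG]
    have hsupp : Function.support (kern D κ z hi V a b) ⊆
        Set.range (Subtype.val : {l : List (Vtx d) // IsPath a b l ∧ ∀ v ∈ l, v ∉ V} → _) := by
      intro l hl
      rw [Subtype.range_coe_subtype]
      by_contra h
      exact hl (if_neg fun h' => h ⟨h'.1, h'.2.1⟩)
    rw [← Subtype.val_injective.tsum_eq hsupp]
    refine le_trans (ENNReal.tsum_le_tsum fun l => ?_) (tsum_obstacle_le_G hd hD hθ hκ V a b)
    rw [kern]
    split_ifs
    · exact le_rfl
    · exact zero_le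

end Kernel

/-! ### Counting pairs of adjacent edges -/

section Count

variable {d : ℕ}

/-- At most `2(d-1)` steps of a self-avoiding path are adjacent to a given edge. -/
lemma card_adjacent_steps_le {ω : ℕ → Vtx d} {p q : ℕ} (hω : Set.InjOn ω (Set.Icc p q))
    {a b : Vtx d} {J : Finset ℕ}
    (hJ : ∀ j ∈ J, p < j ∧ j ≤ q ∧ AdjacentEdges s(a, b) s(ω (j - 1), ω j)) :
    J.card ≤ 2 * (d - 1) := by
  classical
  rcases J.eq_empty_or_nonempty with rfl | ⟨j₀, hj₀⟩
  · simp
  refine le_trans ?_ (card_parallels_le (hJ j₀ hj₀).2.2.exists_shift.1)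
  refine Finset.card_le_card_of_injOn (fun j => s(ω (j - 1), ω j))
    (fun j hj => (hJ j hj).2.2.mem_parallels) ?_
  intro i hi j hj hij
  have hi := hJ i hi
  have hj := hJ j hj
  -- The second case, the same edge traversed in opposite directions, contradicts self-avoidance.
  rcases Sym2.eq_iff.1 hij with ⟨-, h⟩ | ⟨h1, h2⟩
  · exact hω ⟨by omega, by omega⟩ ⟨by omega, by omega⟩ h
  · have e1 := hω ⟨by omega, by omega⟩ ⟨by omega, by omega⟩ h1
    have e2 := hω ⟨by omega, by omega⟩ ⟨by omega, by omega⟩ h2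
    omega

lemma mem_span {x y a b c : Vtx d} :
    c ∈ span s(x, y) s(a, b) ↔ c = x ∨ c = y ∨ c = a ∨ c = b := by
  simp only [span, Set.mem_ofPred_eq, Sym2.mem_iff, or_assoc]

/-- In a self-avoiding path each plaquette is spanned by at most one pair of its steps. -/
lemma card_inner_pairs_le {ω : ℕ → Vtx d} {p q : ℕ} (hpq : p ≤ q)
    (hω : Set.InjOn ω (Set.Icc p q)) {C : Finset (ℕ × ℕ)}
    (hC : ∀ e ∈ C, p ≤ e.1 ∧ e.1 + 1 < e.2 ∧ e.2 ≤ q ∧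
      AdjacentEdges s(ω e.1, ω (e.1 + 1)) s(ω (e.2 - 1), ω e.2)) :
    C.card ≤ (adj (ledges (piece ω p q)) (ledges (piece ω p q))).ncard := by
  rw [← Set.ncard_coe_finset]
  refine Set.ncard_le_ncard_of_injOn
    (fun e => span s(ω e.1, ω (e.1 + 1)) s(ω (e.2 - 1), ω e.2)) ?_ ?_
    (finite_adj (finite_ledges _) (finite_ledges _))
  · intro e he
    have he := hC e he
    refine ⟨_, (mem_ledges_piece hpq).2 ⟨e.1, he.1, by omega, rfl⟩, _,
      (mem_ledges_piece hpq).2 ⟨e.2 - 1, by omega, by omega, ?_⟩, he.2.2.2, rfl⟩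
    rw [Nat.sub_add_cancel (by omega)]
  -- The pair is recovered from its plaquette as the first and the last time at which the path
  -- visits one of the four corners.
  · have key : ∀ e ∈ C, ∀ f ∈ C, span s(ω e.1, ω (e.1 + 1)) s(ω (e.2 - 1), ω e.2) =
        span s(ω f.1, ω (f.1 + 1)) s(ω (f.2 - 1), ω f.2) → f.1 ≤ e.1 ∧ e.2 ≤ f.2 := by
      intro e he f hf h
      have he := hC e he
      have hf := hC f hf
      have h1 : ω e.1 ∈ span s(ω f.1, ω (f.1 + 1)) s(ω (f.2 - 1), ω f.2) := by
        rw [← h, mem_span]; simp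
      have h2 : ω e.2 ∈ span s(ω f.1, ω (f.1 + 1)) s(ω (f.2 - 1), ω f.2) := by
        rw [← h, mem_span]; simp
      rw [mem_span] at h1 h2
      constructor
      · rcases h1 with h | h | h | h <;>
          have := hω ⟨by omega, by omega⟩ ⟨by omega, by omega⟩ h <;> omega
      · rcases h2 with h | h | h | h <;>
          have := hω ⟨by omega, by omega⟩ ⟨by omega, by omega⟩ h <;> omega
    intro e he f hf h
    have h1 := key e he f hf h
    have h2 := key f hf e he h.symm
    exact Prod.ext (by omega) (by omega)

/-- The vertices `ω_v` with `lo < v ≤ p`, other than `ω_p` and `ω_q`. -/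
def pastVertices (ω : ℕ → Vtx d) (lo p q : ℕ) : Set (Vtx d) :=
  {x | (∃ v, lo < v ∧ v ≤ p ∧ ω v = x) ∧ x ≠ ω p ∧ x ≠ ω q}

/-- The number of interactions of the piece `[p, q]` of a walk with itself and with the steps
after time `lo`. -/
lemma card_pairs_le {ω : ℕ → Vtx d} {lo p q : ℕ} (hpq : p ≤ q)
    (hlo : Set.InjOn ω (Set.Ioc lo p)) (hω : Set.InjOn ω (Set.Icc p q)) {C : Finset (ℕ × ℕ)}
    (hC : ∀ e ∈ C, lo ≤ e.1 ∧ e.1 + 1 < e.2 ∧ p < e.2 ∧ e.2 ≤ q ∧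
      AdjacentEdges s(ω e.1, ω (e.1 + 1)) s(ω (e.2 - 1), ω e.2)) :
    C.card ≤ (adj (ledges (piece ω p q)) (ledges (piece ω p q))).ncard + 2 * (d - 1) * 4 +
      2 * (d - 1) * (flippable (pastVertices ω lo p q) (piece ω p q)).card := by
  classical
  -- The bad steps are those that may have an end point outside `pastVertices`, which omits `ω p`
  -- and `ω q` because the path itself contains them. By injectivity there are at most four: `i =
  -- lo`, and one each for `ω i = ω q`, `ω (i + 1) = ω p`, `ω (i + 1) = ω q`, while `ω i = ω p` is
  -- impossible for `lo < i < p`.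
  set bad : ℕ → Prop := fun i => i = lo ∨ (ω i = ω p ∨ ω i = ω q) ∨
    (ω (i + 1) = ω p ∨ ω (i + 1) = ω q) with hbad
  set C₁ := C.filter fun e => p ≤ e.1
  set C₂ := C.filter fun e => e.1 < p ∧ bad e.1
  set C₃ := C.filter fun e => e.1 < p ∧ ¬ bad e.1
  have hsplit : C ⊆ C₁ ∪ C₂ ∪ C₃ := by
    intro e he
    simp only [C₁, C₂, C₃, Finset.mem_union, Finset.mem_filter, he, true_and]
    by_cases h : p ≤ e.1 <;> by_cases h' : bad e.1 <;> simp [h, h'] <;> omega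
  have h1 : C₁.card ≤ (adj (ledges (piece ω p q)) (ledges (piece ω p q))).ncard := by
    refine card_inner_pairs_le hpq hω fun e he => ?_
    obtain ⟨he, hp⟩ := Finset.mem_filter.1 he
    have := hC e he
    exact ⟨hp, this.2.1, this.2.2.2⟩
  have h2 : C₂.card ≤ 2 * (d - 1) * 4 := by
    set B := (Finset.Ico lo p).filter bad with hB
    have hBc : B.card ≤ 4 := by
      have hone : ∀ x : Vtx d, ((Finset.Ioo lo p).filter fun i => ω i = x).card ≤ 1 ∧
          ((Finset.Ioo lo p).filter fun i => ω (i + 1) = x).card ≤ 1 := by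
        intro x
        constructor <;> refine Finset.card_le_one.2 fun i hi j hj => ?_ <;>
          simp only [Finset.mem_filter, Finset.mem_Ioo] at hi hj
        · exact hlo ⟨by omega, by omega⟩ ⟨by omega, by omega⟩ (hi.2.trans hj.2.symm)
        · have := hlo ⟨by omega, by omega⟩ ⟨by omega, by omega⟩ (hi.2.trans hj.2.symm)
          omega
      have hsub : B ⊆ {lo} ∪ ((Finset.Ioo lo p).filter fun i => ω i = ω q) ∪
          ((Finset.Ioo lo p).filter fun i => ω (i + 1) = ω p) ∪
          ((Finset.Ioo lo p).filter fun i => ω (i + 1) = ω q) := by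
        intro i hi
        simp only [hB, hbad, Finset.mem_filter, Finset.mem_Ico] at hi
        simp only [Finset.mem_union, Finset.mem_singleton, Finset.mem_filter, Finset.mem_Ioo]
        by_cases hil : i = lo
        · tauto
        · have : lo < i ∧ i < p := by omega
          have hne : ω i ≠ ω p := fun h => by
            have := hlo ⟨by omega, by omega⟩ ⟨by omega, by omega⟩ h
            omega
          tauto
      calc B.card ≤ _ := Finset.card_le_card hsub
        _ ≤ _ := (Finset.card_union_le _ _).trans (Nat.add_le_add ((Finset.card_union_le _ _).trans
            (Nat.add_le_add (Finset.card_union_le _ _) le_rfl)) le_rfl)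
        _ ≤ 4 := by
          have a1 := (hone (ω q)).1
          have a2 := (hone (ω p)).2
          have a3 := (hone (ω q)).2
          rw [Finset.card_singleton]
          omega
    refine le_trans ?_ (Nat.mul_le_mul_left _ hBc)
    refine Finset.card_le_mul_card_image_of_maps_to (f := Prod.fst) ?_ _ ?_
    · intro e he
      obtain ⟨he, hp, hb⟩ := Finset.mem_filter.1 he
      exact Finset.mem_filter.2 ⟨Finset.mem_Ico.2 ⟨(hC e he).1, hp⟩, hb⟩
    · intro i _
      have hinj : Set.InjOn Prod.snd (C₂.filter fun e => e.1 = i : Set (ℕ × ℕ)) := by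
        intro e he f hf hef
        simp only [Finset.coe_filter, Set.mem_ofPred_eq] at he hf
        exact Prod.ext (he.2.trans hf.2.symm) hef
      rw [← Finset.card_image_of_injOn hinj]
      refine card_adjacent_steps_le hω (a := ω i) (b := ω (i + 1)) fun j hj => ?_
      obtain ⟨e, he, rfl⟩ := Finset.mem_image.1 hj
      obtain ⟨he', rfl⟩ := Finset.mem_filter.1 he
      exact (hC e (Finset.mem_filter.1 he').1).2.2
  -- Both end points of the earlier step are past vertices, so the later step is flippable. The
  -- roles are now reversed: each flippable step is adjacent to at most 2(d-1) earlier ones.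
  have h3 : C₃.card ≤
      2 * (d - 1) * (flippable (pastVertices ω lo p q) (piece ω p q)).card := by
    refine Finset.card_le_mul_card_image_of_maps_to (f := fun e : ℕ × ℕ => ω (e.2 - 1)) ?_ _ ?_
    · intro e he
      obtain ⟨he, hp, hb⟩ := Finset.mem_filter.1 he
      obtain ⟨h1, h2, h3, h4, hadj⟩ := hC e he
      simp only [hbad, not_or] at hb
      obtain ⟨hu, w, hw, hf⟩ := hadj.symm.exists_shift
      have hV : ω e.1 ∈ pastVertices ω lo p q ∧ ω (e.1 + 1) ∈ pastVertices ω lo p q :=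
        ⟨⟨⟨e.1, by omega, by omega, rfl⟩, hb.2.1⟩, ⟨⟨e.1 + 1, by omega, by omega, rfl⟩, hb.2.2⟩⟩
      have hst : (ω (e.2 - 1), ω e.2) ∈ steps (piece ω p q) := by
        refine (mem_steps_piece hpq).2 ⟨e.2 - 1, by omega, by omega, ?_⟩
        rw [Nat.sub_add_cancel (by omega)]
      have hb : ω (e.2 - 1) + (ω e.2 - ω (e.2 - 1)) = ω e.2 := by abel
      refine Finset.mem_filter.2 ⟨List.mem_toFinset.2 (mem_of_mem_steps hst).1,
        ω e.2 - ω (e.2 - 1), w, hu, hw, by rwa [hb], ?_⟩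
      rw [hb]
      rcases Sym2.eq_iff.1 hf with ⟨e1, e2⟩ | ⟨e1, e2⟩
      · rw [← e1, ← e2]; exact hV
      · rw [← e1, ← e2]; exact hV.symm
    · intro x _
      rcases (C₃.filter fun e => ω (e.2 - 1) = x).eq_empty_or_nonempty with h | ⟨f, hf⟩
      · rw [h]; simp
      have hsnd : ∀ e ∈ C₃.filter fun e => ω (e.2 - 1) = x, e.2 = f.2 := by
        intro e he
        obtain ⟨he, hex⟩ := Finset.mem_filter.1 he
        obtain ⟨hf, hfx⟩ := Finset.mem_filter.1 hf
        have he := hC e (Finset.mem_filter.1 he).1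
        have hf := hC f (Finset.mem_filter.1 hf).1
        have := hω ⟨by omega, by omega⟩ ⟨by omega, by omega⟩ (hex.trans hfx.symm)
        omega
      have hinj : Set.InjOn (fun e : ℕ × ℕ => e.1 + 1)
          (C₃.filter fun e => ω (e.2 - 1) = x : Set (ℕ × ℕ)) := by
        intro e he g hg heg
        refine Prod.ext (Nat.succ_injective heg) ?_
        rw [hsnd e (by simpa using he), hsnd g (by simpa using hg)]
      rw [← Finset.card_image_of_injOn hinj]
      have hlo' : Set.InjOn ω (Set.Icc (lo + 1) p) := by
        refine hlo.mono ?_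
        rintro i ⟨h1, h2⟩
        exact ⟨Nat.lt_of_succ_le h1, h2⟩
      refine card_adjacent_steps_le hlo' (a := ω (f.2 - 1)) (b := ω f.2) fun j hj => ?_
      obtain ⟨e, he, rfl⟩ := Finset.mem_image.1 hj
      have h2 := hsnd e he
      obtain ⟨he, hp, hb⟩ := Finset.mem_filter.1 (Finset.mem_filter.1 he).1
      have := hC e he
      simp only [hbad, not_or] at hb
      refine ⟨by omega, by omega, ?_⟩
      rw [← h2, Nat.add_sub_cancel]
      exact this.2.2.2.2.symm
  calc C.card ≤ _ := Finset.card_le_card hsplit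
    _ ≤ C₁.card + C₂.card + C₃.card := (Finset.card_union_le _ _).trans
        (Nat.add_le_add_right (Finset.card_union_le _ _) _)
    _ ≤ _ := by omega

end Count

/-! ### The structure of laces -/

section Lace

lemma mem_pairs {a b : ℕ} {e : ℕ × ℕ} : e ∈ pairs a b ↔ a ≤ e.1 ∧ e.1 + 1 < e.2 ∧ e.2 ≤ b := by
  simp only [pairs, Finset.mem_filter, Finset.mem_product, Finset.mem_Icc]
  constructor
  · rintro ⟨⟨h1, h2⟩, h3⟩; exact ⟨h1.1, h3, h2.2⟩
  · rintro ⟨h1, h2, h3⟩; exact ⟨⟨⟨h1, by omega⟩, by omega, h3⟩, h2⟩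

/-- The left end points of the edges of a lace are `σ 0 = 0, …, σ (m-1)`, the right end points are
`τ 1, …, τ m`, and `τ 0 = 0`. -/
def laceTau (L : Finset (ℕ × ℕ)) : ℕ → ℕ
  | 0 => 0
  | k + 1 => laceT 0 L k

/-- The left end points of the edges of a lace. -/
def laceSig (L : Finset (ℕ × ℕ)) : ℕ → ℕ := laceS 0 L

variable {n m : ℕ} {L : Finset (ℕ × ℕ)}

lemma snd_le_laceT_succ {Γ : Finset (ℕ × ℕ)} {e : ℕ × ℕ} {k : ℕ} (he : e ∈ Γ)
    (h : e.1 < laceT 0 Γ k) : e.2 ≤ laceT 0 Γ (k + 1) :=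
  Finset.le_sup (f := Prod.snd) (Finset.mem_filter.2 ⟨he, h⟩)

lemma snd_le_laceT_zero {Γ : Finset (ℕ × ℕ)} {e : ℕ × ℕ} (he : e ∈ Γ)
    (h : e.1 = 0) : e.2 ≤ laceT 0 Γ 0 :=
  Finset.le_sup (f := Prod.snd) (Finset.mem_filter.2 ⟨he, h⟩)

lemma laceT_zero_mem (hn : 2 ≤ n) (hc : IsConn 0 n L) : (0, laceT 0 L 0) ∈ L := by
  obtain ⟨e, he, h1, h2⟩ := hc 1 (by omega) (by omega)
  obtain ⟨f, hf, hfe⟩ := Finset.exists_mem_eq_sup (L.filter fun e => e.1 = 0)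
    ⟨e, Finset.mem_filter.2 ⟨he, by omega⟩⟩ Prod.snd
  obtain ⟨hf, hf0⟩ := Finset.mem_filter.1 hf
  rw [laceT, hfe, ← hf0]
  exact hf

lemma exists_laceT_mem (hn : 2 ≤ n) (hL : L ⊆ pairs 0 n) (hc : IsConn 0 n L)
    (k : ℕ) : ∃ s, (s, laceT 0 L k) ∈ L := by
  induction k with
  | zero => exact ⟨0, laceT_zero_mem hn hc⟩
  | succ k ih =>
    obtain ⟨s, hs⟩ := ih
    have hs' := mem_pairs.1 (hL hs)
    obtain ⟨f, hf, hfe⟩ := Finset.exists_mem_eq_sup (L.filter fun e => e.1 < laceT 0 L k)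
      ⟨_, Finset.mem_filter.2 ⟨hs, by simp only at hs' ⊢; omega⟩⟩ Prod.snd
    obtain ⟨hf, hf0⟩ := Finset.mem_filter.1 hf
    exact ⟨f.1, by rw [laceT, hfe]; exact hf⟩

lemma exists_laceT_succ_mem (hn : 2 ≤ n) (hL : L ⊆ pairs 0 n) (hc : IsConn 0 n L)
    {Γ : Finset (ℕ × ℕ)} (hΓ : L ⊆ Γ) {k : ℕ} (hk : laceT 0 Γ k = laceT 0 L k) :
    ∃ s < laceT 0 Γ k, (s, laceT 0 Γ (k + 1)) ∈ Γ := by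
  obtain ⟨s, hs⟩ := exists_laceT_mem hn hL hc k
  have hs' := mem_pairs.1 (hL hs)
  obtain ⟨f, hf, hfe⟩ := Finset.exists_mem_eq_sup (Γ.filter fun e => e.1 < laceT 0 Γ k)
    ⟨_, Finset.mem_filter.2 ⟨hΓ hs, by rw [hk]; simp only at hs' ⊢; omega⟩⟩ Prod.snd
  obtain ⟨hf, hf0⟩ := Finset.mem_filter.1 hf
  exact ⟨f.1, hf0, by rw [laceT, hfe]; exact hf⟩

lemma laceS_mem (hn : 2 ≤ n) (hL : L ⊆ pairs 0 n) (hc : IsConn 0 n L)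
    (k : ℕ) : (laceS 0 L k, laceT 0 L k) ∈ L := by
  cases k with
  | zero => exact laceT_zero_mem hn hc
  | succ k => exact Nat.sInf_mem (s := {s | (s, laceT 0 L (k + 1)) ∈ L}) (exists_laceT_mem hn hL hc _)

lemma laceS_succ_le {Γ : Finset (ℕ × ℕ)} {s k : ℕ} (h : (s, laceT 0 Γ (k + 1)) ∈ Γ) :
    laceS 0 Γ (k + 1) ≤ s :=
  Nat.sInf_le h

lemma laceS_succ_lt (hn : 2 ≤ n) (hL : L ⊆ pairs 0 n) (hc : IsConn 0 n L)
    (k : ℕ) : laceS 0 L (k + 1) < laceT 0 L k := by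
  obtain ⟨s, hs, h⟩ := exists_laceT_succ_mem hn hL hc subset_rfl (k := k) rfl
  exact (laceS_succ_le h).trans_lt hs

lemma laceT_le (hn : 2 ≤ n) (hL : L ⊆ pairs 0 n) (hc : IsConn 0 n L)
    (k : ℕ) : laceT 0 L k ≤ n := by
  obtain ⟨s, hs⟩ := exists_laceT_mem hn hL hc k
  exact (mem_pairs.1 (hL hs)).2.2

lemma laceT_mono (hn : 2 ≤ n) (hL : L ⊆ pairs 0 n) (hc : IsConn 0 n L) : Monotone (laceT 0 L) := by
  refine monotone_nat_of_le_succ fun k => ?_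
  obtain ⟨s, hs⟩ := exists_laceT_mem hn hL hc k
  have hs' := mem_pairs.1 (hL hs)
  exact snd_le_laceT_succ hs (by simp only at hs' ⊢; omega)

lemma laceT_lt_succ (hn : 2 ≤ n) (hL : L ⊆ pairs 0 n) (hc : IsConn 0 n L) 
    {k : ℕ} (h : laceT 0 L k < n) : laceT 0 L k < laceT 0 L (k + 1) := by
  obtain ⟨s, hs⟩ := exists_laceT_mem hn hL hc k
  have hs' := mem_pairs.1 (hL hs)
  obtain ⟨e, he, h1, h2⟩ := hc (laceT 0 L k) (by simp only at hs'; omega) h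
  exact h2.trans_le (snd_le_laceT_succ he h1)

lemma exists_laceT_eq (hn : 2 ≤ n) (hL : L ⊆ pairs 0 n) (hc : IsConn 0 n L) : ∃ k, laceT 0 L k = n := by
  refine ⟨n, le_antisymm (laceT_le hn hL hc n) ?_⟩
  have : ∀ k, min n k ≤ laceT 0 L k := by
    intro k
    induction k with
    | zero => simp
    | succ k ih =>
      rcases (laceT_le hn hL hc k).lt_or_eq with h | h
      · have := laceT_lt_succ hn hL hc h; omega
      · have := laceT_mono hn hL hc (show k ≤ k + 1 by omega); omega
  simpa using this n

/-- The structure of the lace `L` on `{0, …, n}` with `m` edges, and of its compatible edges. -/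
structure LaceSeq (n m : ℕ) (L : Finset (ℕ × ℕ)) (σ τ : ℕ → ℕ) : Prop where
  tau_zero : τ 0 = 0
  tau_last : τ m = n
  tau_lt : ∀ k < m, τ k < τ (k + 1)
  sig_zero : σ 0 = 0
  sig_lt : ∀ k, σ (k + 1) < τ (k + 1)
  tau_le_sig : ∀ k, k + 1 < m → τ k ≤ σ (k + 1)
  sig_pos : 1 < m → 0 < σ 1
  mem_iff : ∀ e, e ∈ L ↔ ∃ k < m, e = (σ k, τ (k + 1))
  compatible_le : ∀ e ∈ compatible 0 n L, ∀ k, e.1 < τ (k + 1) → e.2 ≤ τ (k + 2)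
  compatible_mid : ∀ i j k, 1 ≤ i → τ k ≤ i → i + 1 < j → j < τ (k + 2) →
    (i, j) ∈ compatible 0 n L
  compatible_first : ∀ i j, i + 1 < j → j < τ 1 → (i, j) ∈ compatible 0 n L
  compatible_last : ∀ i k, k < m → σ k < i → i + 1 < τ (k + 1) → (i, τ (k + 1)) ∈ compatible 0 n L

/-- A sufficient criterion for compatibility: `e` reaches no further than the edge the algorithm
selects whenever it is a candidate, and it does not win the tie for the smallest left end point. -/
lemma laceMap_insert_eq (hn : 2 ≤ n) (hL : L ⊆ pairs 0 n) (hc : IsConn 0 n L) {e : ℕ × ℕ}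
    (h0 : e.1 = 0 → e.2 ≤ laceT 0 L 0)
    (h1 : ∀ k, e.1 < laceT 0 L k → e.2 ≤ laceT 0 L (k + 1))
    (h2 : ∀ k, e.2 = laceT 0 L (k + 1) → laceS 0 L (k + 1) ≤ e.1) :
    laceMap 0 (insert e L) = laceMap 0 L := by
  have hT : ∀ k, laceT 0 (insert e L) k = laceT 0 L k := by
    intro k
    induction k with
    | zero =>
      refine le_antisymm (Finset.sup_le fun f hf => ?_)
        (Finset.sup_mono (Finset.filter_subset_filter _ (Finset.subset_insert _ _)))
      obtain ⟨hf, hf0⟩ := Finset.mem_filter.1 hf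
      rcases Finset.mem_insert.1 hf with rfl | hf
      · exact h0 hf0
      · exact snd_le_laceT_zero hf hf0
    | succ k ih =>
      refine le_antisymm (Finset.sup_le fun f hf => ?_) (Finset.sup_le fun f hf => ?_)
      · obtain ⟨hf, hf0⟩ := Finset.mem_filter.1 hf
        rw [ih] at hf0
        rcases Finset.mem_insert.1 hf with rfl | hf
        · exact h1 k hf0
        · exact snd_le_laceT_succ hf hf0
      · obtain ⟨hf, hf0⟩ := Finset.mem_filter.1 hf
        exact snd_le_laceT_succ (Finset.mem_insert_of_mem hf) (by rw [ih]; exact hf0)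
  have hS : ∀ k, laceS 0 (insert e L) k = laceS 0 L k := by
    intro k
    cases k with
    | zero => rfl
    | succ k =>
      refine le_antisymm (laceS_succ_le ?_) ?_
      · rw [hT]
        exact Finset.mem_insert_of_mem (laceS_mem hn hL hc _)
      · have hmem : (laceS 0 (insert e L) (k + 1), laceT 0 (insert e L) (k + 1)) ∈ insert e L :=
          Nat.sInf_mem (s := {s | (s, laceT 0 (insert e L) (k + 1)) ∈ insert e L})
            ⟨laceS 0 L (k + 1), by
              rw [hT]
              exact Finset.mem_insert_of_mem (laceS_mem hn hL hc _)⟩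
        rw [hT] at hmem
        rcases Finset.mem_insert.1 hmem with h | h
        · have e1 := congrArg Prod.fst h
          have e2 := congrArg Prod.snd h
          simp only at e1 e2
          rw [e1]
          exact h2 k e2.symm
        · exact laceS_succ_le h
  simp only [laceMap, hT, hS]

/-- If the algorithm on the larger graph selects only edges of `L`, then it has the same right end
points as on `L`; their maximality then applies to `e`. -/
lemma le_laceT_of_laceMap_insert (hn : 2 ≤ n) (hL : L ⊆ pairs 0 n) (hc : IsConn 0 n L)
    {e : ℕ × ℕ} (he : laceMap 0 (insert e L) = (L : Set (ℕ × ℕ))) {k : ℕ}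
    (hk : e.1 < laceT 0 L k) : e.2 ≤ laceT 0 L (k + 1) := by
  have hmem : ∀ k, (laceS 0 (insert e L) k, laceT 0 (insert e L) k) ∈ L := by
    intro k
    rw [← Finset.mem_coe, ← he]
    exact ⟨k, rfl⟩
  have hT : ∀ k, laceT 0 (insert e L) k = laceT 0 L k := by
    intro k
    induction k with
    | zero =>
      exact le_antisymm (snd_le_laceT_zero (hmem 0) rfl)
        (Finset.sup_mono (Finset.filter_subset_filter _ (Finset.subset_insert _ _)))
    | succ k ih =>
      refine le_antisymm ?_ (Finset.sup_le fun f hf => ?_)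
      · obtain ⟨s, hs, hs'⟩ := exists_laceT_succ_mem hn hL hc (Finset.subset_insert e L) ih
        exact snd_le_laceT_succ (hmem (k + 1)) (by rw [← ih]; exact (laceS_succ_le hs').trans_lt hs)
      · obtain ⟨hf, hf0⟩ := Finset.mem_filter.1 hf
        exact snd_le_laceT_succ (Finset.mem_insert_of_mem hf) (by rw [ih]; exact hf0)
  rw [← hT]
  exact snd_le_laceT_succ (Finset.mem_insert_self _ _) (by rw [hT]; exact hk)

/-- Minimality forces the lace to consist of the edges found by its own algorithm until the right
end point reaches `n`. An edge is compatible if it never outreaches the selected edge; this gives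
both the restriction on where compatible edges start and the large supply of them needed for
self-avoidance. Edges starting at 0 are special because the algorithm's first choice is among them.
-/
lemma laceSeq_of_mem_laces (hn : 2 ≤ n) (hLm : L ∈ laces 0 n m) :
    LaceSeq n m L (laceSig L) (laceTau L) := by
  classical
  obtain ⟨-, ⟨hL, hc, hmin⟩, hm⟩ := Finset.mem_filter.1 hLm
  have hmono := laceT_mono hn hL hc
  have hmem := laceS_mem hn hL hc
  have hex := exists_laceT_eq hn hL hc
  set K := Nat.find hex with hK
  have hKn : laceT 0 L K = n := Nat.find_spec hex
  have hlt : ∀ k < K, laceT 0 L k < laceT 0 L (k + 1) := fun k hk =>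
    laceT_lt_succ hn hL hc (lt_of_le_of_ne (laceT_le hn hL hc k) (Nat.find_min hex hk))
  have hinj : ∀ i ≤ K, ∀ j ≤ K, laceT 0 L i = laceT 0 L j → i = j := by
    have : ∀ i j, i < j → j ≤ K → laceT 0 L i < laceT 0 L j := fun i j hij hj =>
      (hlt i (by omega)).trans_le (hmono hij)
    intro i hi j hj h
    rcases lt_trichotomy i j with h' | h' | h'
    · exact absurd h (this i j h' hj).ne
    · exact h'
    · exact absurd h (this j i h' hi).ne'
  set E := (Finset.range (K + 1)).image fun k => (laceS 0 L k, laceT 0 L k) with hE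
  have hEL : E = L := by
    refine Finset.Subset.antisymm ?_ ?_
    · intro e he
      obtain ⟨k, -, rfl⟩ := Finset.mem_image.1 he
      exact hmem k
    · intro e he
      by_contra heE
      -- An edge outside `E` would be removable: `j` is covered by the first selected edge whose
      -- right end point exceeds `j`, since that edge starts before the previous right end point.
      refine hmin e he fun j hj0 hjn => ?_
      have hjex : ∃ k, j < laceT 0 L k := ⟨K, hKn ▸ hjn⟩
      have hkK : Nat.find hjex ≤ K := Nat.find_min' hjex (hKn ▸ hjn)
      have hfind := Nat.find_spec hjex
      refine ⟨(laceS 0 L (Nat.find hjex), laceT 0 L (Nat.find hjex)),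
        Finset.mem_erase.2 ⟨?_, hmem _⟩, ?_, hfind⟩
      · rintro rfl
        exact heE (Finset.mem_image.2 ⟨_, Finset.mem_range.2 (by omega), rfl⟩)
      · rcases h : Nat.find hjex with _ | k
        · exact hj0
        · have h1 := Nat.find_min hjex (m := k) (by omega)
          have h2 := laceS_succ_lt hn hL hc k
          simp only
          omega
  have hmK : m = K + 1 := by
    rw [← hm, ← hEL, hE, Finset.card_image_of_injOn, Finset.card_range]
    intro i hi j hj hij
    simp only [Finset.coe_range, Set.mem_Iio] at hi hj
    exact hinj i (by omega) j (by omega) (congrArg Prod.snd hij)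
  have hmem_iff : ∀ e, e ∈ L ↔ ∃ k < m, e = (laceS 0 L k, laceT 0 L k) := by
    intro e
    conv_lhs => rw [← hEL]
    simp only [hE, Finset.mem_image, Finset.mem_range, ← hmK]
    constructor <;> rintro ⟨k, hk, h⟩ <;> exact ⟨k, hk, h.symm⟩
  have hmap : laceMap 0 L = (L : Set (ℕ × ℕ)) := by
    ext e
    rw [Finset.mem_coe]
    constructor
    · rintro ⟨k, rfl⟩; exact hmem k
    · intro he
      obtain ⟨k, -, rfl⟩ := (hmem_iff e).1 he
      exact ⟨k, rfl⟩
  -- Otherwise edge `k + 2` would have been a candidate one stage earlier, and it reaches further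
  -- than edge `k + 1`.
  have hle_sig : ∀ k, k + 2 < m → laceT 0 L k ≤ laceS 0 L (k + 2) := by
    intro k hk
    by_contra h
    have h1 := snd_le_laceT_succ (hmem (k + 2)) (not_le.1 h)
    have h2 : laceT 0 L (k + 1) < laceT 0 L (k + 2) := hlt (k + 1) (by omega)
    simp only at h1
    omega
  have hcomp : ∀ e ∈ pairs 0 n, e ∉ L → (e.1 = 0 → e.2 ≤ laceT 0 L 0) →
      (∀ k, e.1 < laceT 0 L k → e.2 ≤ laceT 0 L (k + 1)) →
      (∀ k, e.2 = laceT 0 L (k + 1) → laceS 0 L (k + 1) ≤ e.1) → e ∈ compatible 0 n L := by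
    intro e he heL h0 h1 h2
    exact Finset.mem_filter.2 ⟨he, heL, (laceMap_insert_eq hn hL hc h0 h1 h2).trans hmap⟩
  have htau_mono : Monotone (laceTau L) := by
    refine monotone_nat_of_le_succ fun k => ?_
    cases k with
    | zero => exact Nat.zero_le _
    | succ k => exact hmono (Nat.le_succ k)
  have hsig_lt : ∀ k, laceSig L (k + 1) < laceTau L (k + 1) := laceS_succ_lt hn hL hc
  have hT0 : 0 < laceT 0 L 0 := by
    have := (mem_pairs.1 (hL (hmem 0))).2.1
    simp only at this
    omega
  refine ⟨rfl, by rw [hmK]; exact hKn, ?_, rfl, hsig_lt, ?_, ?_, hmem_iff, ?_, ?_, ?_, ?_⟩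
  · intro k hk
    cases k with
    | zero => exact hT0
    | succ k => exact hlt k (by omega)
  · intro k hk
    cases k with
    | zero => exact Nat.zero_le _
    | succ k => exact hle_sig k hk
  · intro h1
    by_contra h
    have h2 := snd_le_laceT_zero (hmem 1) (Nat.le_zero.1 (not_lt.1 h))
    have h3 : laceT 0 L 0 < laceT 0 L 1 := hlt 0 (by omega)
    simp only at h2
    omega
  · intro e he k hk
    exact le_laceT_of_laceMap_insert hn hL hc (Finset.mem_filter.1 he).2.2 hk
  · intro i j k hi hk hij hj
    have hn' : laceTau L (k + 2) ≤ n := laceT_le hn hL hc (k + 1)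
    refine hcomp _ (mem_pairs.2 ⟨Nat.zero_le _, hij, by simp only; omega⟩) ?_ ?_ ?_ ?_
    · intro he
      obtain ⟨l, hl, he⟩ := (hmem_iff _).1 he
      obtain ⟨rfl, rfl⟩ := Prod.mk.inj he
      have hlk : l ≤ k := by
        by_contra h
        exact absurd (htau_mono (show k + 2 ≤ l + 1 by omega)) (not_le.2 hj)
      cases l with
      | zero => exact absurd hi (by simp [laceS])
      | succ l =>
        have h1 := hsig_lt l
        have h2 := htau_mono hlk
        simp only [laceSig] at h1
        omega
    · intro h; simp only at h; omega
    · intro l hl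
      by_contra h
      simp only at hl h
      rcases lt_or_ge l k with h' | h'
      · have h1 : laceT 0 L l ≤ laceTau L k := htau_mono (show l + 1 ≤ k from h')
        omega
      · have h1 : laceTau L (k + 2) ≤ laceTau L (l + 2) := htau_mono (by omega)
        have h2 : laceTau L (l + 2) = laceT 0 L (l + 1) := rfl
        omega
    · intro l hl
      simp only at hl ⊢
      have hlk : l < k := by
        by_contra h
        have h1 : laceTau L (k + 2) ≤ laceTau L (l + 2) := htau_mono (by omega)
        have h2 : laceTau L (l + 2) = laceT 0 L (l + 1) := rfl
        omega
      have h1 := hsig_lt l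
      have h2 := htau_mono (show l + 1 ≤ k from hlk)
      simp only [laceSig] at h1
      omega
  · intro i j hij hj
    have hj : j < laceT 0 L 0 := hj
    have hT0n := laceT_le hn hL hc 0
    refine hcomp _ (mem_pairs.2 ⟨Nat.zero_le _, hij, by simp only; omega⟩) ?_ ?_ ?_ ?_
    · intro he
      obtain ⟨l, hl, he⟩ := (hmem_iff _).1 he
      obtain ⟨rfl, rfl⟩ := Prod.mk.inj he
      exact absurd (hmono (Nat.zero_le l)) (not_le.2 hj)
    · intro _; exact hj.le
    · intro l _; exact hj.le.trans (hmono (Nat.zero_le _))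
    · intro l hl
      have := hmono (Nat.zero_le (l + 1))
      simp only at hl
      omega
  · intro i k hk hi hik
    have hi : laceS 0 L k < i := hi
    refine hcomp _ (mem_pairs.2 ⟨Nat.zero_le _, hik, laceT_le hn hL hc k⟩) ?_ ?_ ?_ ?_
    · intro he
      obtain ⟨l, hl, he⟩ := (hmem_iff _).1 he
      obtain ⟨h1, h2⟩ := Prod.mk.inj he
      have := hinj k (by omega) l (by omega) h2
      subst this
      omega
    · intro h; simp only at h; omega
    · intro l hl
      simp only at hl
      change laceT 0 L k ≤ laceT 0 L (l + 1)
      refine hmono ?_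
      by_contra h
      obtain ⟨k', rfl⟩ : ∃ k', k = k' + 2 := ⟨k - 2, by omega⟩
      have h1 := hle_sig k' hk
      have h2 := hmono (show l ≤ k' by omega)
      omega
    · intro l hl
      simp only at hl ⊢
      refine (laceS_succ_le (s := laceS 0 L k) ?_).trans hi.le
      rw [← hl]
      exact hmem k

end Lace

/-! ### Iterated sums -/

section Iterated

variable {P : Type*}

/-- The extension of a finite tuple to a sequence by a default value. -/
def extend (p₀ : P) {N : ℕ} (q : Fin N → P) (b : ℕ) : P := if h : b < N then q ⟨b, h⟩ else p₀

/-- If `w b q` depends only on `q 0, …, q b`, and the sum over `q b` is at most `K b`, then the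
product of the `w b` has sum at most the product of the `K b`. -/
lemma tsum_prod_le (p₀ : P) (N : ℕ) (w : ℕ → (ℕ → P) → ℝ≥0∞) (K : ℕ → ℝ≥0∞)
    (hloc : ∀ b q q', (∀ b' ≤ b, q b' = q' b') → w b q = w b q')
    (hK : ∀ b q, ∑' p, w b (Function.update q b p) ≤ K b) :
    ∑' q : Fin N → P, ∏ b ∈ Finset.range N, w b (extend p₀ q) ≤ ∏ b ∈ Finset.range N, K b := by
  induction N with
  | zero => simp
  | succ N ih =>
    calc ∑' q : Fin (N + 1) → P, ∏ b ∈ Finset.range (N + 1), w b (extend p₀ q)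
        ≤ ∑' q : (Fin N → P) × P, (∏ b ∈ Finset.range N, w b (extend p₀ q.1)) *
            w N (Function.update (extend p₀ q.1) N q.2) := by
          refine tsum_le_tsum_of_injective
            (fun q : Fin (N + 1) → P => (fun i : Fin N => q i.castSucc, q (Fin.last N))) ?_ ?_
          · intro q q' h
            obtain ⟨h1, h2⟩ := Prod.mk.inj h
            funext i
            refine Fin.lastCases h2 (fun i => congrFun h1 i) i
          · intro q
            have hq : ∀ b < N, extend p₀ q b = extend p₀ (fun i : Fin N => q i.castSucc) b := by
              intro b hb
              rw [extend, extend, dif_pos hb, dif_pos (by omega)]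
              rfl
            rw [Finset.prod_range_succ]
            refine le_of_eq (congrArg₂ _ (Finset.prod_congr rfl fun b hb => ?_) ?_)
            · have hb := Finset.mem_range.1 hb
              exact hloc _ _ _ fun b' hb' => hq b' (by omega)
            · refine hloc _ _ _ fun b' hb' => ?_
              rcases hb'.lt_or_eq with h | rfl
              · rw [Function.update_of_ne h.ne, hq b' h]
              · rw [Function.update_self, extend, dif_pos (by omega)]
                rfl
      _ = ∑' q : Fin N → P, (∏ b ∈ Finset.range N, w b (extend p₀ q)) *
            ∑' p, w N (Function.update (extend p₀ q) N p) := by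
          rw [ENNReal.tsum_prod (f := fun q p => (∏ b ∈ Finset.range N, w b (extend p₀ q)) *
            w N (Function.update (extend p₀ q) N p))]
          simp only [ENNReal.tsum_mul_left]
      _ ≤ ∑' q : Fin N → P, (∏ b ∈ Finset.range N, w b (extend p₀ q)) * K N :=
          ENNReal.tsum_le_tsum fun q => mul_le_mul_right (hK N _) _
      _ ≤ _ := by
          rw [ENNReal.tsum_mul_right, Finset.prod_range_succ]
          exact mul_le_mul_left ih _

end Iterated

/-! ### Finiteness below the critical point -/

section Finiteness

variable {d : ℕ} {D : Vtx d → ℝ≥0} {κ z : ℝ≥0}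

lemma chi_lt_top (hz : (z : ℝ≥0∞) < zc D κ) : χ D κ z < ∞ := by
  obtain ⟨w, ⟨y, hy, rfl⟩, hzy⟩ := lt_sSup_iff.1 hz
  refine lt_of_le_of_lt (ENNReal.tsum_le_tsum fun n => ?_) hy
  gcongr

lemma tsum_G_le : ∑' x, G D κ z x ≤ χ D κ z := by
  simp only [G]
  rw [ENNReal.tsum_comm]
  refine ENNReal.tsum_le_tsum fun n => ?_
  rw [c, mul_comm, ← ENNReal.tsum_mul_left, ← ENNReal.tsum_sigma' (f := fun p : Σ x, SAWsTo d n x =>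
    (z : ℝ≥0∞) ^ n * (p.2.1.weight D κ : ℝ≥0∞))]
  refine tsum_le_tsum_of_injective
    (fun p : Σ x, SAWsTo d n x => (⟨p.2.1, p.2.2.1, p.2.2.2.2⟩ : SAWs d n)) ?_ fun _ => le_rfl
  rintro ⟨x, ω, h0, hn, hs⟩ ⟨x', ω', h0', hn', hs'⟩ h
  obtain rfl : ω = ω' := Subtype.ext_iff.1 h
  obtain rfl : x = x' := hn.symm.trans hn'
  rfl

lemma G_le_chi (x : Vtx d) : G D κ z x ≤ χ D κ z := (ENNReal.le_tsum x).trans tsum_G_le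

lemma H_le_G (x : Vtx d) : H D κ z x ≤ G D κ z x := tsub_le_self

lemma conv_lt_top {p₁ : ℝ≥0} (hD : IsStepDistribution D p₁) (hz : (z : ℝ≥0∞) < zc D κ)
    (x : Vtx d) : conv (fun y => (D y : ℝ≥0∞)) (H D κ z) x < ∞ := by
  calc conv (fun y => (D y : ℝ≥0∞)) (H D κ z) x ≤ ∑' y, (D y : ℝ≥0∞) * χ D κ z :=
        ENNReal.tsum_le_tsum fun y => mul_le_mul_right ((H_le_G _).trans (G_le_chi _)) _
    _ = χ D κ z := by
        rw [ENNReal.tsum_mul_right, ENNReal.tsum_coe_eq hD.hasSum, ENNReal.coe_one, one_mul]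
    _ < ∞ := chi_lt_top hz

lemma r_le (x : Vtx d) : r κ x ≤ 1 + κ := by
  unfold r
  gcongr
  · split_ifs <;> simp
  · split_ifs <;> simp

lemma tsum_r_lt_top : ∑' x : Vtx d, r κ x < ∞ := by
  rw [tsum_eq_sum (s := Finset.Icc (-1) 1)]
  · refine ENNReal.sum_lt_top.2 fun x _ => (r_le x).trans_lt ?_
    exact ENNReal.add_lt_top.2 ⟨ENNReal.one_lt_top, ENNReal.coe_lt_top⟩
  · intro x hx
    have hx1 : ¬ ‖x‖ ≤ 1 := by
      intro h
      refine hx (Finset.mem_Icc.2 ⟨fun i => ?_, fun i => ?_⟩) <;>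
      · have := (norm_le_pi_norm x i).trans h
        rw [Int.norm_eq_abs] at this
        have h2 : |x i| ≤ 1 := by exact_mod_cast this
        have h3 := abs_le.1 h2
        simp only [Pi.neg_apply, Pi.one_apply]
        omega
    have h0 : x ≠ 0 := by rintro rfl; simp at hx1
    have h1 : ‖x‖ ≠ 1 := fun h => hx1 h.le
    simp [r, h0, h1]

lemma tsum_sub_right (f : Vtx d → ℝ≥0∞) (a : Vtx d) : ∑' p, f (p - a) = ∑' p, f p :=
  (Equiv.subRight a).tsum_eq f

lemma prod_range_two_mul (f : ℕ → ℝ≥0∞) (a : ℕ) :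
    ∏ b ∈ Finset.range (2 * a), f b = ∏ j ∈ Finset.range a, (f (2 * j) * f (2 * j + 1)) := by
  induction a with
  | zero => rfl
  | succ a ih =>
    rw [show 2 * (a + 1) = 2 * a + 1 + 1 by ring, Finset.prod_range_succ, Finset.prod_range_succ,
      Finset.prod_range_succ, ih, mul_assoc]

lemma prod_Icc_one (f : ℕ → ℝ≥0∞) (a : ℕ) :
    ∏ j ∈ Finset.Icc 1 a, f j = ∏ j ∈ Finset.range a, f (j + 1) := by
  induction a with
  | zero => rfl
  | succ a ih => rw [Finset.prod_Icc_succ_top (by omega), ih, Finset.prod_range_succ]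

/-- For each vertex y_i one factor linking it to earlier vertices (or to the origin) is kept and
summed; all other factors are bounded by their suprema, χ or 1+κ. -/
lemma diagram_lt_top (hz : (z : ℝ≥0∞) < zc D κ) {m : ℕ} (hm : 2 ≤ m) (x : Vtx d) :
    diagram D κ z m x < ∞ := by
  obtain ⟨a, rfl⟩ := Nat.exists_eq_add_of_le' hm
  set X := χ D κ z
  have hX : X < ∞ := chi_lt_top hz
  set R := ∑' x : Vtx d, r κ x
  have hR : R < ∞ := tsum_r_lt_top
  -- With `b = i - 2`: even `i` is attached to y_(i-1) by `G`, odd `i` to y_(i-3) by `r`; the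
  -- vertices y_2 and y_3 are attached to the origin.
  set w : ℕ → (ℕ → Vtx d) → ℝ≥0∞ := fun b q =>
    if b % 2 = 0 then G D κ z (q b - if b = 0 then 0 else q (b - 1))
    else r κ (q b - if b = 1 then 0 else q (b - 3)) with hw
  set K : ℕ → ℝ≥0∞ := fun b => if b % 2 = 0 then X else R
  have hH : ∀ y, H D κ z y ≤ X := fun y => (H_le_G y).trans (G_le_chi y)
  have hy : ∀ (y : Fin (2 * (a + 2) - 2) → Vtx d) i, ycoord y i = extend 0 y (i - 2) :=
    fun _ _ => rfl
  have hterm : ∀ y : Fin (2 * (a + 2) - 2) → Vtx d,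
      H D κ z (ycoord y 2) * r κ (ycoord y 3) *
        (∏ j ∈ Finset.Icc 1 (a + 2 - 2),
          (H D κ z (ycoord y (2 * j + 1) - ycoord y (2 * j)) *
            G D κ z (ycoord y (2 * j + 2) - ycoord y (2 * j + 1)) *
            r κ (ycoord y (2 * j + 3) - ycoord y (2 * j)))) *
        (H D κ z (ycoord y (2 * (a + 2) - 1) - ycoord y (2 * (a + 2) - 2)) *
          H D κ z (x - ycoord y (2 * (a + 2) - 1)) *
          r κ (x - ycoord y (2 * (a + 2) - 2))) ≤
      (X ^ a * (X * X * (1 + κ))) *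
        ∏ b ∈ Finset.range (2 * (a + 2) - 2), w b (extend 0 y) := by
    intro y
    have hprod : ∀ f : ℕ → ℝ≥0∞, ∏ b ∈ Finset.range (2 * (a + 2) - 2), f b =
        (∏ j ∈ Finset.range a, (f (2 * (j + 1)) * f (2 * (j + 1) + 1))) *
          (f (2 * 0) * f (2 * 0 + 1)) := by
      intro f
      rw [show 2 * (a + 2) - 2 = 2 * (a + 1) by omega, prod_range_two_mul,
        Finset.prod_range_succ']
    rw [hprod, prod_Icc_one, Nat.add_sub_cancel]
    have h0 : H D κ z (ycoord y 2) * r κ (ycoord y 3) ≤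
        w (2 * 0) (extend 0 y) * w (2 * 0 + 1) (extend 0 y) := by
      simp only [hw, hy]
      simpa using mul_le_mul_left (H_le_G _) _
    have hj : ∀ j, H D κ z (ycoord y (2 * (j + 1) + 1) - ycoord y (2 * (j + 1))) *
            G D κ z (ycoord y (2 * (j + 1) + 2) - ycoord y (2 * (j + 1) + 1)) *
            r κ (ycoord y (2 * (j + 1) + 3) - ycoord y (2 * (j + 1))) ≤
          X * (w (2 * (j + 1)) (extend 0 y) * w (2 * (j + 1) + 1) (extend 0 y)) := by
      intro j
      rw [mul_assoc]
      refine mul_le_mul' (hH _) (le_of_eq ?_)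
      simp only [hw, hy]
      rw [if_pos (by omega), if_neg (by omega), if_neg (by omega), if_neg (by omega)]
      rfl
    calc _ ≤ (w (2 * 0) (extend 0 y) * w (2 * 0 + 1) (extend 0 y)) *
          (∏ j ∈ Finset.range a,
            X * (w (2 * (j + 1)) (extend 0 y) * w (2 * (j + 1) + 1) (extend 0 y))) *
          (X * X * (1 + κ)) := by
          refine mul_le_mul' (mul_le_mul' h0 (Finset.prod_le_prod' fun j _ => hj j)) ?_
          exact mul_le_mul' (mul_le_mul' (hH _) (hH _)) (r_le _)
      _ = _ := by
          rw [Finset.prod_mul_distrib, Finset.prod_const, Finset.card_range]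
          ring
  refine lt_of_le_of_lt (ENNReal.tsum_le_tsum hterm) ?_
  rw [ENNReal.tsum_mul_left]
  have hsum := tsum_prod_le (0 : Vtx d) (2 * (a + 2) - 2) w K ?_ ?_
  · refine lt_of_le_of_lt (mul_le_mul_right hsum _) ?_
    have h1 : (1 + κ : ℝ≥0∞) < ∞ := ENNReal.add_lt_top.2 ⟨ENNReal.one_lt_top, ENNReal.coe_lt_top⟩
    refine ENNReal.mul_lt_top (ENNReal.mul_lt_top (ENNReal.pow_lt_top hX)
      (ENNReal.mul_lt_top (ENNReal.mul_lt_top hX hX) h1)) (ENNReal.prod_lt_top fun b _ => ?_)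
    simp only [K]
    split_ifs <;> assumption
  · intro b q q' h
    simp only [hw]
    rw [h b le_rfl, h (b - 1) (by omega), h (b - 3) (by omega)]
  · intro b q
    simp only [hw, K, Function.update_self]
    by_cases hb : b % 2 = 0
    · simp only [hb, if_true]
      by_cases h0 : b = 0
      · simp only [h0, if_true, sub_zero]; exact tsum_G_le
      · simp only [h0, if_false]
        simp only [Function.update_of_ne (show b - 1 ≠ b by omega)]
        rw [tsum_sub_right (G D κ z)]; exact tsum_G_le
    · simp only [hb, if_false]
      by_cases h0 : b = 1
      · simp only [h0, if_true, sub_zero]; exact le_rfl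
      · simp only [h0, if_false]
        simp only [Function.update_of_ne (show b - 3 ≠ b by omega)]
        rw [tsum_sub_right (r κ)]

end Finiteness

/-! ### Bounds on the factors of the lace expansion coefficients -/

section Factors

variable {d n : ℕ} {κ : ℝ≥0}

lemma enorm_U_le (ω : Walk d n) (e : ℕ × ℕ) : ‖U κ ω e‖ₑ ≤ r κ (ω.vert e.2 - ω.vert e.1) := by
  by_cases hadj : AdjacentEdges s(ω.vert e.1, ω.vert (e.1 + 1)) s(ω.vert (e.2 - 1), ω.vert e.2)
  · have hnorm := norm_sub_of_adjacentEdges hadj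
    have hne : ω.vert e.1 ≠ ω.vert e.2 := fun h => by
      rw [h, sub_self, norm_zero] at hnorm
      simp at hnorm
    rw [U, if_neg hne, if_pos hadj, r, if_pos hnorm, mul_one, zero_sub, mul_one, enorm_neg]
    rw [show ‖(κ : ℝ)‖ₑ = (κ : ℝ≥0∞) by simp [enorm]]
    exact le_add_self
  · by_cases heq : ω.vert e.1 = ω.vert e.2
    · rw [U, if_pos heq, if_neg hadj, r, if_pos (sub_eq_zero.2 heq.symm)]
      simp
    · rw [U, if_neg heq, if_neg hadj]
      simp

open Classical in
/-- The pairs in `C` whose steps are adjacent edges. -/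
def adjPairs (ω : ℕ → Vtx d) (C : Finset (ℕ × ℕ)) : Finset (ℕ × ℕ) :=
  C.filter fun e => AdjacentEdges s(ω e.1, ω (e.1 + 1)) s(ω (e.2 - 1), ω e.2)

open Classical in
-- Coincidence excludes adjacency, so a coinciding pair has U = 1 and annihilates the product; every
-- adjacent pair gives 1+κ.
lemma prod_enorm_one_sub_U_le (ω : Walk d n) (C : Finset (ℕ × ℕ)) :
    ∏ e ∈ C, ‖1 - U κ ω e‖ₑ ≤
      if ∀ e ∈ C, ω.vert e.1 ≠ ω.vert e.2 then (1 + κ : ℝ≥0∞) ^ (adjPairs ω.vert C).card else 0 := by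
  split_ifs with h
  · calc ∏ e ∈ C, ‖1 - U κ ω e‖ₑ
        ≤ ∏ e ∈ C, if AdjacentEdges s(ω.vert e.1, ω.vert (e.1 + 1))
            s(ω.vert (e.2 - 1), ω.vert e.2) then (1 + κ : ℝ≥0∞) else 1 := by
          refine Finset.prod_le_prod' fun e he => ?_
          rw [U, if_neg (h e he)]
          split_ifs with hadj
          · have : (1 - (0 - (κ : ℝ) * 1)) = ((1 + κ : ℝ≥0) : ℝ) := by push_cast; ring
            rw [this, show ‖((1 + κ : ℝ≥0) : ℝ)‖ₑ = ((1 + κ : ℝ≥0) : ℝ≥0∞) by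
              rw [Real.enorm_eq_ofReal (NNReal.coe_nonneg _), ENNReal.ofReal_coe_nnreal]]
            simp
          · simp
      _ = _ := by
          rw [Finset.prod_ite, Finset.prod_const, Finset.prod_const_one, mul_one, adjPairs]
  · push Not at h
    obtain ⟨e, he, heq⟩ := h
    refine le_of_eq (Finset.prod_eq_zero he ?_)
    have hadj : ¬ AdjacentEdges s(ω.vert e.1, ω.vert (e.1 + 1))
        s(ω.vert (e.2 - 1), ω.vert e.2) := fun hadj => by
      have hnorm := norm_sub_of_adjacentEdges hadj
      rw [heq, sub_self, norm_zero] at hnorm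
      simp at hnorm
    rw [U, if_pos heq, if_neg hadj]
    simp

open Classical in
/-- An upper bound for the contribution of the lace `L` to `π^{(m)}`. -/
def laceTerm (D : Vtx d → ℝ≥0) (κ z : ℝ≥0) (ω : Walk d n) (L : Finset (ℕ × ℕ)) : ℝ≥0∞ :=
  if ∀ e ∈ compatible 0 n L, ω.vert e.1 ≠ ω.vert e.2 then
    (∏ e ∈ L, r κ (ω.vert e.2 - ω.vert e.1)) *
      (((∏ i ∈ Finset.Ico 0 n, (z * D (ω.vert (i + 1) - ω.vert i))) *
        (1 + κ) ^ (adjPairs ω.vert (compatible 0 n L)).card : ℝ≥0) : ℝ≥0∞)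
  else 0

lemma enorm_piTerm_le (D : Vtx d → ℝ≥0) (z : ℝ≥0) (m : ℕ) (ω : Walk d n) :
    ‖piTerm D κ z m ω‖ₑ ≤ ∑ L ∈ laces 0 n m, laceTerm D κ z ω L := by
  classical
  have hpre : ‖(z : ℝ) ^ n * (ω.prob D : ℝ)‖ₑ =
      ((∏ i ∈ Finset.Ico 0 n, (z * D (ω.vert (i + 1) - ω.vert i)) : ℝ≥0) : ℝ≥0∞) := by
    rw [Finset.prod_mul_distrib, Finset.prod_const, Nat.card_Ico, Nat.sub_zero,
      ← Finset.range_eq_Ico, ← Walk.prob]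
    rw [show (z : ℝ) ^ n * (ω.prob D : ℝ) = ((z ^ n * ω.prob D : ℝ≥0) : ℝ) by push_cast; rfl,
      Real.enorm_eq_ofReal (NNReal.coe_nonneg _), ENNReal.ofReal_coe_nnreal]
  rw [piTerm, enorm_mul, hpre, J]
  refine (mul_le_mul_right (enorm_sum_le _ _) _).trans ?_
  rw [Finset.mul_sum]
  refine Finset.sum_le_sum fun L _ => ?_
  rw [enorm_mul, laceTerm]
  have hprod : ∀ (s : Finset (ℕ × ℕ)) (f : ℕ × ℕ → ℝ), ‖∏ e ∈ s, f e‖ₑ = ∏ e ∈ s, ‖f e‖ₑ := by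
    intro s f
    induction s using Finset.induction_on with
    | empty => simp
    | insert a s ha ih => rw [Finset.prod_insert ha, Finset.prod_insert ha, enorm_mul, ih]
  rw [hprod, hprod]
  have h1 : ∏ e ∈ L, ‖-U κ ω e‖ₑ ≤ ∏ e ∈ L, r κ (ω.vert e.2 - ω.vert e.1) :=
    Finset.prod_le_prod' fun e _ => by rw [enorm_neg]; exact enorm_U_le ω e
  have h2 := prod_enorm_one_sub_U_le (κ := κ) ω (compatible 0 n L)
  split_ifs at h2 ⊢ with h
  · refine (mul_le_mul_right (mul_le_mul' h1 h2) _).trans (le_of_eq ?_)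
    rw [mul_left_comm, ENNReal.coe_mul]
    simp
  · rw [nonpos_iff_eq_zero.1 h2, mul_zero, mul_zero]

end Factors

/-! ### Splitting a walk at marks -/

section Marks

variable {d : ℕ}

lemma exists_between_marks {p : ℕ → ℕ} {a b : ℕ} {v : ℕ} (hab : a ≤ b) (h1 : p a < v)
    (h2 : v ≤ p b) : ∃ c, a ≤ c ∧ c < b ∧ p c < v ∧ v ≤ p (c + 1) := by
  induction b, hab using Nat.le_induction with
  | base => omega
  | succ b hab ih =>
    rcases le_or_gt v (p b) with h | h
    · obtain ⟨c, hc⟩ := ih h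
      exact ⟨c, hc.1, by omega, hc.2.2⟩
    · exact ⟨b, hab, by omega, h, h2⟩

lemma marks_mono {p : ℕ → ℕ} {N : ℕ} (hp : ∀ b < N, p b ≤ p (b + 1)) {a b : ℕ} (hab : a ≤ b)
    (hb : b ≤ N) : p a ≤ p b := by
  induction b, hab using Nat.le_induction with
  | base => exact le_rfl
  | succ b hab ih => exact (ih (by omega)).trans (hp b (by omega))

lemma prod_marks {p : ℕ → ℕ} {N : ℕ} (hp : ∀ b < N, p b ≤ p (b + 1)) (g : ℕ → ℝ≥0) :
    ∏ i ∈ Finset.Ico (p 0) (p N), g i =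
      ∏ b ∈ Finset.range N, ∏ i ∈ Finset.Ico (p b) (p (b + 1)), g i := by
  induction N with
  | zero => simp
  | succ N ih =>
    rw [Finset.prod_range_succ, ← ih fun b hb => hp b (by omega),
      Finset.prod_Ico_consecutive _ (marks_mono hp (Nat.zero_le _) (by omega)) (hp N (by omega))]

lemma card_le_sum_marks {p : ℕ → ℕ} {N : ℕ} {C : Finset (ℕ × ℕ)}
    (hC : ∀ e ∈ C, p 0 < e.2 ∧ e.2 ≤ p N) :
    C.card ≤ ∑ b ∈ Finset.range N, (C.filter fun e => p b < e.2 ∧ e.2 ≤ p (b + 1)).card := by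
  classical
  refine le_trans (Finset.card_le_card fun e he => ?_) Finset.card_biUnion_le
  obtain ⟨c, -, hc, h⟩ := exists_between_marks (Nat.zero_le N) (hC e he).1 (hC e he).2
  exact Finset.mem_biUnion.2 ⟨c, Finset.mem_range.2 hc, Finset.mem_filter.2 ⟨he, h⟩⟩

/-- The weight of a piece of a walk, including its interactions with itself and with the earlier
steps after time `lo`, is bounded by its kernel. -/
lemma piece_le_kern (hd : 2 ≤ d) (D : Vtx d → ℝ≥0) (κ z : ℝ≥0) {ω : ℕ → Vtx d} {lo p q : ℕ}
    (hpq : p ≤ q) {hi : Prop} (hhi : hi → p < q)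
    (hlo : Set.InjOn ω (Set.Ioc lo p)) (hω : Set.InjOn ω (Set.Icc p q))
    (hsep : ∀ v j, lo < v → v ≤ p → p < j → j < q → ω v ≠ ω j) {C : Finset (ℕ × ℕ)}
    (hC : ∀ e ∈ C, lo ≤ e.1 ∧ e.1 + 1 < e.2 ∧ p < e.2 ∧ e.2 ≤ q ∧
      AdjacentEdges s(ω e.1, ω (e.1 + 1)) s(ω (e.2 - 1), ω e.2)) :
    (((∏ i ∈ Finset.Ico p q, (z * D (ω (i + 1) - ω i))) * (1 + κ) ^ C.card : ℝ≥0) : ℝ≥0∞) ≤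
      (1 + κ : ℝ≥0∞) ^ (2 * k0 d) *
        kern D κ z hi (pastVertices ω lo p q) (ω p) (ω q) (piece ω p q) := by
  have hV : ∀ v ∈ piece ω p q, v ∉ pastVertices ω lo p q := by
    rintro v hv ⟨⟨u, hu1, hu2, rfl⟩, h1, h2⟩
    obtain ⟨j, hj1, hj2, hj⟩ := mem_piece.1 hv
    have h3 : j ≠ p := by rintro rfl; exact h1 hj.symm
    have h4 : j ≠ q := by rintro rfl; exact h2 hj.symm
    exact hsep u j hu1 hu2 (by omega) (by omega) hj.symm
  rw [kern, if_pos ⟨isPath_piece hpq hω, hV, fun h => by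
    have := hhi h
    rw [length_piece]; omega⟩]
  have hcard := card_pairs_le hpq hlo hω hC
  -- The four exceptional steps of `card_pairs_le` fit into 2k₀ = 4d(d-1) because d ≥ 2.
  have h4 : 2 * (d - 1) * 4 ≤ 2 * k0 d := by
    rw [k0]
    calc 2 * (d - 1) * 4 = 2 * (2 * 2 * (d - 1)) := by ring
      _ ≤ _ := by gcongr
  rw [show (1 + κ : ℝ≥0∞) = ((1 + κ : ℝ≥0) : ℝ≥0∞) by simp, ← ENNReal.coe_pow, ← ENNReal.coe_mul,
    ENNReal.coe_le_coe, lweight, length_piece, lprob_piece D ω hpq, Finset.prod_mul_distrib,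
    Finset.prod_const, Nat.card_Ico, show q + 1 - p - 1 = q - p by omega]
  have h1 : (1 : ℝ≥0) ≤ 1 + κ := le_self_add
  calc _ ≤ z ^ (q - p) * (∏ i ∈ Finset.Ico p q, D (ω (i + 1) - ω i)) *
        (1 + κ) ^ (2 * k0 d + (adj (ledges (piece ω p q)) (ledges (piece ω p q))).ncard +
          2 * (d - 1) * (flippable (pastVertices ω lo p q) (piece ω p q)).card) := by
        refine mul_le_mul_right (pow_le_pow_right' h1 ?_) _
        omega
    _ = _ := by rw [pow_add, pow_add]; ring

end Marks

/-! ### Self-avoidance and interaction windows of the pieces cut out by a lace -/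

section LaceMarks

variable {d n m : ℕ} {L : Finset (ℕ × ℕ)} {σ τ : ℕ → ℕ}

/-- The end points of the lace edges in increasing order. -/
def mark (n m : ℕ) (σ τ : ℕ → ℕ) (b : ℕ) : ℕ :=
  if b = 2 * m - 1 then n else if b % 2 = 0 then τ (b / 2) else σ ((b + 1) / 2)

/-- The pieces that have at least one step. -/
def nontrivialPiece (m b : ℕ) : Prop := b = 0 ∨ b % 2 = 1 ∨ b = 2 * m - 2

namespace LaceSeq

variable {b : ℕ}

lemma tau_le_tau (h : LaceSeq n m L σ τ) {i j : ℕ} (hij : i ≤ j) (hj : j ≤ m) : τ i ≤ τ j :=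
  marks_mono (fun k hk => (h.tau_lt k hk).le) hij hj

lemma mark_even (h : LaceSeq n m L σ τ) {k : ℕ} : mark n m σ τ (2 * k) = τ k := by
  rw [mark]
  split_ifs with h1 h2
  -- Truncated subtraction makes `2 * m - 1` even only for `m = 0`.
  · have : m = 0 := by omega
    subst this
    have : k = 0 := by omega
    subst this
    exact h.tau_last.symm
  · congr 1; omega
  · omega

lemma mark_odd {k : ℕ} (hk : k + 1 < m) : mark n m σ τ (2 * k + 1) = σ (k + 1) := by
  rw [mark, if_neg (by omega), if_neg (by omega)]
  congr 1; omega

lemma mark_last : mark n m σ τ (2 * m - 1) = n := by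
  rw [mark, if_pos rfl]

lemma mark_bounds (h : LaceSeq n m L σ τ) (hm : 2 ≤ m) (hb : b < 2 * m - 1) :
    τ (b / 2) ≤ mark n m σ τ b ∧ mark n m σ τ b < τ (b / 2 + 1) ∧
      mark n m σ τ b ≤ mark n m σ τ (b + 1) ∧ mark n m σ τ (b + 1) ≤ τ (b / 2 + 1) ∧
      (nontrivialPiece m b → mark n m σ τ b < mark n m σ τ (b + 1)) ∧
      (b = 0 → mark n m σ τ (b + 1) < τ 1) ∧ (b = 1 → 0 < mark n m σ τ b) := by
  rcases Nat.even_or_odd' b with ⟨k, rfl | rfl⟩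
  · rw [show 2 * k / 2 = k by omega, h.mark_even]
    have hlt := h.tau_lt k (by omega)
    rcases eq_or_ne (2 * k + 1) (2 * m - 1) with hk | hk
    · rw [hk, mark_last, ← h.tau_last, show m = k + 1 by omega]
      exact ⟨le_rfl, hlt, hlt.le, le_rfl, fun _ => hlt, by omega, by omega⟩
    · rw [mark_odd (by omega)]
      have h1 := h.tau_le_sig k (by omega)
      have h2 := h.sig_lt k
      refine ⟨le_rfl, hlt, h1, h2.le, ?_, ?_, by omega⟩
      · rintro (h0 | h0 | h0)
        · obtain rfl : k = 0 := by omega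
          rw [h.tau_zero]
          exact h.sig_pos (by omega)
        · omega
        · omega
      · intro h0
        obtain rfl : k = 0 := by omega
        exact h2
  · rw [show (2 * k + 1) / 2 = k by omega, mark_odd (by omega),
      show 2 * k + 1 + 1 = 2 * (k + 1) by ring, h.mark_even]
    have h1 := h.tau_le_sig k (by omega)
    have h2 := h.sig_lt k
    refine ⟨h1, h2, h2.le, le_rfl, fun _ => h2, by omega, ?_⟩
    intro h0
    obtain rfl : k = 0 := by omega
    exact h.sig_pos (by omega)

lemma mark_zero (h : LaceSeq n m L σ τ) : mark n m σ τ 0 = 0 := by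
  have := h.mark_even (k := 0)
  rw [mul_zero] at this
  rw [this, h.tau_zero]

lemma mark_le_succ (h : LaceSeq n m L σ τ) (hm : 2 ≤ m) : ∀ b < 2 * m - 1,
    mark n m σ τ b ≤ mark n m σ τ (b + 1) := fun _ hb => (h.mark_bounds hm hb).2.2.1

variable {ω : Walk d n}

/-- Between the right end point preceding `τ (b / 2)` and the one following it, all pairs are
compatible, and consecutive vertices, which form no graph edge, differ by the definition of a walk.
The truncation of `b / 2 - 1` covers the first pieces, for which the window starts at time 0. -/
lemma vert_ne_mid (h : LaceSeq n m L σ τ) (hm : 2 ≤ m) (hb : b < 2 * m - 1)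
    (hav : ∀ e ∈ compatible 0 n L, ω.vert e.1 ≠ ω.vert e.2) {i j : ℕ} (hi : b / 2 = 0 ∨ 1 ≤ i)
    (hτ : τ (b / 2 - 1) ≤ i) (hij : i < j) (hj : j < τ (b / 2 + 1)) :
    ω.vert i ≠ ω.vert j := by
  have hn : j < n := hj.trans_le ((h.tau_le_tau (by omega) le_rfl).trans_eq h.tau_last)
  rcases (Nat.succ_le_of_lt hij).eq_or_lt with rfl | hij'
  · exact (ω.step_ne i (by omega)).symm
  · rcases Nat.eq_zero_or_pos (b / 2) with h0 | h0
    · rw [h0] at hj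
      exact hav _ (h.compatible_first i j hij' hj)
    · refine hav _ (h.compatible_mid i j (b / 2 - 1) (hi.resolve_left (by omega)) hτ hij' ?_)
      rwa [show b / 2 - 1 + 2 = b / 2 + 1 by omega]

/-- Only a right end point `τ (b / 2 + 1)` falls outside the window of `vert_ne_mid`. Pairs ending
there are compatible if they start after the left end point of the lace edge ending there, which
holds for all times in the piece. -/
lemma injOn_piece (h : LaceSeq n m L σ τ) (hm : 2 ≤ m) (hb : b < 2 * m - 1)
    (hav : ∀ e ∈ compatible 0 n L, ω.vert e.1 ≠ ω.vert e.2) :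
    Set.InjOn ω.vert (Set.Icc (mark n m σ τ b) (mark n m σ τ (b + 1))) := by
  obtain ⟨h1, h2, h3, h4, -, h6, h7⟩ := h.mark_bounds hm hb
  have hle : τ (b / 2 - 1) ≤ τ (b / 2) := h.tau_le_tau (by omega) (by omega)
  have hσ : ∀ k, σ k ≤ τ k := by
    intro k
    cases k with
    | zero => rw [h.sig_zero]; exact Nat.zero_le _
    | succ k => exact (h.sig_lt k).le
  have key : ∀ i j, mark n m σ τ b ≤ i → i < j → j ≤ mark n m σ τ (b + 1) →
      ω.vert i ≠ ω.vert j := by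
    intro i j hi hij hj
    have hpos : b / 2 = 0 ∨ 1 ≤ i := by
      rcases Nat.eq_zero_or_pos (b / 2) with h0 | h0
      · exact Or.inl h0
      · have : τ 0 < τ 1 := h.tau_lt 0 (by omega)
        have := h.tau_le_tau (show 1 ≤ b / 2 from h0) (by omega)
        omega
    rcases (hj.trans h4).eq_or_lt with hj' | hj'
    · rcases (Nat.succ_le_of_lt hij).eq_or_lt with rfl | hij'
      · refine (ω.step_ne i ?_).symm
        have := (h.tau_le_tau (show b / 2 + 1 ≤ m by omega) le_rfl).trans_eq h.tau_last
        omega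
      · rw [hj']
        refine hav _ (h.compatible_last i (b / 2) (by omega) ?_ (by omega))
        rcases Nat.lt_or_ge b 2 with hb2 | hb2
        · interval_cases b
          · have := h6 rfl
            simp only [Nat.zero_div, zero_add] at hj' this hj
            omega
          · have := h7 rfl
            simp only [Nat.reduceDiv, h.sig_zero]
            omega
        · have := h.sig_lt (b / 2 - 1)
          rw [show b / 2 - 1 + 1 = b / 2 by omega] at this
          omega
    · exact h.vert_ne_mid hm hb hav hpos (by omega) hij hj'
  intro i hi j hj hij
  by_contra hne
  rcases lt_or_gt_of_ne hne with hlt | hlt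
  · exact key i j hi.1 hlt hj.2 hij
  · exact key j i hj.1 hlt hi.2 hij.symm

/-- This is the counterpart of `vert_ne_mid`: the steps that can interact with a piece lie in the
same window in which the walk is known to be self-avoiding. -/
lemma le_of_compatible (h : LaceSeq n m L σ τ) (hm : 2 ≤ m) (hb : b < 2 * m - 1) {e : ℕ × ℕ}
    (he : e ∈ compatible 0 n L) (hlt : mark n m σ τ b < e.2) : τ (b / 2 - 1) ≤ e.1 := by
  by_contra hcon
  rcases Nat.lt_or_ge (b / 2) 2 with hb2 | hb2
  · rw [show b / 2 - 1 = 0 by omega, h.tau_zero] at hcon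
    omega
  · have h1 := h.compatible_le e he (b / 2 - 2) (by
      rw [show b / 2 - 2 + 1 = b / 2 - 1 by omega]; omega)
    rw [show b / 2 - 2 + 2 = b / 2 by omega] at h1
    have := (h.mark_bounds hm hb).1
    omega

/-- The bound on the contribution of a lace in terms of the pieces into which the end points of
its edges split the walk. -/
lemma laceTerm_le (h : LaceSeq n m L σ τ) (hd : 2 ≤ d) (hm : 2 ≤ m) (D : Vtx d → ℝ≥0)
    (κ z : ℝ≥0) :
    laceTerm D κ z ω L ≤ (∏ k ∈ Finset.range m, r κ (ω.vert (τ (k + 1)) - ω.vert (σ k))) *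
      ((1 + κ : ℝ≥0∞) ^ ((4 * m - 2) * k0 d) * ∏ b ∈ Finset.range (2 * m - 1),
        kern D κ z (nontrivialPiece m b)
          (pastVertices ω.vert (mark n m σ τ (2 * (b / 2 - 1))) (mark n m σ τ b)
            (mark n m σ τ (b + 1)))
          (ω.vert (mark n m σ τ b)) (ω.vert (mark n m σ τ (b + 1)))
          (piece ω.vert (mark n m σ τ b) (mark n m σ τ (b + 1)))) := by
  classical
  rw [laceTerm]
  split_ifs with hav
  swap
  · exact zero_le
  set p := mark n m σ τ with hp
  have hLprod : ∏ e ∈ L, r κ (ω.vert e.2 - ω.vert e.1) =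
      ∏ k ∈ Finset.range m, r κ (ω.vert (τ (k + 1)) - ω.vert (σ k)) := by
    have hL : L = (Finset.range m).image fun k => (σ k, τ (k + 1)) := by
      ext e
      rw [h.mem_iff, Finset.mem_image]
      constructor <;> rintro ⟨k, hk, he⟩
      · exact ⟨k, Finset.mem_range.2 hk, he.symm⟩
      · exact ⟨k, Finset.mem_range.1 hk, he.symm⟩
    rw [hL, Finset.prod_image]
    have hlt : ∀ i j, i < j → j < m → τ (i + 1) < τ (j + 1) := fun i j hij hj =>
      (h.tau_le_tau (show i + 1 ≤ j from hij) hj.le).trans_lt (h.tau_lt j hj)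
    intro i hi j hj hij
    have hi := Finset.mem_range.1 hi
    have hj := Finset.mem_range.1 hj
    have hij : τ (i + 1) = τ (j + 1) := congrArg Prod.snd hij
    rcases lt_trichotomy i j with h' | h' | h'
    · exact absurd hij (hlt i j h' hj).ne
    · exact h'
    · exact absurd hij (hlt j i h' hi).ne'
  rw [hLprod]
  refine mul_le_mul_right ?_ _
  have hp0 : p 0 = 0 := h.mark_zero
  have hpn : p (2 * m - 1) = n := mark_last
  have hmono := h.mark_le_succ hm
  set C := adjPairs ω.vert (compatible 0 n L) with hC
  have hCmem : ∀ e ∈ C, e ∈ compatible 0 n L ∧ e.1 + 1 < e.2 ∧ e.2 ≤ n ∧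
      AdjacentEdges s(ω.vert e.1, ω.vert (e.1 + 1)) s(ω.vert (e.2 - 1), ω.vert e.2) := by
    intro e he
    obtain ⟨he, hadj⟩ := Finset.mem_filter.1 he
    have := mem_pairs.1 (Finset.mem_filter.1 he).1
    exact ⟨he, this.2.1, this.2.2, hadj⟩
  have hcard := card_le_sum_marks (p := p) (N := 2 * m - 1) (C := C) fun e he => by
    have := hCmem e he
    rw [hp0, hpn]
    exact ⟨by omega, this.2.2.1⟩
  have hprod := prod_marks (p := p) hmono fun i => z * D (ω.vert (i + 1) - ω.vert i)
  rw [hp0, hpn] at hprod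
  have h1 : (1 : ℝ≥0) ≤ 1 + κ := le_self_add
  calc _ ≤ ((∏ b ∈ Finset.range (2 * m - 1),
        ((∏ i ∈ Finset.Ico (p b) (p (b + 1)), (z * D (ω.vert (i + 1) - ω.vert i))) *
          (1 + κ) ^ (C.filter fun e => p b < e.2 ∧ e.2 ≤ p (b + 1)).card) : ℝ≥0) : ℝ≥0∞) := by
        rw [ENNReal.coe_le_coe, hprod, Finset.prod_mul_distrib (s := Finset.range (2 * m - 1))
          (g := fun b => (1 + κ) ^ (C.filter fun e => p b < e.2 ∧ e.2 ≤ p (b + 1)).card),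
          Finset.prod_pow_eq_pow_sum]
        exact mul_le_mul_right (pow_le_pow_right' h1 hcard) _
    _ = ∏ b ∈ Finset.range (2 * m - 1),
        (((∏ i ∈ Finset.Ico (p b) (p (b + 1)), (z * D (ω.vert (i + 1) - ω.vert i))) *
          (1 + κ) ^ (C.filter fun e => p b < e.2 ∧ e.2 ≤ p (b + 1)).card : ℝ≥0) : ℝ≥0∞) := by
        rw [ENNReal.ofNNReal_finsetProd]
    _ ≤ ∏ b ∈ Finset.range (2 * m - 1), ((1 + κ : ℝ≥0∞) ^ (2 * k0 d) *
        kern D κ z (nontrivialPiece m b)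
          (pastVertices ω.vert (p (2 * (b / 2 - 1))) (p b) (p (b + 1)))
          (ω.vert (p b)) (ω.vert (p (b + 1))) (piece ω.vert (p b) (p (b + 1)))) := by
        refine Finset.prod_le_prod' fun b hb => ?_
        have hb := Finset.mem_range.1 hb
        obtain ⟨m1, m2, m3, m4, m5, -, -⟩ := h.mark_bounds hm hb
        have hlo : p (2 * (b / 2 - 1)) = τ (b / 2 - 1) := h.mark_even
        have hne : ∀ i j, p (2 * (b / 2 - 1)) < i → i < j → j < τ (b / 2 + 1) →
            ω.vert i ≠ ω.vert j := fun i j hi hij hj =>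
          h.vert_ne_mid hm hb hav (Or.inr (by omega)) (by omega) hij hj
        refine piece_le_kern hd D κ z m3 m5 ?_ (h.injOn_piece hm hb hav) ?_ ?_
        · rintro i ⟨hi1, hi2⟩ j ⟨hj1, hj2⟩ hij
          by_contra hn
          rcases lt_or_gt_of_ne hn with hlt | hlt
          · exact hne i j hi1 hlt (by omega) hij
          · exact hne j i hj1 hlt (by omega) hij.symm
        · intro v j hv1 hv2 hj1 hj2
          exact hne v j hv1 (by omega) (by omega)
        · intro e he
          obtain ⟨he, he1, he2⟩ := Finset.mem_filter.1 he
          obtain ⟨c1, c2, c3, c4⟩ := hCmem e he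
          exact ⟨hlo.trans_le (h.le_of_compatible hm hb c1 he1), c2, he1, he2, c4⟩
    _ = _ := by
        rw [Finset.prod_mul_distrib, Finset.prod_const, Finset.card_range, ← pow_mul]
        congr 2
        -- There are 2m-1 pieces, each with a factor (1+κ)^(2k₀).
        rw [show 4 * m - 2 = 2 * (2 * m - 1) by omega]
        ring

end LaceSeq

end LaceMarks

/-! ### Summation over walks and laces -/

section Assembly

variable {d m : ℕ} {D : Vtx d → ℝ≥0} {κ z : ℝ≥0} {x : Vtx d}

/-- Walks from the origin to `x`, together with a lace with `m` edges. -/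
abbrev LacedWalk (d m : ℕ) (x : Vtx d) : Type :=
  Σ p : (Σ k : ℕ, WalksTo d (k + 2) x), {L // L ∈ laces 0 (p.1 + 2) m}

lemma tsum_enorm_piTerm_le :
    ∑' p : (Σ k : ℕ, WalksTo d (k + 2) x), ‖piTerm D κ z m p.2.1‖ₑ ≤
      ∑' a : LacedWalk d m x, laceTerm D κ z a.1.2.1 a.2.1 := by
  rw [ENNReal.tsum_sigma' (f := fun a : LacedWalk d m x => laceTerm D κ z a.1.2.1 a.2.1)]
  refine ENNReal.tsum_le_tsum fun p => (enorm_piTerm_le D z m p.2.1).trans (le_of_eq ?_)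
  exact (Finset.tsum_subtype (laces 0 (p.1 + 2) m) fun L => laceTerm D κ z p.2.1 L).symm

lemma lacePi_bound {B : ℝ≥0∞} (hB : B < ∞)
    (h : ∑' a : LacedWalk d m x, laceTerm D κ z a.1.2.1 a.2.1 ≤ B) :
    LacePiConverges D κ z m x ∧ ENNReal.ofReal |lacePi D κ z m x| ≤ B := by
  have h1 := tsum_enorm_piTerm_le.trans h
  have hs : Summable fun p : Σ k : ℕ, WalksTo d (k + 2) x => ‖piTerm D κ z m p.2.1‖ := by
    have := ENNReal.tsum_coe_ne_top_iff_summable.1 (h1.trans_lt hB).ne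
    exact NNReal.summable_coe.2 this
  refine ⟨hs, ?_⟩
  have hs' := hs.of_norm
  rw [lacePi, ← hs'.tsum_sigma, ← Real.enorm_eq_ofReal_abs]
  exact (enorm_tsum_le_tsum_enorm).trans h1

lemma LaceSeq.ext {n : ℕ} {L L' : Finset (ℕ × ℕ)} {σ τ σ' τ' : ℕ → ℕ} (h : LaceSeq n m L σ τ)
    (h' : LaceSeq n m L' σ' τ') (hmark : ∀ b < 2 * m - 1, mark n m σ τ b = mark n m σ' τ' b) :
    L = L' := by
  have hτ : ∀ k < m, τ (k + 1) = τ' (k + 1) := by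
    intro k hk
    rcases eq_or_ne (k + 1) m with e | e
    · rw [e, h.tau_last, h'.tau_last]
    · rw [← h.mark_even, ← h'.mark_even, hmark _ (by omega)]
  have hσ : ∀ k < m, σ k = σ' k := by
    intro k hk
    cases k with
    | zero => rw [h.sig_zero, h'.sig_zero]
    | succ k =>
      have := hmark (2 * k + 1) (by omega)
      rwa [LaceSeq.mark_odd hk, LaceSeq.mark_odd hk] at this
  ext e
  rw [h.mem_iff, h'.mem_iff]
  constructor <;> rintro ⟨k, hk, rfl⟩
  · exact ⟨k, hk, by rw [hτ k hk, hσ k hk]⟩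
  · exact ⟨k, hk, by rw [hτ k hk, hσ k hk]⟩

lemma Walk.ext_vert {n : ℕ} {ω ω' : Walk d n} (h : ∀ i ≤ n, ω.vert i = ω'.vert i) : ω = ω' := by
  have : ω.vert = ω'.vert := by
    funext i
    rcases le_total i n with hi | hi
    · exact h i hi
    · rw [ω.const i hi, ω'.const i hi, h n le_rfl]
  cases ω
  cases ω'
  cases this
  rfl

lemma eq_of_piece_eq {ω ω' : ℕ → Vtx d} {p q i : ℕ} (h : piece ω p q = piece ω' p q)
    (h1 : p ≤ i) (h2 : i ≤ q) : ω i = ω' i :=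
  List.map_inj_left.1 h i (List.mem_range'_1.2 ⟨h1, by omega⟩)

/-! ### One lace edge -/

/-- The only lace is the single edge from 0 to n, and all other pairs avoid coincidences. Splitting
off the first step, the rest is a self-avoiding path with at least one step, which yields D*H. -/
lemma laceTerm_one_le {n : ℕ} (hd : 2 ≤ d) (hn : 2 ≤ n) {ω : Walk d n}
    (h0 : ω.vert 0 = 0) (hx : ω.vert n = x) {L : Finset (ℕ × ℕ)} (hL : L ∈ laces 0 n 1) :
    laceTerm D κ z ω L ≤ (1 + κ : ℝ≥0∞) ^ (2 * k0 d) * r κ x * (z * D (ω.vert 1)) *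
      kern D κ z True ∅ (ω.vert 1) x (piece ω.vert 1 n) := by
  classical
  have h := laceSeq_of_mem_laces hn hL
  rw [laceTerm]
  split_ifs with hav
  swap
  · exact zero_le
  have hLs : L = {(0, n)} := by
    ext e
    rw [h.mem_iff, Finset.mem_singleton]
    constructor
    · rintro ⟨k, hk, rfl⟩
      obtain rfl : k = 0 := by omega
      rw [h.sig_zero, h.tau_last]
    · rintro rfl
      exact ⟨0, by omega, by rw [h.sig_zero, h.tau_last]⟩
  have hne : ∀ i j, 1 ≤ i → i < j → j ≤ n → ω.vert i ≠ ω.vert j := by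
    intro i j hi hij hj
    rcases (Nat.succ_le_of_lt hij).eq_or_lt with rfl | hij'
    · exact (ω.step_ne i (by omega)).symm
    rcases hj.eq_or_lt with rfl | hj'
    · have := h.compatible_last i 0 (by omega) (by rw [h.sig_zero]; omega)
        (by rw [h.tau_last]; exact hij')
      rw [h.tau_last] at this
      exact hav _ this
    · exact hav _ (h.compatible_first i j hij' (by rw [h.tau_last]; exact hj'))
  have hinj : Set.InjOn ω.vert (Set.Icc 1 n) := by
    intro i hi j hj hij
    by_contra hne'
    rcases lt_or_gt_of_ne hne' with hlt | hlt
    · exact hne i j hi.1 hlt hj.2 hij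
    · exact hne j i hj.1 hlt hi.2 hij.symm
  have hpast : pastVertices ω.vert 0 1 n = ∅ := by
    refine Set.eq_empty_of_forall_notMem ?_
    rintro y ⟨⟨v, hv1, hv2, rfl⟩, h1, -⟩
    obtain rfl : v = 1 := by omega
    exact h1 rfl
  -- The only past step is the first one. It starts at `lo` and so is among the exceptional steps;
  -- the obstacle is empty.
  have hpiece := piece_le_kern hd D κ z (ω := ω.vert) (lo := 0) (p := 1) (q := n) (hi := True)
    (C := adjPairs ω.vert (compatible 0 n L)) (by omega) (fun _ => by omega)
    (hinj.mono (by rintro i ⟨h1, h2⟩; exact ⟨h1, by omega⟩)) hinj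
    (fun v j hv1 hv2 hj1 hj2 => hne v j hv1 (by omega) hj2.le)
    (fun e he => by
      obtain ⟨he, hadj⟩ := Finset.mem_filter.1 he
      have := mem_pairs.1 (Finset.mem_filter.1 he).1
      exact ⟨this.1, this.2.1, by omega, this.2.2, hadj⟩)
  rw [hpast, hx] at hpiece
  rw [hLs, Finset.prod_singleton, hx, h0, sub_zero, ← hLs,
    Finset.prod_eq_prod_Ico_succ_bot (by omega : 0 < n), zero_add, h0, sub_zero, mul_assoc,
    ENNReal.coe_mul]
  refine (mul_le_mul_right (mul_le_mul_right hpiece _) _).trans (le_of_eq ?_)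
  rw [ENNReal.coe_mul]
  ring

lemma tsum_laceTerm_one_le (hd : 2 ≤ d) {p₁ θ : ℝ≥0} (hD : ∀ v, IsGenerator v → D v = p₁)
    (hθ : θ * (1 + κ) ^ (2 * (d - 1)) ≤ z ^ 2 * p₁ ^ 2)
    (hκ : (1 + κ) ^ (2 * (d - 1) * (colours d).card) ≤ 1 + θ) :
    ∑' a : LacedWalk d 1 x, laceTerm D κ z a.1.2.1 a.2.1 ≤
      (1 + (κ : ℝ≥0∞)) ^ (2 * k0 d) * (z : ℝ≥0∞) * r κ x *
        conv (fun y => (D y : ℝ≥0∞)) (H D κ z) x := by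
  calc ∑' a : LacedWalk d 1 x, laceTerm D κ z a.1.2.1 a.2.1
      ≤ ∑' p : Vtx d × List (Vtx d), (1 + κ : ℝ≥0∞) ^ (2 * k0 d) * r κ x * (z * D p.1) *
          kern D κ z True ∅ p.1 x p.2 := by
        refine tsum_le_tsum_of_injective (fun a : LacedWalk d 1 x =>
          (a.1.2.1.vert 1, piece a.1.2.1.vert 1 (a.1.1 + 2))) ?_ ?_
        · rintro ⟨⟨k, ω, h0, hx⟩, L, hL⟩ ⟨⟨k', ω', h0', hx'⟩, L', hL'⟩ heq
          obtain ⟨-, h2⟩ := Prod.mk.inj heq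
          simp only at h2
          have hlen := congrArg List.length h2
          rw [length_piece, length_piece] at hlen
          obtain rfl : k = k' := by omega
          obtain rfl : ω = ω' := by
            refine Walk.ext_vert fun i hi => ?_
            rcases Nat.eq_zero_or_pos i with rfl | hpos
            · rw [h0, h0']
            · exact eq_of_piece_eq h2 hpos hi
          obtain rfl : L = L' := by
            have h := laceSeq_of_mem_laces (by omega) hL
            have h' := laceSeq_of_mem_laces (by omega) hL'
            refine h.ext h' fun b hb => ?_
            obtain rfl : b = 0 := by omega
            rw [h.mark_zero, h'.mark_zero]
          rfl
        · rintro ⟨⟨k, ω, h0, hx⟩, L, hL⟩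
          exact laceTerm_one_le hd (by omega) h0 hx hL
    _ = ∑' y, (1 + κ : ℝ≥0∞) ^ (2 * k0 d) * r κ x * (z * D y) *
          ∑' l, kern D κ z True ∅ y x l := by
        rw [ENNReal.tsum_prod (f := fun y l => (1 + κ : ℝ≥0∞) ^ (2 * k0 d) * r κ x * (z * D y) *
          kern D κ z True ∅ y x l)]
        simp only [ENNReal.tsum_mul_left]
    _ ≤ ∑' y, (1 + κ : ℝ≥0∞) ^ (2 * k0 d) * r κ x * (z * D y) * H D κ z (x - y) := by
        refine ENNReal.tsum_le_tsum fun y => mul_le_mul_right ?_ _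
        refine (tsum_kern_le hd hD hθ hκ True ∅ y x).trans (le_of_eq ?_)
        rw [HG, if_pos trivial]
    _ = _ := by
        rw [conv, ← ENNReal.tsum_mul_left]
        refine tsum_congr fun y => ?_
        ring

/-! ### At least two lace edges -/

/-- The positions of the walk at the marks: `0, y_2, …, y_{2m-1}, x`. -/
def pos (m : ℕ) (y : Fin (2 * m - 2) → Vtx d) (x : Vtx d) (b : ℕ) : Vtx d :=
  if b = 0 then 0 else if b = 2 * m - 1 then x else ycoord y (b + 1)

/-- The kernel of the piece `q b`, given the earlier pieces. -/
def pieceKern (D : Vtx d → ℝ≥0) (κ z : ℝ≥0) (m : ℕ) (Y : ℕ → Vtx d) (b : ℕ)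
    (q : ℕ → List (Vtx d)) : ℝ≥0∞ :=
  kern D κ z (nontrivialPiece m b)
    {x | (∃ b', 2 * (b / 2 - 1) ≤ b' ∧ b' < b ∧ x ∈ (q b').tail) ∧ x ≠ Y b ∧ x ≠ Y (b + 1)}
    (Y b) (Y (b + 1)) (q b)

/-- The factors `r` of the diagram. -/
def edgeFactor (κ : ℝ≥0) (m : ℕ) (Y : ℕ → Vtx d) : ℝ≥0∞ :=
  ∏ k ∈ Finset.range m, r κ (Y (min (2 * k + 2) (2 * m - 1)) - Y (2 * k - 1))

/-- The marks of a laced walk. -/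
def LacedWalk.mark (a : LacedWalk d m x) (b : ℕ) : ℕ :=
  ASAW.mark (a.1.1 + 2) m (laceSig a.2.1) (laceTau a.2.1) b

/-- The positions and pieces of a laced walk. -/
def LacedWalk.split (a : LacedWalk d m x) :
    (Fin (2 * m - 2) → Vtx d) × (Fin (2 * m - 1) → List (Vtx d)) :=
  (fun i => a.1.2.1.vert (a.mark (i + 1)),
    fun i => piece a.1.2.1.vert (a.mark i) (a.mark (i + 1)))

lemma LacedWalk.laceSeq (a : LacedWalk d m x) :
    LaceSeq (a.1.1 + 2) m a.2.1 (laceSig a.2.1) (laceTau a.2.1) :=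
  laceSeq_of_mem_laces (by omega) a.2.2

lemma LacedWalk.pos_split (a : LacedWalk d m x) {b : ℕ} (hb : b ≤ 2 * m - 1) :
    pos m a.split.1 x b = a.1.2.1.vert (a.mark b) := by
  rw [pos]
  split_ifs with h0 h1
  · rw [h0, LacedWalk.mark, a.laceSeq.mark_zero, a.1.2.2.1]
  · rw [h1, LacedWalk.mark, LaceSeq.mark_last, a.1.2.2.2]
  · rw [ycoord, dif_pos (by omega)]
    simp only [LacedWalk.split]
    congr 2
    omega

/-- The lengths of the pieces determine the marks, the marks determine the lace, and the pieces
determine the walk. -/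
lemma LacedWalk.split_injective (hm : 2 ≤ m) :
    Function.Injective (LacedWalk.split : LacedWalk d m x → _) := by
  intro a a' heq
  have hp : ∀ b < 2 * m - 1, piece a.1.2.1.vert (a.mark b) (a.mark (b + 1)) =
      piece a'.1.2.1.vert (a'.mark b) (a'.mark (b + 1)) := fun b hb =>
    congrFun (congrArg Prod.snd heq) ⟨b, hb⟩
  have hmark : ∀ b ≤ 2 * m - 1, a.mark b = a'.mark b := by
    intro b
    induction b with
    | zero => intro _; exact a.laceSeq.mark_zero.trans a'.laceSeq.mark_zero.symm
    | succ b ih =>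
      intro hb
      have h1 := ih (by omega)
      have h2 := congrArg List.length (hp b (by omega))
      rw [length_piece, length_piece] at h2
      have h3 : a.mark b ≤ a.mark (b + 1) := a.laceSeq.mark_le_succ hm b (by omega)
      have h4 : a'.mark b ≤ a'.mark (b + 1) := a'.laceSeq.mark_le_succ hm b (by omega)
      omega
  have hn := hmark _ le_rfl
  have hl := a.laceSeq
  have hl' := a'.laceSeq
  obtain ⟨⟨k, ω, h0, hx⟩, L, hL⟩ := a
  obtain ⟨⟨k', ω', h0', hx'⟩, L', hL'⟩ := a'
  simp only [LacedWalk.mark, LaceSeq.mark_last] at hn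
  obtain rfl : k = k' := by omega
  obtain rfl : ω = ω' := by
    refine Walk.ext_vert fun i hi => ?_
    rcases Nat.eq_zero_or_pos i with rfl | hpos
    · rw [h0, h0']
    · obtain ⟨b, -, hb, h1, h2⟩ := exists_between_marks
        (p := ASAW.mark (k + 2) m (laceSig L) (laceTau L)) (v := i) (Nat.zero_le (2 * m - 1))
        (by rw [hl.mark_zero]; exact hpos) (by rw [LaceSeq.mark_last]; exact hi)
      have h3 := hp b hb
      rw [← hmark b (by omega), ← hmark (b + 1) (by omega)] at h3
      exact eq_of_piece_eq h3 h1.le h2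
  obtain rfl : L = L' := hl.ext hl' fun b hb => hmark b hb.le
  rfl

lemma LacedWalk.laceTerm_le (hd : 2 ≤ d) (hm : 2 ≤ m) (a : LacedWalk d m x) :
    laceTerm D κ z a.1.2.1 a.2.1 ≤ (1 + κ : ℝ≥0∞) ^ ((4 * m - 2) * k0 d) *
      (edgeFactor κ m (pos m a.split.1 x) * ∏ b ∈ Finset.range (2 * m - 1),
        pieceKern D κ z m (pos m a.split.1 x) b (extend [] a.split.2)) := by
  have h := a.laceSeq
  refine (h.laceTerm_le hd hm D κ z).trans (le_of_eq ?_)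
  rw [mul_left_comm]
  congr 2
  · refine Finset.prod_congr rfl fun k hk => ?_
    have hk := Finset.mem_range.1 hk
    rw [a.pos_split (by omega), a.pos_split (by omega)]
    congr 3
    · rcases eq_or_ne (k + 1) m with e | e
      · rw [e, h.tau_last, show min (2 * k + 2) (2 * m - 1) = 2 * m - 1 by omega]
        exact LaceSeq.mark_last.symm
      · rw [show min (2 * k + 2) (2 * m - 1) = 2 * (k + 1) by omega]
        exact h.mark_even.symm
    · cases k with
      | zero => exact h.sig_zero.trans h.mark_zero.symm
      | succ k =>
        rw [show 2 * (k + 1) - 1 = 2 * k + 1 by omega]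
        exact (LaceSeq.mark_odd hk).symm
  · refine Finset.prod_congr rfl fun b hb => ?_
    have hb := Finset.mem_range.1 hb
    have hq : ∀ b < 2 * m - 1, extend [] a.split.2 b =
        piece a.1.2.1.vert (a.mark b) (a.mark (b + 1)) := fun b hb => by
      rw [extend, dif_pos hb]; rfl
    have hmono : ∀ b < 2 * m - 1, a.mark b ≤ a.mark (b + 1) := h.mark_le_succ hm
    rw [pieceKern, hq b hb, a.pos_split (by omega), a.pos_split (by omega)]
    congr 1
    ext y
    change (_ ∧ _) ↔ (_ ∧ _)
    refine and_congr_left fun _ => ?_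
    constructor
    · rintro ⟨v, h1, h2, rfl⟩
      obtain ⟨b', hb1, hb2, h3, h4⟩ :=
        exists_between_marks (show 2 * (b / 2 - 1) ≤ b by omega) h1 h2
      refine ⟨b', hb1, hb2, ?_⟩
      rw [hq b' (by omega), tail_piece, mem_piece]
      exact ⟨v, h3, h4, rfl⟩
    · rintro ⟨b', hb1, hb2, hy⟩
      rw [hq b' (by omega), tail_piece, mem_piece] at hy
      obtain ⟨v, h3, h4, rfl⟩ := hy
      have h5 := marks_mono hmono hb1 (by omega)
      have h6 := marks_mono hmono (show b' + 1 ≤ b from hb2) (by omega)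
      exact ⟨v, lt_of_le_of_lt h5 h3, h4.trans h6, rfl⟩

/-- The obstacle in `pieceKern` involves earlier pieces only, so the pieces can be summed from the
last to the first with the positions at the marks fixed. -/
lemma tsum_pieceKern_le (hd : 2 ≤ d) {p₁ θ : ℝ≥0} (hD : ∀ v, IsGenerator v → D v = p₁)
    (hθ : θ * (1 + κ) ^ (2 * (d - 1)) ≤ z ^ 2 * p₁ ^ 2)
    (hκ : (1 + κ) ^ (2 * (d - 1) * (colours d).card) ≤ 1 + θ) (N : ℕ) (Y : ℕ → Vtx d) :
    ∑' q : Fin N → List (Vtx d), ∏ b ∈ Finset.range N, pieceKern D κ z m Y b (extend [] q) ≤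
      ∏ b ∈ Finset.range N, HG D κ z (nontrivialPiece m b) (Y (b + 1) - Y b) := by
  refine tsum_prod_le [] N (pieceKern D κ z m Y) _ ?_ ?_
  · intro b q q' hqq
    rw [pieceKern, pieceKern, hqq b le_rfl]
    congr 1
    ext y
    change (_ ∧ _) ↔ (_ ∧ _)
    refine and_congr_left fun _ => exists_congr fun b' => and_congr_right fun _ =>
      and_congr_right fun hb' => ?_
    rw [hqq b' hb'.le]
  · intro b q
    refine le_trans (le_of_eq (tsum_congr fun l => ?_)) (tsum_kern_le hd hD hθ hκ _
      {x | (∃ b', 2 * (b / 2 - 1) ≤ b' ∧ b' < b ∧ x ∈ (q b').tail) ∧ x ≠ Y b ∧ x ≠ Y (b + 1)}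
      (Y b) (Y (b + 1)))
    rw [pieceKern, Function.update_self]
    congr 1
    ext y
    change (_ ∧ _) ↔ (_ ∧ _)
    refine and_congr_left fun _ => exists_congr fun b' => and_congr_right fun _ =>
      and_congr_right fun hb' => ?_
    rw [Function.update_of_ne hb'.ne]

/-- Reindexing: lace edge `k` joins marks `2 * k - 1` and `2 * k + 2`, where truncation gives mark 0
for `k = 0` and the minimum gives the end point for the last edge. Only the even pieces strictly
between the first and the last may be trivial, hence the factors `G`. -/
lemma tsum_edgeFactor_mul_eq_diagram (hm : 2 ≤ m) :
    ∑' y : Fin (2 * m - 2) → Vtx d, edgeFactor κ m (pos m y x) *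
      ∏ b ∈ Finset.range (2 * m - 1),
        HG D κ z (nontrivialPiece m b) (pos m y x (b + 1) - pos m y x b) = diagram D κ z m x := by
  obtain ⟨a, rfl⟩ := Nat.exists_eq_add_of_le' hm
  refine tsum_congr fun y => ?_
  have hpos : ∀ b, b ≠ 0 → b < 2 * a + 3 → pos (a + 2) y x b = ycoord y (b + 1) := by
    intro b h1 h2
    rw [pos, if_neg h1, if_neg (by omega)]
  have hpos0 : pos (a + 2) y x 0 = 0 := if_pos rfl
  have hposx : pos (a + 2) y x (2 * a + 3) = x := by
    rw [pos, if_neg (by omega), if_pos (by omega)]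
  have hHG : ∀ b u, (b = 0 ∨ b % 2 = 1 ∨ b = 2 * a + 2) →
      HG D κ z (nontrivialPiece (a + 2) b) u = H D κ z u := by
    intro b u hb
    rw [HG, if_pos]
    unfold nontrivialPiece
    omega
  rw [edgeFactor, Finset.prod_range_succ', Finset.prod_range_succ, prod_Icc_one,
    Nat.add_sub_cancel, show 2 * (a + 2) - 1 = 2 * (a + 1) + 1 by omega,
    show 2 * (a + 2) - 2 = 2 * a + 2 by omega, Finset.prod_range_succ', prod_range_two_mul,
    Finset.prod_range_succ]
  have e1 : ∏ k ∈ Finset.range a, r κ (pos (a + 2) y x (min (2 * (k + 1) + 2) (2 * (a + 1) + 1)) -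
      pos (a + 2) y x (2 * (k + 1) - 1)) = ∏ j ∈ Finset.range a,
        r κ (ycoord y (2 * (j + 1) + 3) - ycoord y (2 * (j + 1))) := by
    refine Finset.prod_congr rfl fun j hj => ?_
    have hj := Finset.mem_range.1 hj
    rw [show min (2 * (j + 1) + 2) (2 * (a + 1) + 1) = 2 * (j + 1) + 2 by omega,
      hpos _ (by omega) (by omega), hpos _ (by omega) (by omega)]
    rfl
  have e2 : ∏ j ∈ Finset.range a,
      (HG D κ z (nontrivialPiece (a + 2) (2 * j + 1))
          (pos (a + 2) y x (2 * j + 1 + 1) - pos (a + 2) y x (2 * j + 1)) *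
        HG D κ z (nontrivialPiece (a + 2) (2 * j + 1 + 1))
          (pos (a + 2) y x (2 * j + 1 + 1 + 1) - pos (a + 2) y x (2 * j + 1 + 1))) =
      ∏ j ∈ Finset.range a,
        (H D κ z (ycoord y (2 * (j + 1) + 1) - ycoord y (2 * (j + 1))) *
          G D κ z (ycoord y (2 * (j + 1) + 2) - ycoord y (2 * (j + 1) + 1))) := by
    refine Finset.prod_congr rfl fun j hj => ?_
    have hj := Finset.mem_range.1 hj
    rw [hHG _ _ (by omega), HG, if_neg (by unfold nontrivialPiece; omega),
      hpos _ (by omega) (by omega), hpos _ (by omega) (by omega), hpos _ (by omega) (by omega)]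
    rfl
  rw [e1, e2, Finset.prod_mul_distrib (f := fun j =>
    H D κ z (ycoord y (2 * (j + 1) + 1) - ycoord y (2 * (j + 1))) *
          G D κ z (ycoord y (2 * (j + 1) + 2) - ycoord y (2 * (j + 1) + 1)))]
  rw [hHG _ _ (by omega), hHG _ _ (by omega), hHG _ _ (by omega),
    show min (2 * (a + 1) + 2) (2 * (a + 1) + 1) = 2 * a + 3 by omega,
    show min (2 * 0 + 2) (2 * (a + 1) + 1) = 2 by omega,
    show 2 * 0 - 1 = 0 by omega, show 2 * a + 1 + 1 + 1 = 2 * a + 3 by omega,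
    show 2 * (a + 1) - 1 = 2 * a + 1 by omega, hposx, hpos0,
    hpos 2 (by omega) (by omega), hpos (0 + 1) (by omega) (by omega),
    hpos (2 * a + 1) (by omega) (by omega), hpos (2 * a + 1 + 1) (by omega) (by omega),
    sub_zero, sub_zero, show 2 * (a + 1) + 1 = 2 * a + 1 + 1 + 1 by omega]
  ring

lemma tsum_laceTerm_le (hd : 2 ≤ d) {p₁ θ : ℝ≥0} (hD : ∀ v, IsGenerator v → D v = p₁)
    (hθ : θ * (1 + κ) ^ (2 * (d - 1)) ≤ z ^ 2 * p₁ ^ 2)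
    (hκ : (1 + κ) ^ (2 * (d - 1) * (colours d).card) ≤ 1 + θ) (hm : 2 ≤ m) :
    ∑' a : LacedWalk d m x, laceTerm D κ z a.1.2.1 a.2.1 ≤
      (1 + (κ : ℝ≥0∞)) ^ ((4 * m - 2) * k0 d) * diagram D κ z m x := by
  calc ∑' a : LacedWalk d m x, laceTerm D κ z a.1.2.1 a.2.1
      ≤ ∑' p : (Fin (2 * m - 2) → Vtx d) × (Fin (2 * m - 1) → List (Vtx d)),
          (1 + κ : ℝ≥0∞) ^ ((4 * m - 2) * k0 d) *
          (edgeFactor κ m (pos m p.1 x) * ∏ b ∈ Finset.range (2 * m - 1),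
            pieceKern D κ z m (pos m p.1 x) b (extend [] p.2)) :=
        tsum_le_tsum_of_injective _ (LacedWalk.split_injective hm) fun a => a.laceTerm_le hd hm
    _ = (1 + κ : ℝ≥0∞) ^ ((4 * m - 2) * k0 d) * ∑' y : Fin (2 * m - 2) → Vtx d,
          edgeFactor κ m (pos m y x) * ∑' q : Fin (2 * m - 1) → List (Vtx d),
            ∏ b ∈ Finset.range (2 * m - 1), pieceKern D κ z m (pos m y x) b (extend [] q) := by
        rw [ENNReal.tsum_mul_left, ENNReal.tsum_prod (f := fun (y : Fin (2 * m - 2) → Vtx d)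
          (q : Fin (2 * m - 1) → List (Vtx d)) => edgeFactor κ m (pos m y x) *
            ∏ b ∈ Finset.range (2 * m - 1), pieceKern D κ z m (pos m y x) b (extend [] q))]
        simp only [ENNReal.tsum_mul_left]
    _ ≤ _ := by
        rw [← tsum_edgeFactor_mul_eq_diagram hm]
        exact mul_le_mul_right (ENNReal.tsum_le_tsum fun y =>
          mul_le_mul_right (tsum_pieceKern_le hd hD hθ hκ _ _) _) _

/-! ### The choice of `κ₀` -/

lemma IsStepDistribution.apply_generator {p₁ : ℝ≥0} (hD : IsStepDistribution D p₁) {v : Vtx d}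
    (hv : IsGenerator v) : D v = p₁ := by
  obtain ⟨i, rfl | rfl⟩ := hv
  · exact hD.single i
  · rw [← hD.single i, ← hD.symm 1 (fun _ => -1) (Pi.single i 1)]
    congr 1
    funext j
    simp

lemma exists_kappa (d : ℕ) {p₁ : ℝ≥0} (hp₁ : 0 < p₁) :
    ∃ κ₀ : ℝ≥0, 0 < κ₀ ∧ ∀ κ ≤ κ₀, (1 + κ) ^ (2 * (d - 1) * (colours d).card) ≤
      1 + p₁ ^ 2 * ((1 + κ) ^ (2 * (d - 1) * 3))⁻¹ := by
  have hne : ∀ κ : ℝ≥0, (1 + κ) ^ (2 * (d - 1) * 3) ≠ 0 := fun κ => by positivity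
  have hf : Continuous fun κ : ℝ≥0 => (1 + κ) ^ (2 * (d - 1) * (colours d).card) := by fun_prop
  have hg : Continuous fun κ : ℝ≥0 => 1 + p₁ ^ 2 * ((1 + κ) ^ (2 * (d - 1) * 3))⁻¹ := by
    have : Continuous fun κ : ℝ≥0 => (1 + κ) ^ (2 * (d - 1) * 3) := by fun_prop
    exact continuous_const.add (continuous_const.mul (this.inv₀ hne))
  -- At κ = 0 the inequality reads 1 < 1 + p₁². Since the left side increases and the right side
  -- decreases in κ, one small κ₀ settles all smaller values.
  have hev := (hf.tendsto 0).eventually_lt (hg.tendsto 0) (by simpa using pow_pos hp₁ 2)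
  obtain ⟨κ₀, h1, h2⟩ := ((hev.filter_mono nhdsWithin_le_nhds).and
    (self_mem_nhdsWithin (s := Set.Ioi (0 : ℝ≥0)))).exists
  refine ⟨κ₀, h2, fun κ hκ => ?_⟩
  calc (1 + κ) ^ (2 * (d - 1) * (colours d).card)
      ≤ (1 + κ₀) ^ (2 * (d - 1) * (colours d).card) := by gcongr
    _ ≤ _ := h1.le
    _ ≤ _ := by
        have : 0 < (1 + κ) ^ (2 * (d - 1) * 3) := pos_iff_ne_zero.2 (hne κ)
        gcongr

/-- The chosen θ is p₁²z₀³, and (1+κ)^(2(d-1)) = 1/z₀, so the left side is p₁²z₀². This is where the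
lower bound on z is used. -/
lemma theta_le (d : ℕ) {p₁ : ℝ≥0} (hz : z0 d κ ≤ z) :
    p₁ ^ 2 * ((1 + κ) ^ (2 * (d - 1) * 3))⁻¹ * (1 + κ) ^ (2 * (d - 1)) ≤ z ^ 2 * p₁ ^ 2 := by
  have hne : (1 + κ) ^ (2 * (d - 1)) ≠ 0 := by positivity
  calc p₁ ^ 2 * ((1 + κ) ^ (2 * (d - 1) * 3))⁻¹ * (1 + κ) ^ (2 * (d - 1))
      = (z0 d κ) ^ 2 * p₁ ^ 2 := by
        rw [z0, pow_mul _ _ 3]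
        field_simp
    _ ≤ _ := by gcongr

end Assembly

end ASAW

end

theorem mainTheorem5 (d : ℕ) (hd : 2 ≤ d) (p₁ : ℝ≥0) (hp₁ : 0 < p₁) :
    ∃ κ₀ : ℝ≥0, 0 < κ₀ ∧
      ∀ D : ASAW.Vtx d → ℝ≥0, ASAW.IsStepDistribution D p₁ →
      ∀ κ : ℝ≥0, κ ≤ κ₀ →
      ∀ z : ℝ≥0, ASAW.z0 d κ ≤ z → (z : ℝ≥0∞) < ASAW.zc D κ →
      ∀ x : ASAW.Vtx d,
        (ASAW.LacePiConverges D κ z 1 x ∧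
          ASAW.conv (fun y => (D y : ℝ≥0∞)) (ASAW.H D κ z) x < ∞ ∧
          ENNReal.ofReal |ASAW.lacePi D κ z 1 x| ≤
            (1 + (κ : ℝ≥0∞)) ^ (2 * ASAW.k0 d) * (z : ℝ≥0∞) * ASAW.r κ x *
              ASAW.conv (fun y => (D y : ℝ≥0∞)) (ASAW.H D κ z) x) ∧
        ∀ m : ℕ, 2 ≤ m →
          ASAW.LacePiConverges D κ z m x ∧
          ASAW.diagram D κ z m x < ∞ ∧
          ENNReal.ofReal |ASAW.lacePi D κ z m x| ≤
            (1 + (κ : ℝ≥0∞)) ^ ((4 * m - 2) * ASAW.k0 d) * ASAW.diagram D κ z m x := by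
  obtain ⟨κ₀, hκ₀, hκ⟩ := ASAW.exists_kappa d hp₁
  refine ⟨κ₀, hκ₀, fun D hD κ hκκ₀ z hz0 hzc x => ?_⟩
  have hgen : ∀ v, ASAW.IsGenerator v → D v = p₁ := fun v hv => hD.apply_generator hv
  have hθ := ASAW.theta_le d (p₁ := p₁) hz0
  have hκ' := hκ κ hκκ₀
  have h1 : (1 + (κ : ℝ≥0∞)) < ∞ :=
    ENNReal.add_lt_top.2 ⟨ENNReal.one_lt_top, ENNReal.coe_lt_top⟩
  constructor
  · have hconv := ASAW.conv_lt_top hD hzc x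
    have hB := ENNReal.mul_lt_top (ENNReal.mul_lt_top (ENNReal.mul_lt_top
      (ENNReal.pow_lt_top (n := 2 * ASAW.k0 d) h1) (ENNReal.coe_lt_top (r := z)))
      ((ASAW.r_le x).trans_lt h1)) hconv
    have := ASAW.lacePi_bound hB (ASAW.tsum_laceTerm_one_le hd hgen hθ hκ')
    exact ⟨this.1, hconv, this.2⟩
  · intro m hm
    have hdiag := ASAW.diagram_lt_top hzc hm x
    have hB := ENNReal.mul_lt_top (ENNReal.pow_lt_top (n := (4 * m - 2) * ASAW.k0 d) h1) hdiag
    have := ASAW.lacePi_bound hB (ASAW.tsum_laceTerm_le hd hgen hθ hκ' hm)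
    exact ⟨this.1, hdiag, this.2⟩
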